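/- **Setting.** Let $c>0$, $w\in\mathbb R$, and consider on $\Omega=(a,b)$, $0\le t\le T$, the system $$u_t+wu_x-v=0,\qquad v_t+wv_x-c^2u_{xx}=0 ,$$ either with periodic boundary conditions, or with physical boundaries and $w\neq0$: with $n=\mp1$ the outward normal at $a$, $b$, one has $u=0$ at the inflow end ($wn<0$) and $v+\xi n u_x=0$ at the outflow end ($wn>0$), where $\xi>0$ and $|w|\le 2c^2\xi/(c^2+\xi^2)$. Let $(u,v)$ be a classical solution ($u$ of class $C^2$, $v$ of class $C^1$ on $[0,T]\times[a,b]$) with $u(\cdot,t)\in H^{q+2}(\Omega)$, $v(\cdot,t)\in H^{q+1}(\Omega)$ for all $t\in[0,T]$, where $q\ge1$. Let $a=x_0<\dots<x_N=b$ be a mesh, $\Omega_j=(x_{j-1},x_j)$, $h\ge\max_j(x_j-x_{j-1})$. At an interior node (and at the periodic seam), with element $1$ on the left, element $2$ on the right, $[[v]]=v_1-v_2$, $[[u_x]]=u_{x,1}-u_{x,2}$, put $$v^*=\alpha v_1+(1-\alpha)v_2-\eta[[u_x]],\qquad u_x^*=-\beta[[v]]+(1-\alpha)u_{x,1}+\alpha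 u_{x,2},$$ where $0\le\alpha\le1$, $\beta,\eta\ge0$, $$\alpha(1-\alpha)=\beta\eta ,\qquad w^2(c^2\beta+\eta)^2\le 4c^2\big(\eta+w(\tfrac12-\alpha)\big)\big(c^2\beta-w(\tfrac12-\alpha)\big).$$ (The last condition is the subsonic condition under which this flux does not create energy.) At physical boundaries the flux is determined by $v^*-\xi n u_x^*=v-\xi n u_x$ together with $v^*=w u_x^*$ at inflow and $v^*+\xi n u_x^*=0$ at outflow. The semidiscrete solution $(u^h,v^h)$ is, on each $\Omega_j$, a pair of polynomials in $x$ of degrees at most $q$ and $s=q-1$, with coefficients differentiable in $t\in[0,T]$, such that for all $t\in[0,T]$, all piecewise polynomials $\phi_u,\phi_v$ of degrees at most $q$, $q-1$ and all piecewise constants $\tilde\phi$, $$\sum_j\int_{\Omega_j}\Big[c^2\phi_u'\,\partial_x(u^h_t+wu^h_x-v^h)+\tilde\phi\,(u^h_t+wu^h_x-v^h)+\phi_v(v^h_t+wv^h_x)+c^2\phi_v'u^h_x\Big]$$ $$=\sum_j\sum_{\partial\Omega_j}\Big[c^2(v^*-v^h)\phi_u'n+c^2\phi_vu_x^*n-c^2\phi_u'(u_x^*-u_x^h)wn-(v^*-v^h)\phi_vwn\Big].$$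 **Projection.** For $f\in C^1[a,b]$, $g\in C[a,b]$ the projection $(\tilde u^h,\tilde v^h)$ of $(f,g)$ is, on each $\Omega_j$, a pair of polynomials of degrees at most $q$, $q-1$ such that $\delta_u=\tilde u^h-f$, $\delta_v=\tilde v^h-g$ satisfy $$\int_{\Omega_j}\phi\,\partial_x\delta_u=\int_{\Omega_j}\phi\,\delta_v=\int_{\Omega_j}\delta_u=0\quad\text{for all polynomials }\phi\text{ of degree at most }q-2\ (\phi=0\text{ if }q=1),$$ $$(1+\beta-\alpha)\delta_v+(\eta+\alpha)\partial_x\delta_u=0\ \text{ at }x_{j-1},\qquad(\beta+\alpha)\delta_v-(1+\eta-\alpha)\partial_x\delta_u=0\ \text{ at }x_j,$$ except that at a physical boundary point the end point condition is replaced by $\delta_v-\xi n\,\partial_x\delta_u=0$. **Theorem.** 1. The projection of $(f,g)$ exists and is unique, and the fluxes $\delta_v^*$, $(\partial_x\delta_u)^*$ built from the traces of $\delta_v,\partial_x\delta_u$ vanish at every node. 2. There is a constant $C>0$, depending only on $q$, the type of boundary condition and the parameters $c,w,\alpha,\beta,\eta,\xi$ (not on the mesh, $h$, $T$, $\Omega$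 or the solution), such that the following holds. Let $(\tilde u^h,\tilde v^h)(t)$ be the projection of $(u,v)(\cdot,t)$, $\tilde e_u=\tilde u^h-u^h$, $\tilde e_v=\tilde v^h-v^h$, and $\mathcal E^h=\frac12\sum_j\int_{\Omega_j}\tilde e_v^2+c^2(\partial_x\tilde e_u)^2$. Then $\mathcal E^h$ is differentiable on $[0,T]$ and $$\frac{d\mathcal E^h}{dt}\le Ch^q\sqrt{\mathcal E^h}\,\Big(|u(\cdot,t)|^2_{H^{q+2}(\Omega)}+|v(\cdot,t)|^2_{H^{q+1}(\Omega)}\Big)^{1/2}.$$ If moreover $(u^h,v^h)=(\tilde u^h,\tilde v^h)$ at $t=0$, then the energy-norm error is of the optimal order $h^q$: whenever $|u(\cdot,t)|^2_{H^{q+2}(\Omega)}+|v(\cdot,t)|^2_{H^{q+1}(\Omega)}\le M$ for all $t\le T$, $$\|\partial_x(u-u^h)(\cdot,T)\|^2_{L^2(\Omega)}+\|(v-v^h)(\cdot,T)\|^2_{L^2(\Omega)}\le Ch^{2q}\Big(|u(\cdot,T)|^2_{H^{q+1}(\Omega)}+|v(\cdot,T)|^2_{H^q(\Omega)}+T^2M\Big).$$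 ($\partial_x u^h$ and the norms are taken element by element.) 3. For $\xi>0$ the Sommerfeld flux $\alpha=\frac12$, $\beta=\frac1{2\xi}$, $\eta=\frac\xi2$ satisfies $\alpha(1-\alpha)=\beta\eta$, and for it the subsonic condition above is equivalent to $|w|\le 2c^2\xi/(c^2+\xi^2)$. -/

import Mathlib

open Set MeasureTheory Polynomial
open scoped ContDiff

noncomputable section

namespace AdvectiveDG

/-! ### Sobolev spaces on a bounded interval `(a, b)` -/

/-- `f, g ∈ L²(a,b)` and `g` is the weak derivative of order `k` of `f` on `(a,b)`. -/
def HasL2WeakDeriv (k : ℕ) (f g : ℝ → ℝ) (a b : ℝ) : Prop :=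
  MemLp f 2 (volume.restrict (Ioo a b)) ∧ MemLp g 2 (volume.restrict (Ioo a b)) ∧
  ∀ φ : ℝ → ℝ, ContDiff ℝ ∞ φ → HasCompactSupport φ → tsupport φ ⊆ Ioo a b →
    ∫ x in a..b, f x * iteratedDeriv k φ x = (-1) ^ k * ∫ x in a..b, g x * φ x

/-- `f ∈ H^k(a,b)`: all weak derivatives up to order `k` exist in `L²(a,b)`. -/
def MemSobolev (k : ℕ) (f : ℝ → ℝ) (a b : ℝ) : Prop :=
  ∀ i ≤ k, ∃ g : ℝ → ℝ, HasL2WeakDeriv i f g a b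

open Classical in
/-- The weak derivative of order `k` in `L²(a,b)` (unique almost everywhere), if there is one. -/
def weakDeriv (k : ℕ) (f : ℝ → ℝ) (a b : ℝ) : ℝ → ℝ :=
  if h : ∃ g : ℝ → ℝ, HasL2WeakDeriv k f g a b then h.choose else 0

/-- The Sobolev seminorm `|f|_{H^k(a,b)}`. -/
def sobolevSeminorm (k : ℕ) (f : ℝ → ℝ) (a b : ℝ) : ℝ :=
  Real.sqrt (∫ x in a..b, (weakDeriv k f a b x) ^ 2)

/-! ### The problem and its numerical fluxes -/

/-- Wave speed `c`, advection velocity `w`, inter-element flux parameters `α, β, η`, and the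
impedance `ξ` used in the flux at physical boundaries. -/
structure Params where
  c : ℝ
  w : ℝ
  α : ℝ
  β : ℝ
  η : ℝ
  ξ : ℝ

/-- Either the two end points are identified, or they are physical boundaries: a Dirichlet
condition at the inflow end, a radiation condition at the outflow end. -/
inductive BoundaryType
  | periodic
  | physical

/-- One-sided traces of `v` and of `p = ∂u/∂x` at a point. -/
structure Trace where
  v : ℝ
  p : ℝ

/-- The inter-element flux `(v*, ∂u*/∂x)` from the traces of the left element `L` (element 1,
outward normal `+1`) and of the right element `R` (element 2, outward normal `-1`), so that
`[[v]] = L.v - R.v` and `[[∂u/∂x]] = L.p - R.p`. -/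
def interFlux (P : Params) (L R : Trace) : Trace where
  v := P.α * L.v + (1 - P.α) * R.v - P.η * (L.p - R.p)
  p := -P.β * (L.v - R.v) + ((1 - P.α) * L.p + P.α * R.p)

/-- The flux at an inflow boundary with outward normal `n = ±1`: the solution of
`v* - w p* = 0`, `v* - ξ n p* = v - ξ n p`. -/
def inflowFlux (P : Params) (n : ℝ) (S : Trace) : Trace where
  v := P.w * n / (P.ξ - P.w * n) * (P.ξ * (S.p * n) - S.v)
  p := n * ((P.ξ * (S.p * n) - S.v) / (P.ξ - P.w * n))

/-- The flux at an outflow boundary with outward normal `n = ±1`: the solution of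
`v* + ξ n p* = 0`, `v* - ξ n p* = v - ξ n p`. -/
def outflowFlux (P : Params) (n : ℝ) (S : Trace) : Trace where
  v := (S.v - P.ξ * (S.p * n)) / 2
  p := n * ((P.ξ * (S.p * n) - S.v) / (2 * P.ξ))

open Classical in
/-- The flux at a physical boundary with outward normal `n`; inflow means `w n < 0`. -/
def boundaryFlux (P : Params) (n : ℝ) (S : Trace) : Trace :=
  if P.w * n < 0 then inflowFlux P n S else outflowFlux P n S

/-- The flux at the node `x_i`, `0 ≤ i ≤ N`, of a mesh with the elements `(x_j, x_{j+1})`, `j < N`.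
`trL j` and `trR j` are the traces, from inside element `j`, at its left and its right end. -/
def nodeFlux (P : Params) (bc : BoundaryType) (N : ℕ) (trL trR : ℕ → Trace) (i : ℕ) : Trace :=
  if 0 < i ∧ i < N then interFlux P (trR (i - 1)) (trL i)
  else match bc with
    | .periodic => interFlux P (trR (N - 1)) (trL 0)
    | .physical =>
        if i = 0 then boundaryFlux P (-1) (trL 0) else boundaryFlux P 1 (trR (N - 1))

/-! ### The semidiscrete scheme -/

/-- The trace at `y` of a pair of polynomials `(u, v)`. -/
def polyTrace (u v : ℝ[X]) (y : ℝ) : Trace where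
  v := v.eval y
  p := (derivative u).eval y

/-- The boundary part of the variational form at an end point `y` with outward normal `n`, where
the flux is `S` and the traces of the approximation from inside are `s`. -/
def faceTerm (P : Params) (φu φv : ℝ[X]) (s S : Trace) (y n : ℝ) : ℝ :=
  P.c ^ 2 * (S.v - s.v) * ((derivative φu).eval y * n)
    + P.c ^ 2 * φv.eval y * (S.p * n)
    - P.c ^ 2 * (derivative φu).eval y * (S.p - s.p) * (P.w * n)
    - (S.v - s.v) * φv.eval y * (P.w * n)

/-- The volume part of the variational form on the element `(y, z)`. The test function `φc` is a
constant; `ut, vt` are the time derivatives of `u, v`. -/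
def volumeTerm (P : Params) (φu φv : ℝ[X]) (φc : ℝ) (u v ut vt : ℝ[X]) (y z : ℝ) : ℝ :=
  ∫ x in y..z,
    (P.c ^ 2 * (derivative φu).eval x * (derivative (ut + C P.w * derivative u - v)).eval x
      + φc * (ut + C P.w * derivative u - v).eval x
      + φv.eval x * vt.eval x
      + φv.eval x * (P.w * (derivative v).eval x)
      + P.c ^ 2 * (derivative φv).eval x * (derivative u).eval x)

/-- The form `𝓑((φ_u, φ_v, φ_c), (u, v))` of the method, where `ut, vt` are the time derivatives
of `u, v`; all arguments are given element by element. -/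
def formB (P : Params) (bc : BoundaryType) (N : ℕ) (x : ℕ → ℝ)
    (φu φv : ℕ → ℝ[X]) (φc : ℕ → ℝ) (u v ut vt : ℕ → ℝ[X]) : ℝ :=
  let trL : ℕ → Trace := fun j => polyTrace (u j) (v j) (x j)
  let trR : ℕ → Trace := fun j => polyTrace (u j) (v j) (x (j + 1))
  (∑ j ∈ Finset.range N,
      volumeTerm P (φu j) (φv j) (φc j) (u j) (v j) (ut j) (vt j) (x j) (x (j + 1)))
    - ∑ j ∈ Finset.range N,
      (faceTerm P (φu j) (φv j) (trL j) (nodeFlux P bc N trL trR j) (x j) (-1)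
        + faceTerm P (φu j) (φv j) (trR j) (nodeFlux P bc N trL trR (j + 1)) (x (j + 1)) 1)

/-- `(U, V)` solves the semidiscrete problem on `[0, T]` with piecewise polynomials of degree at
most `q` for `u` and at most `q - 1` for `v`. -/
def IsDGSolution (P : Params) (bc : BoundaryType) (q N : ℕ) (x : ℕ → ℝ) (T : ℝ)
    (U V : ℝ → ℕ → ℝ[X]) : Prop :=
  (∀ t ∈ Icc 0 T, ∀ j < N, (U t j).degree ≤ (q : WithBot ℕ) ∧ (V t j).degree < (q : WithBot ℕ)) ∧
  ∃ Ut Vt : ℝ → ℕ → ℝ[X],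
    (∀ t ∈ Icc 0 T, ∀ j < N, ∀ k : ℕ,
      HasDerivWithinAt (fun s => (U s j).coeff k) ((Ut t j).coeff k) (Icc 0 T) t ∧
      HasDerivWithinAt (fun s => (V s j).coeff k) ((Vt t j).coeff k) (Icc 0 T) t) ∧
    ∀ t ∈ Icc 0 T, ∀ (φu φv : ℕ → ℝ[X]) (φc : ℕ → ℝ),
      (∀ j < N, (φu j).degree ≤ (q : WithBot ℕ) ∧ (φv j).degree < (q : WithBot ℕ)) →
      formB P bc N x φu φv φc (U t) (V t) (Ut t) (Vt t) = 0

/-! ### The exact solution -/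

/-- The condition on the exact solution at a physical boundary point `y` with outward normal `n`,
where `g, p` are the values of `v, ∂u/∂x` there and `f` is the value of `u`. -/
def PhysicalCondition (P : Params) (n f g p : ℝ) : Prop :=
  (P.w * n < 0 → f = 0) ∧ (0 < P.w * n → g + P.ξ * (p * n) = 0)

/-- `(u, v)`, as functions of `t` and `x`, is a classical solution on `[0,T] × [a,b]` of
`u_t + w u_x - v = 0`, `v_t + w v_x - c² u_xx = 0` with the given boundary conditions. -/
structure IsClassicalSolution (P : Params) (bc : BoundaryType) (a b T : ℝ)
    (u v : ℝ → ℝ → ℝ) : Prop where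
  contDiff_u : ContDiffOn ℝ 2 (Function.uncurry u) (Icc 0 T ×ˢ Icc a b)
  contDiff_v : ContDiffOn ℝ 1 (Function.uncurry v) (Icc 0 T ×ˢ Icc a b)
  eq_u : ∀ t ∈ Icc 0 T, ∀ x ∈ Icc a b,
    derivWithin (fun s => u s x) (Icc 0 T) t + P.w * derivWithin (u t) (Icc a b) x - v t x = 0
  eq_v : ∀ t ∈ Icc 0 T, ∀ x ∈ Icc a b,
    derivWithin (fun s => v s x) (Icc 0 T) t + P.w * derivWithin (v t) (Icc a b) x
      - P.c ^ 2 * iteratedDerivWithin 2 (u t) (Icc a b) x = 0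
  boundary : ∀ t ∈ Icc 0 T,
    match bc with
    | .periodic => u t a = u t b ∧ v t a = v t b ∧
        derivWithin (u t) (Icc a b) a = derivWithin (u t) (Icc a b) b
    | .physical =>
        PhysicalCondition P (-1) (u t a) (v t a) (derivWithin (u t) (Icc a b) a) ∧
        PhysicalCondition P 1 (u t b) (v t b) (derivWithin (u t) (Icc a b) b)

/-! ### The projection -/

/-- The trace at `y` of `(δ_u, δ_v) = (pu - f, pv - g)`; `f, g` are functions on `[a,b]`. -/
def errTrace (a b : ℝ) (f g : ℝ → ℝ) (pu pv : ℝ[X]) (y : ℝ) : Trace where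
  v := pv.eval y - g y
  p := (derivative pu).eval y - derivWithin f (Icc a b) y

/-- The end point condition of the projection at the left end of an element. At a physical
boundary it is `δ_v - ξ n ∂δ_u/∂x = 0` with `n = -1`. -/
def LeftCondition (P : Params) (bc : BoundaryType) (j : ℕ) (δ : Trace) : Prop :=
  match bc, j with
  | .physical, 0 => δ.v + P.ξ * δ.p = 0
  | _, _ => (1 + P.β - P.α) * δ.v + (P.η + P.α) * δ.p = 0

open Classical in
/-- The end point condition of the projection at the right end of an element. At a physical
boundary it is `δ_v - ξ n ∂δ_u/∂x = 0` with `n = 1`. -/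
def RightCondition (P : Params) (bc : BoundaryType) (N j : ℕ) (δ : Trace) : Prop :=
  if bc = .physical ∧ j + 1 = N then δ.v - P.ξ * δ.p = 0
  else (P.β + P.α) * δ.v - (1 + P.η - P.α) * δ.p = 0

/-- `(pu, pv)` is the projection of `(f, g)` on the element `(x_j, x_{j+1})`. -/
structure IsProjection (P : Params) (bc : BoundaryType) (q N : ℕ) (x : ℕ → ℝ) (j : ℕ)
    (f g : ℝ → ℝ) (pu pv : ℝ[X]) : Prop where
  degree_u : pu.degree ≤ (q : WithBot ℕ)
  degree_v : pv.degree < (q : WithBot ℕ)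
  orth_u : ∀ φ : ℝ[X], φ.degree < ((q - 1 : ℕ) : WithBot ℕ) →
    ∫ y in (x j)..(x (j + 1)), φ.eval y * (errTrace (x 0) (x N) f g pu pv y).p = 0
  orth_v : ∀ φ : ℝ[X], φ.degree < ((q - 1 : ℕ) : WithBot ℕ) →
    ∫ y in (x j)..(x (j + 1)), φ.eval y * (errTrace (x 0) (x N) f g pu pv y).v = 0
  mean_u : ∫ y in (x j)..(x (j + 1)), (pu.eval y - f y) = 0
  left_end : LeftCondition P bc j (errTrace (x 0) (x N) f g pu pv (x j))
  right_end : RightCondition P bc N j (errTrace (x 0) (x N) f g pu pv (x (j + 1)))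

/-- The energy `𝓔^h` of `(e_u, e_v) = (pu - u^h, pv - v^h)`. -/
def errorEnergy (P : Params) (N : ℕ) (x : ℕ → ℝ) (pu pv uh vh : ℕ → ℝ[X]) : ℝ :=
  1 / 2 * ∑ j ∈ Finset.range N, ∫ y in (x j)..(x (j + 1)),
    (((pv j - vh j).eval y) ^ 2 + P.c ^ 2 * ((derivative (pu j - uh j)).eval y) ^ 2)

/-- The squared energy-norm error `‖∂(f - u^h)/∂x‖² + ‖g - v^h‖²` in `L²`. -/
def energyNormErrorSq (N : ℕ) (x : ℕ → ℝ) (f g : ℝ → ℝ) (uh vh : ℕ → ℝ[X]) : ℝ :=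
  ∑ j ∈ Finset.range N, ∫ y in (x j)..(x (j + 1)),
    ((derivWithin f (Icc (x 0) (x N)) y - (derivative (uh j)).eval y) ^ 2
      + (g y - (vh j).eval y) ^ 2)

/-- The subsonic condition under which the inter-element flux does not create energy. -/
def FluxStable (P : Params) : Prop :=
  P.w ^ 2 * (P.c ^ 2 * P.β + P.η) ^ 2 ≤
    4 * P.c ^ 2 * (P.η + P.w * (1 / 2 - P.α)) * (P.c ^ 2 * P.β - P.w * (1 / 2 - P.α))

/-- The assumptions on the parameters. -/
structure Admissible (P : Params) (bc : BoundaryType) : Prop where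
  c_pos : 0 < P.c
  α_nonneg : 0 ≤ P.α
  α_le_one : P.α ≤ 1
  β_nonneg : 0 ≤ P.β
  η_nonneg : 0 ≤ P.η
  flux : P.α * (1 - P.α) = P.β * P.η
  stable : FluxStable P
  physical : bc = .physical →
    P.w ≠ 0 ∧ 0 < P.ξ ∧ |P.w| ≤ 2 * P.c ^ 2 * P.ξ / (P.c ^ 2 + P.ξ ^ 2)

/-- The parameters of the Sommerfeld flux with impedance `ξ`. -/
def sommerfeld (c w ξ : ℝ) : Params where
  c := c
  w := w
  α := 1 / 2
  β := 1 / (2 * ξ)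
  η := ξ / 2
  ξ := ξ

end AdvectiveDG

end

/-! Put `p = ∂u/∂x`. The energy only sees `p` and `v`, and these satisfy the first order system `p_t
= v_x - w p_x`, `v_t = c² p_x - w v_x`. With `ψ = φ_u'`, `χ = φ_v` and zero constant test function,
integration by parts turns the scheme into `weakElement`: space derivatives fall on the test
polynomials only, and the elements interact through the fluxes only.

Write the discrete error as `ẽ = δ - (u^h - u)`, with `δ` the projection error. The exact solution
satisfies the weak form because the fluxes are consistent with it, the scheme does so by definition,
and all fluxes are linear. Hence `ẽ` and `δ` have the same weak form. In that of `δ` nearly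
everything vanishes: `ψ'` and `χ'` have degree at most `q - 2`, so the orthogonality conditions
remove the volume terms, and the end point conditions make every flux of `δ` zero. Only the pairing
of the test functions with the time derivative of `δ` remains. Testing with `ẽ` itself gives the
derivative of the energy plus nodal terms, which are nonnegative by `Admissible.energy_dissipation`.
This is `errorEnergy_deriv_le`.

The identity `α(1-α) = βη` says that the matrix by which one side of a node enters the flux is
singular; a single condition per side therefore suffices to annihilate both flux components
(`Admissible.left_zero`, `Admissible.right_zero`).

For the size of `δ`, the two end point combinations of `δ_v` and `δ_p` decouple the projection into
two scalar Gauss–Radau projections, each interpolating at one end (`isPairProjection_iff`). Their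
error is bounded by comparison with the Taylor polynomial at the interpolation point
(`IsRadau.integral_sq_le`). The projection is linear in finitely many moments and point values, so
it commutes with the time derivative: the time derivative of `δ` is the projection error of `(v_x -
w p_x, c² p_x - w v_x)`. The `q`-th weak derivatives of this pair combine those of `u` of order
`q+2` and of `v` of order `q+1`, which gives the rate `h^q`.

Finally the energy inequality bounds the growth of the square root of the energy
(`le_sq_of_deriv_le_mul_sqrt`), and the triangle inequality with the projection error at time `T`
yields the error estimate. -/

namespace AdvectiveDG

/-! ### Weak derivatives in one dimension -/

theorem exists_Icc_superset_of_isCompact {K : Set ℝ} {a b : ℝ} (hab : a < b) (hK : IsCompact K)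
    (hsub : K ⊆ Ioo a b) : ∃ a' b', a < a' ∧ a' ≤ b' ∧ b' < b ∧ K ⊆ Icc a' b' := by
  rcases K.eq_empty_or_nonempty with rfl | hne
  · exact ⟨(a + b) / 2, (a + b) / 2, by linarith, le_rfl, by linarith, empty_subset _⟩
  · obtain ⟨l, hl, hl'⟩ := hK.exists_isLeast hne
    obtain ⟨g, hg, hg'⟩ := hK.exists_isGreatest hne
    exact ⟨l, g, (hsub hl).1, hl' hg, (hsub hg).2, fun x hx => ⟨hl' hx, hg' hx⟩⟩

/-- The primitive from `a` vanishes to the left of the support trivially, and to the right of it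
because the total integral is zero; so it is again compactly supported in the open interval. -/
theorem exists_testFunction_primitive {a b : ℝ} (hab : a < b) {φ : ℝ → ℝ} (hφ : ContDiff ℝ ∞ φ)
    (hc : HasCompactSupport φ) (hs : tsupport φ ⊆ Ioo a b) (h0 : ∫ x in a..b, φ x = 0) :
    ∃ χ : ℝ → ℝ, ContDiff ℝ ∞ χ ∧ HasCompactSupport χ ∧ tsupport χ ⊆ Ioo a b ∧ deriv χ = φ := by
  obtain ⟨a', b', ha, hab', hb, hK⟩ := exists_Icc_superset_of_isCompact hab hc hs
  have hzero : ∀ x, x ∉ Icc a' b' → φ x = 0 := fun x hx =>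
    image_eq_zero_of_notMem_tsupport fun h => hx (hK h)
  have hder : ∀ x, HasDerivAt (fun y => ∫ s in a..y, φ s) (φ x) x := fun x =>
    hφ.continuous.integral_hasStrictDerivAt a x |>.hasDerivAt
  have hd : deriv (fun y => ∫ s in a..y, φ s) = φ := funext fun x => (hder x).deriv
  have hval : ∀ x, x ∉ Icc a' b' → ∫ s in a..x, φ s = 0 := by
    intro x hx
    rcases lt_or_ge x a' with h | h
    · refine (intervalIntegral.integral_congr (g := fun _ => (0 : ℝ)) fun s hs => hzero s ?_).trans
        (by simp)
      intro hs'
      have := (mem_uIcc.1 hs)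
      rcases this with h1 | h1 <;> linarith [h1.1, h1.2, hs'.1, hs'.2]
    · have hx' : b' < x := by
        by_contra hcon
        exact hx ⟨h, not_lt.1 hcon⟩
      have hi : ∀ y z, IntervalIntegrable φ volume y z := fun y z =>
        hφ.continuous.intervalIntegrable y z
      rw [← intervalIntegral.integral_add_adjacent_intervals (hi a b) (hi b x), h0, zero_add]
      refine (intervalIntegral.integral_congr (g := fun _ => (0 : ℝ)) fun s hs => hzero s ?_).trans
        (by simp)
      intro hs'
      have := (mem_uIcc.1 hs)
      rcases this with h1 | h1 <;> linarith [h1.1, h1.2, hs'.1, hs'.2]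
  have hts : tsupport (fun y => ∫ s in a..y, φ s) ⊆ Icc a' b' :=
    closure_minimal (fun x hx => by_contra fun h => hx (hval x h)) isClosed_Icc
  refine ⟨fun y => ∫ s in a..y, φ s, ?_, ?_, ?_, hd⟩
  · rw [contDiff_infty_iff_deriv, hd]
    exact ⟨fun x => (hder x).differentiableAt, hφ⟩
  · exact HasCompactSupport.of_support_subset_isCompact isCompact_Icc
      ((subset_tsupport _).trans hts)
  · exact hts.trans fun x hx => ⟨ha.trans_le hx.1, hx.2.trans_lt hb⟩

/-- The du Bois-Reymond lemma. Subtracting from a test function its integral times a fixed bump `ψ`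
of mass one leaves a function of mean zero, hence the derivative of a test function. Thus `H` acts
on test functions as the constant `∫ H ψ` does. -/
theorem ae_eq_const_of_integral_mul_deriv_eq_zero {a b : ℝ} (hab : a < b) {H : ℝ → ℝ}
    (hH : IntegrableOn H (Ioo a b))
    (h : ∀ φ : ℝ → ℝ, ContDiff ℝ ∞ φ → HasCompactSupport φ → tsupport φ ⊆ Ioo a b →
      ∫ x in a..b, H x * deriv φ x = 0) :
    ∃ c, ∀ᵐ x, x ∈ Ioo a b → H x = c := by
  have hHi : IntervalIntegrable H volume a b := by
    rwa [intervalIntegrable_iff_integrableOn_Ioo_of_le hab.le]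
  -- The outer radius, a quarter of the length, keeps the closed support of the bump inside the open
  -- interval.
  let B : ContDiffBump ((a + b) / 2) := ⟨(b - a) / 8, (b - a) / 4, by linarith, by linarith⟩
  have hBs : tsupport (B.normed volume) ⊆ Ioo a b := by
    rw [B.tsupport_normed_eq, Real.closedBall_eq_Icc]
    intro x hx
    change x ∈ Icc ((a + b) / 2 - (b - a) / 4) ((a + b) / 2 + (b - a) / 4) at hx
    constructor <;> linarith [hx.1, hx.2]
  have hBc : HasCompactSupport (B.normed volume) := B.hasCompactSupport_normed
  have hBd : ContDiff ℝ ∞ (B.normed volume) := B.contDiff_normed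
  have hfull : ∀ φ : ℝ → ℝ, tsupport φ ⊆ Ioo a b → ∫ x in a..b, φ x = ∫ x, φ x := by
    intro φ hφ
    apply intervalIntegral.integral_eq_integral_of_support_subset
    exact (subset_tsupport _).trans (hφ.trans Ioo_subset_Ioc_self)
  have hB1 : ∫ x in a..b, B.normed volume x = 1 := by
    rw [hfull _ hBs]; exact B.integral_normed
  set ψ : ℝ → ℝ := B.normed volume with hψ
  refine ⟨∫ x in a..b, H x * ψ x, ?_⟩
  set c := ∫ x in a..b, H x * ψ x with hcdef
  have key : ∀ᵐ x, x ∈ Ioo a b → H x - c = 0 := by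
    refine isOpen_Ioo.ae_eq_zero_of_integral_contDiff_smul_eq_zero
      (hH.sub (integrableOn_const (by simp))).locallyIntegrableOn ?_
    intro φ hφ hφc hφs
    set k := ∫ x in a..b, φ x with hk
    have hts : tsupport (fun x => φ x - k * ψ x) ⊆ Ioo a b := by
      refine (tsupport_sub φ (fun x => k * ψ x)).trans (union_subset hφs ?_)
      exact (tsupport_mul_subset_right).trans hBs
    obtain ⟨χ, hχ, hχc, hχs, hχd⟩ := exists_testFunction_primitive hab
      (φ := fun x => φ x - k * ψ x) (hφ.sub (contDiff_const.mul hBd))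
      (hφc.sub hBc.mul_left) hts (by
        rw [intervalIntegral.integral_sub (hφ.continuous.intervalIntegrable _ _)
          ((hBd.continuous.const_mul k |>.intervalIntegrable _ _)),
          intervalIntegral.integral_const_mul, hB1]
        simp [hk])
    have h1 := h χ hχ hχc hχs
    rw [hχd] at h1
    have hi1 : IntervalIntegrable (fun x => H x * φ x) volume a b :=
      hHi.mul_continuousOn hφ.continuous.continuousOn
    have hi2 : IntervalIntegrable (fun x => H x * ψ x) volume a b :=
      hHi.mul_continuousOn hBd.continuous.continuousOn
    have h2 : ∫ x in a..b, H x * (φ x - k * ψ x) = (∫ x in a..b, H x * φ x) - k * c := by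
      rw [hcdef, ← intervalIntegral.integral_const_mul,
        ← intervalIntegral.integral_sub hi1 (hi2.const_mul k)]
      congr 1; ext x; ring
    rw [h2] at h1
    rw [← hfull]
    · have : ∀ x, φ x • (H x - c) = H x * φ x - c * φ x := fun x => by
        simp only [smul_eq_mul]; ring
      simp_rw [this]
      rw [intervalIntegral.integral_sub hi1 ((hφ.continuous.intervalIntegrable _ _).const_mul c),
        intervalIntegral.integral_const_mul]
      linarith
    · exact (tsupport_smul_subset_left φ _).trans hφs
  filter_upwards [key] with x hx hxm
  linarith [hx hxm]

theorem testFunction_absolutelyContinuous {φ : ℝ → ℝ} (hφ : ContDiff ℝ ∞ φ) (a b : ℝ) :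
    AbsolutelyContinuousOnInterval φ a b :=
  (hφ.of_le (by simp) : ContDiff ℝ 1 φ).contDiffOn.absolutelyContinuousOnInterval

/-- A function with an integrable weak derivative is a primitive of it. -/
theorem ae_eq_primitive_of_weakDeriv {a b : ℝ} (hab : a < b) {H G : ℝ → ℝ}
    (hH : IntegrableOn H (Ioo a b)) (hG : IntegrableOn G (Ioo a b))
    (h : ∀ φ : ℝ → ℝ, ContDiff ℝ ∞ φ → HasCompactSupport φ → tsupport φ ⊆ Ioo a b →
      ∫ x in a..b, H x * deriv φ x = - ∫ x in a..b, G x * φ x) :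
    ∃ c, ∀ᵐ x, x ∈ Ioo a b → H x = c + ∫ s in a..x, G s := by
  have hHi : IntervalIntegrable H volume a b := by
    rwa [intervalIntegrable_iff_integrableOn_Ioo_of_le hab.le]
  have hGi : IntervalIntegrable G volume a b := by
    rwa [intervalIntegrable_iff_integrableOn_Ioo_of_le hab.le]
  have hac := hGi.absolutelyContinuousOnInterval_intervalIntegral (c := a) left_mem_uIcc
  have hII : IntervalIntegrable (fun x => ∫ s in a..x, G s) volume a b :=
    hac.continuousOn.intervalIntegrable
  -- The primitive of `G` is absolutely continuous, so it may be integrated by parts against test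
  -- functions; `H` minus this primitive then has weak derivative zero.
  obtain ⟨c, hc⟩ := ae_eq_const_of_integral_mul_deriv_eq_zero hab
    (H := fun x => H x - ∫ s in a..x, G s) (by
      rw [← intervalIntegrable_iff_integrableOn_Ioo_of_le hab.le]
      exact hHi.sub hII) (by
    intro φ hφ hφc hφs
    have hφac := testFunction_absolutelyContinuous hφ a b
    have hd : Continuous (deriv φ) := hφ.continuous_deriv (by simp)
    have ha0 : φ a = 0 := image_eq_zero_of_notMem_tsupport fun h => lt_irrefl _ (hφs h).1
    have hb0 : φ b = 0 := image_eq_zero_of_notMem_tsupport fun h => lt_irrefl _ (hφs h).2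
    have h1 := hac.integral_mul_deriv_eq_deriv_mul hφac
    have h2 : ∫ x in a..b, deriv (fun x => ∫ s in a..x, G s) x * φ x = ∫ x in a..b, G x * φ x := by
      apply intervalIntegral.integral_congr_ae
      filter_upwards [hGi.ae_hasDerivAt_integral] with x hx hxm
      rw [(hx (uIoc_subset_uIcc hxm) a left_mem_uIcc).deriv]
    rw [h2, ha0, hb0] at h1
    simp_rw [sub_mul]
    rw [intervalIntegral.integral_sub (hHi.mul_continuousOn hd.continuousOn)
      (hII.mul_continuousOn hd.continuousOn), h1, h φ hφ hφc hφs]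
    ring)
  refine ⟨c, ?_⟩
  filter_upwards [hc] with x hx hxm
  linarith [hx hxm]

/-! ### Weak derivatives of higher order -/

theorem iteratedDeriv_testFunction {φ : ℝ → ℝ} {a b : ℝ} (hφ : ContDiff ℝ ∞ φ)
    (hc : HasCompactSupport φ) (hs : tsupport φ ⊆ Ioo a b) :
    ContDiff ℝ ∞ (deriv φ) ∧ HasCompactSupport (deriv φ) ∧ tsupport (deriv φ) ⊆ Ioo a b :=
  ⟨(contDiff_infty_iff_deriv.1 hφ).2, hc.deriv, (tsupport_deriv_subset (𝕜 := ℝ)).trans hs⟩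

theorem integrableOn_of_memLp_two {f : ℝ → ℝ} {a b : ℝ}
    (hf : MemLp f 2 (volume.restrict (Ioo a b))) : IntegrableOn f (Ioo a b) :=
  hf.integrable (by norm_num)

theorem intervalIntegrable_of_memLp_two {f : ℝ → ℝ} {a b : ℝ} (hab : a ≤ b)
    (hf : MemLp f 2 (volume.restrict (Ioo a b))) : IntervalIntegrable f volume a b := by
  rw [intervalIntegrable_iff_integrableOn_Ioo_of_le hab]
  exact integrableOn_of_memLp_two hf

theorem continuous_iteratedDeriv_testFunction {φ : ℝ → ℝ} (hφ : ContDiff ℝ ∞ φ) (k : ℕ) :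
    Continuous (iteratedDeriv k φ) :=
  hφ.continuous_iteratedDeriv k (by exact_mod_cast le_top)

/-- Weak derivatives are defined one order at a time directly from `f`. Testing the relation of
order `i` with `φ'` links consecutive orders, which allows inductions on the order. -/
theorem HasL2WeakDeriv.integral_mul_deriv {i : ℕ} {f g g' : ℝ → ℝ} {a b : ℝ}
    (hg : HasL2WeakDeriv i f g a b) (hg' : HasL2WeakDeriv (i + 1) f g' a b) {φ : ℝ → ℝ}
    (hφ : ContDiff ℝ ∞ φ) (hc : HasCompactSupport φ) (hs : tsupport φ ⊆ Ioo a b) :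
    ∫ x in a..b, g x * deriv φ x = - ∫ x in a..b, g' x * φ x := by
  obtain ⟨h1, h2, h3⟩ := iteratedDeriv_testFunction hφ hc hs
  have e1 := hg.2.2 _ h1 h2 h3
  have e2 := hg'.2.2 _ hφ hc hs
  rw [iteratedDeriv_succ', e1, pow_succ] at e2
  have : ((-1 : ℝ) ^ i) ≠ 0 := pow_ne_zero _ (by norm_num)
  apply mul_left_cancel₀ this
  linarith

theorem HasL2WeakDeriv.add {i : ℕ} {f₁ g₁ f₂ g₂ : ℝ → ℝ} {a b : ℝ} (hab : a ≤ b)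
    (h₁ : HasL2WeakDeriv i f₁ g₁ a b) (h₂ : HasL2WeakDeriv i f₂ g₂ a b) :
    HasL2WeakDeriv i (fun x => f₁ x + f₂ x) (fun x => g₁ x + g₂ x) a b := by
  refine ⟨h₁.1.add h₂.1, h₁.2.1.add h₂.2.1, fun φ hφ hc hs => ?_⟩
  have hk := (continuous_iteratedDeriv_testFunction hφ i).continuousOn (s := uIcc a b)
  simp_rw [add_mul]
  rw [intervalIntegral.integral_add
      ((intervalIntegrable_of_memLp_two hab h₁.1).mul_continuousOn hk)
      ((intervalIntegrable_of_memLp_two hab h₂.1).mul_continuousOn hk),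
    intervalIntegral.integral_add
      ((intervalIntegrable_of_memLp_two hab h₁.2.1).mul_continuousOn hφ.continuous.continuousOn)
      ((intervalIntegrable_of_memLp_two hab h₂.2.1).mul_continuousOn hφ.continuous.continuousOn),
    h₁.2.2 φ hφ hc hs, h₂.2.2 φ hφ hc hs]
  ring

theorem HasL2WeakDeriv.const_mul {i : ℕ} {f g : ℝ → ℝ} {a b : ℝ} (k : ℝ)
    (h : HasL2WeakDeriv i f g a b) :
    HasL2WeakDeriv i (fun x => k * f x) (fun x => k * g x) a b := by
  refine ⟨h.1.const_mul k, h.2.1.const_mul k, fun φ hφ hc hs => ?_⟩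
  simp_rw [mul_assoc]
  rw [intervalIntegral.integral_const_mul, intervalIntegral.integral_const_mul, h.2.2 φ hφ hc hs]
  ring

theorem memLp_two_of_continuousOn {f : ℝ → ℝ} {a b : ℝ} (hf : ContinuousOn f (Icc a b)) :
    MemLp f 2 (volume.restrict (Ioo a b)) := by
  obtain ⟨K, hK⟩ := isCompact_Icc.exists_bound_of_continuousOn hf
  refine MemLp.of_bound ((hf.mono Ioo_subset_Icc_self).aestronglyMeasurable measurableSet_Ioo) K ?_
  exact (ae_restrict_iff' measurableSet_Ioo).2
    (.of_forall fun x hx => hK x (Ioo_subset_Icc_self hx))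

theorem tsupport_iteratedDeriv_subset (φ : ℝ → ℝ) (i : ℕ) :
    tsupport (iteratedDeriv i φ) ⊆ tsupport φ := by
  induction i with
  | zero => simp
  | succ n ih =>
    rw [iteratedDeriv_succ]
    exact (tsupport_deriv_subset (𝕜 := ℝ)).trans ih

/-- The classical derivative of a `C¹` function inherits its higher weak derivatives. -/
theorem HasL2WeakDeriv.of_hasDerivWithinAt {i : ℕ} {f f' g : ℝ → ℝ} {a b : ℝ} (hab : a < b)
    (hf : ∀ x ∈ Icc a b, HasDerivWithinAt f (f' x) (Icc a b) x) (hf' : ContinuousOn f' (Icc a b))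
    (h : HasL2WeakDeriv (i + 1) f g a b) : HasL2WeakDeriv i f' g a b := by
  refine ⟨memLp_two_of_continuousOn hf', h.2.1, fun φ hφ hc hs => ?_⟩
  have e := h.2.2 φ hφ hc hs
  have hk : ContDiff ℝ 1 (iteratedDeriv i φ) := by
    have h2 : ContDiff ℝ ((1 + i : ℕ) : ℕ∞) φ := hφ.of_le (by exact_mod_cast le_top)
    exact ContDiff.iterate_deriv' 1 i (by exact_mod_cast h2) |> fun h => by
      simpa [iteratedDeriv_eq_iterate] using h
  have hzero : ∀ x, x ∉ Ioo a b → iteratedDeriv i φ x = 0 := by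
    intro x hx
    have := tsupport_iteratedDeriv_subset φ i
    exact image_eq_zero_of_notMem_tsupport fun h => hx (hs (this h))
  -- One integration by parts against the `i`-th derivative of the test function, which vanishes at
  -- both ends, moves one derivative onto `f`.
  have hib := intervalIntegral.integral_mul_deriv_eq_deriv_mul_of_hasDerivWithinAt
    (a := a) (b := b) (u := f) (u' := f') (v := iteratedDeriv i φ) (v' := iteratedDeriv (i + 1) φ)
    (by rwa [uIcc_of_le hab.le]) (fun x _ => by
      rw [iteratedDeriv_succ]
      exact (hk.differentiable (by simp) x).hasDerivAt.hasDerivWithinAt)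
    (hf'.intervalIntegrable_of_Icc hab.le)
    ((continuous_iteratedDeriv_testFunction hφ (i + 1)).intervalIntegrable _ _)
  rw [hzero a (by simp), hzero b (by simp), e, pow_succ] at hib
  linarith

/-! ### Auxiliary facts on integrals and polynomials -/

theorem abs_integral_mul_le_sqrt_mul_sqrt {α : Type*} [MeasurableSpace α] {μ : Measure α}
    {f g : α → ℝ} (hf : MemLp f 2 μ) (hg : MemLp g 2 μ) :
    |∫ x, f x * g x ∂μ| ≤ Real.sqrt (∫ x, f x ^ 2 ∂μ) * Real.sqrt (∫ x, g x ^ 2 ∂μ) := by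
  have hfg : Integrable (fun x => f x * g x) μ := hf.integrable_mul hg
  have hff := hf.integrable_sq
  have hgg := hg.integrable_sq
  rw [← Real.sqrt_mul (integral_nonneg fun x => sq_nonneg _)]
  apply Real.abs_le_sqrt
  have key : ∀ t : ℝ, 0 ≤ (∫ x, g x ^ 2 ∂μ) * (t * t) + (2 * ∫ x, f x * g x ∂μ) * t
      + ∫ x, f x ^ 2 ∂μ := by
    intro t
    have : ∫ x, (f x + t * g x) ^ 2 ∂μ = (∫ x, g x ^ 2 ∂μ) * (t * t)
        + (2 * ∫ x, f x * g x ∂μ) * t + ∫ x, f x ^ 2 ∂μ := by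
      have e : ∀ x, (f x + t * g x) ^ 2 = (t * t) * g x ^ 2 + (2 * t) * (f x * g x) + f x ^ 2 :=
        fun x => by ring
      simp_rw [e]
      rw [integral_add (f := fun x => t * t * g x ^ 2 + 2 * t * (f x * g x))
          ((hgg.const_mul _).add (hfg.const_mul _)) hff,
        integral_add (hgg.const_mul _) (hfg.const_mul _), integral_const_mul, integral_const_mul]
      ring
    rw [← this]
    exact integral_nonneg fun x => sq_nonneg _
  have := discrim_le_zero key
  rw [discrim] at this
  nlinarith

theorem exists_antiderivative (P : ℝ[X]) (e c : ℝ) :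
    ∃ Q : ℝ[X], derivative Q = P ∧ Q.eval e = c := by
  have h : ∃ Q : ℝ[X], derivative Q = P := by
    induction P using Polynomial.induction_on' with
    | add p r hp hr =>
      obtain ⟨Q, hQ⟩ := hp
      obtain ⟨R, hR⟩ := hr
      exact ⟨Q + R, by simp [hQ, hR]⟩
    | monomial n k =>
      refine ⟨monomial (n + 1) (k / (n + 1)), ?_⟩
      rw [derivative_monomial]
      have : (n : ℝ) + 1 ≠ 0 := by positivity
      simp [this]
  obtain ⟨Q, hQ⟩ := h
  exact ⟨Q + C (c - Q.eval e), by simp [hQ], by simp⟩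

theorem degree_lt_succ_of_derivative {Q : ℝ[X]} {n : ℕ} (h : (derivative Q).degree < n) :
    Q.degree < (n + 1 : ℕ) := by
  rw [degree_lt_iff_coeff_zero] at h ⊢
  intro m hm
  obtain ⟨k, rfl⟩ : ∃ k, m = k + 1 := ⟨m - 1, by omega⟩
  have := h k (by omega)
  rw [coeff_derivative] at this
  exact (mul_eq_zero.1 this).resolve_right (by positivity)

theorem degree_derivative_lt_of_degree_le {Q : ℝ[X]} {n : ℕ} (h : Q.degree < (n + 1 : ℕ)) :
    (derivative Q).degree < n := by
  rw [degree_lt_iff_coeff_zero] at h ⊢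
  intro m hm
  rw [coeff_derivative, h (m + 1) (by omega), zero_mul]

theorem degree_lt_succ_iff {Q : ℝ[X]} {n : ℕ} : Q.degree < (n + 1 : ℕ) ↔ Q.degree ≤ n := by
  rw [degree_lt_iff_coeff_zero, degree_le_iff_coeff_zero]
  exact forall_congr' fun m => by rw [Nat.cast_lt, Nat.succ_le_iff]

theorem integral_derivative_eval (Q : ℝ[X]) (e x : ℝ) :
    ∫ s in e..x, (derivative Q).eval s = Q.eval x - Q.eval e :=
  intervalIntegral.integral_eq_sub_of_hasDerivAt (fun s _ => Q.hasDerivAt s)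
    ((derivative Q).continuous.intervalIntegrable _ _)

/-! ### Taylor approximation -/

theorem memLp_restrict_Ioo_mono {f : ℝ → ℝ} {a b y z : ℝ} (hy : a ≤ y) (hz : z ≤ b)
    (hf : MemLp f 2 (volume.restrict (Ioo a b))) : MemLp f 2 (volume.restrict (Ioo y z)) :=
  hf.mono_measure (Measure.restrict_mono (Ioo_subset_Ioo hy hz) le_rfl)

theorem abs_integral_le_sqrt_mul_sqrt {G : ℝ → ℝ} {y z e x : ℝ}
    (hG : MemLp G 2 (volume.restrict (Ioo y z))) (he : e ∈ Icc y z) (hx : x ∈ Icc y z) :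
    |∫ s in e..x, G s| ≤ Real.sqrt |x - e| * Real.sqrt (∫ s in y..z, G s ^ 2) := by
  have hyz : y ≤ z := he.1.trans he.2
  wlog hex : e ≤ x generalizing e x
  · rw [intervalIntegral.integral_symm, abs_neg, abs_sub_comm]
    exact this hx he (le_of_not_ge hex)
  have hG' := memLp_restrict_Ioo_mono he.1 hx.2 hG
  have h1 := abs_integral_mul_le_sqrt_mul_sqrt (memLp_const (1 : ℝ)) hG'
  rw [intervalIntegral.integral_of_le hex, integral_Ioc_eq_integral_Ioo,
    intervalIntegral.integral_of_le hyz, integral_Ioc_eq_integral_Ioo]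
  simp only [one_mul, one_pow] at h1
  refine h1.trans ?_
  have h2 : ∫ _ in Ioo e x, (1 : ℝ) = |x - e| := by
    rw [abs_of_nonneg (by linarith)]; simp [hex]
  rw [h2]
  gcongr
  · exact .of_forall fun s => sq_nonneg _
  · exact hG.integrable_sq
  · exact he.1
  · exact hx.2

/-- Induction on the order: the estimate for `H 1` is integrated from `e`, each integration adding a
factor `|x - e|`. The base case is Cauchy–Schwarz, whence the half power. The expansion is centred
at `e` so that the error vanishes there, as the Radau estimate requires. No factorials are kept. -/
theorem exists_taylor_ae {a b y z e : ℝ} (hab : a < b) (hy : a ≤ y) (hz : z ≤ b)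
    (he : e ∈ Icc y z) (k : ℕ) : ∀ (H : ℕ → ℝ → ℝ),
    (∀ i ≤ k + 1, MemLp (H i) 2 (volume.restrict (Ioo a b))) →
    (∀ i < k + 1, ∀ φ : ℝ → ℝ, ContDiff ℝ ∞ φ → HasCompactSupport φ → tsupport φ ⊆ Ioo a b →
      ∫ x in a..b, H i x * deriv φ x = - ∫ x in a..b, H (i + 1) x * φ x) →
    ∃ p : ℝ[X], p.degree < (k + 1 : ℕ) ∧ ∀ᵐ x, x ∈ Ioo y z →
      |H 0 x - p.eval x| ≤
        |x - e| ^ k * Real.sqrt |x - e| * Real.sqrt (∫ s in y..z, H (k + 1) s ^ 2) := by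
  have hyz : y ≤ z := he.1.trans he.2
  have hea : e ∈ Icc a b := ⟨hy.trans he.1, he.2.trans hz⟩
  have base : ∀ (H : ℕ → ℝ → ℝ), (∀ i ≤ 1, MemLp (H i) 2 (volume.restrict (Ioo a b))) →
      (∀ φ : ℝ → ℝ, ContDiff ℝ ∞ φ → HasCompactSupport φ → tsupport φ ⊆ Ioo a b →
      ∫ x in a..b, H 0 x * deriv φ x = - ∫ x in a..b, H 1 x * φ x) →
      ∃ c, ∀ᵐ x, x ∈ Ioo y z → H 0 x = c + ∫ s in e..x, H 1 s := by
    intro H hL hw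
    obtain ⟨c, hc⟩ := ae_eq_primitive_of_weakDeriv hab (integrableOn_of_memLp_two (hL 0 (by simp)))
      (integrableOn_of_memLp_two (hL 1 le_rfl)) hw
    have hi := intervalIntegrable_of_memLp_two hab.le (hL 1 le_rfl)
    refine ⟨c + ∫ s in a..e, H 1 s, ?_⟩
    filter_upwards [hc] with x hx hxm
    have hxm' : x ∈ Ioo a b := ⟨hy.trans_lt hxm.1, hxm.2.trans_le hz⟩
    rw [hx hxm', add_assoc, intervalIntegral.integral_add_adjacent_intervals]
    · exact hi.mono_set (by rw [uIcc_of_le hea.1, uIcc_of_le hab.le]; exact Icc_subset_Icc_right hea.2)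
    · refine hi.mono_set ?_
      rw [uIcc_of_le hab.le]
      exact uIcc_subset_Icc hea ⟨hxm'.1.le, hxm'.2.le⟩
  induction k with
  | zero =>
    intro H hL hw
    obtain ⟨c, hc⟩ := base H hL (hw 0 (by simp))
    refine ⟨C c, ?_, ?_⟩
    · exact degree_C_le.trans_lt (by norm_num)
    · filter_upwards [hc] with x hx hxm
      rw [hx hxm, eval_C, add_sub_cancel_left, pow_zero, one_mul]
      exact abs_integral_le_sqrt_mul_sqrt (memLp_restrict_Ioo_mono hy hz (hL 1 le_rfl)) he
        (Ioo_subset_Icc_self hxm)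
  | succ k ih =>
    intro H hL hw
    obtain ⟨c, hc⟩ := base H (fun i hi => hL i (by omega)) (hw 0 (by simp))
    obtain ⟨p, hp, hpe⟩ := ih (fun i => H (i + 1)) (fun i hi => hL (i + 1) (by omega))
      (fun i hi => hw (i + 1) (by omega))
    -- The constant of integration is the value of `H 0` at `e` in its continuous representative, so
    -- that `H 0 - Q` is the integral from `e` of `H 1 - p`.
    obtain ⟨Q, hQ, hQe⟩ := exists_antiderivative p e c
    refine ⟨Q, degree_lt_succ_of_derivative (by rwa [hQ]), ?_⟩
    set S := Real.sqrt (∫ s in y..z, H (k + 1 + 1) s ^ 2) with hS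
    filter_upwards [hc] with x hx hxm
    have hxI : x ∈ Icc y z := Ioo_subset_Icc_self hxm
    have h1 : H 0 x - Q.eval x = ∫ s in e..x, (H 1 s - p.eval s) := by
      rw [intervalIntegral.integral_sub, hx hxm, ← hQ, integral_derivative_eval, hQe]
      · ring
      · refine (intervalIntegrable_of_memLp_two hab.le (hL 1 (by omega))).mono_set ?_
        rw [uIcc_of_le hab.le]
        exact uIcc_subset_Icc hea ⟨hy.trans hxI.1, hxI.2.trans hz⟩
      · exact p.continuous.intervalIntegrable _ _
    rw [h1]
    have h2 := intervalIntegral.norm_integral_le_of_norm_le_const_ae (a := e) (b := x)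
      (f := fun s => H 1 s - p.eval s) (C := |x - e| ^ k * Real.sqrt |x - e| * S) (by
        -- The inductive bound holds on the open interval; the end points are discarded as null
        -- sets.
        have hne : ∀ᵐ s : ℝ, s ≠ z := by
          simp [ae_iff, measure_singleton]
        have hne' : ∀ᵐ s : ℝ, s ≠ y := by
          simp [ae_iff, measure_singleton]
        filter_upwards [hpe, hne, hne'] with s hs hsz hsy hsm
        have hsI : s ∈ uIcc e x := uIoc_subset_uIcc hsm
        have hs1 := uIcc_subset_Icc he hxI hsI
        have hle : |s - e| ≤ |x - e| := abs_sub_left_of_mem_uIcc hsI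
        refine (hs ⟨lt_of_le_of_ne hs1.1 hsy.symm, lt_of_le_of_ne hs1.2 hsz⟩).trans ?_
        gcongr)
    rw [Real.norm_eq_abs] at h2
    refine h2.trans (le_of_eq ?_)
    rw [pow_succ]; ring

theorem hasL2WeakDeriv_zero {f : ℝ → ℝ} {a b : ℝ} (hf : ContinuousOn f (Icc a b)) :
    HasL2WeakDeriv 0 f f a b :=
  ⟨memLp_two_of_continuousOn hf, memLp_two_of_continuousOn hf, fun φ _ _ _ => by simp⟩

/-- An almost everywhere inequality of continuous functions is the almost everywhere equality of
`max f g` with `g`, and continuous functions that agree almost everywhere agree. -/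
theorem le_on_Icc_of_ae_le {f g : ℝ → ℝ} {y z : ℝ} (hyz : y < z) (hf : ContinuousOn f (Icc y z))
    (hg : ContinuousOn g (Icc y z)) (h : ∀ᵐ x, x ∈ Ioo y z → f x ≤ g x) :
    ∀ x ∈ Icc y z, f x ≤ g x := by
  have key : EqOn (fun x => max (f x) (g x)) g (Icc y z) := by
    refine Measure.eqOn_Icc_of_ae_eq volume hyz.ne ?_ (hf.sup hg) hg
    rw [← restrict_Ioo_eq_restrict_Icc]
    refine (ae_restrict_iff' measurableSet_Ioo).2 ?_
    filter_upwards [h] with x hx hxm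
    exact max_eq_right (hx hxm)
  exact fun x hx => max_eq_right_iff.1 (key hx)

theorem exists_taylor {a b y z e : ℝ} (hyz : y < z) (hy : a ≤ y) (hz : z ≤ b)
    (he : e ∈ Icc y z) {q : ℕ} (hq : 1 ≤ q) {F G : ℝ → ℝ} (hF : ContinuousOn F (Icc a b))
    (hFi : ∀ i < q, ∃ g, HasL2WeakDeriv i F g a b) (hG : HasL2WeakDeriv q F G a b) :
    ∃ p : ℝ[X], p.degree < q ∧ ∀ x ∈ Icc y z,
      |F x - p.eval x| ≤ |x - e| ^ (q - 1) * Real.sqrt |x - e|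
        * Real.sqrt (∫ s in y..z, G s ^ 2) := by
  obtain ⟨k, rfl⟩ : ∃ k, q = k + 1 := ⟨q - 1, by omega⟩
  have hab : a < b := by linarith
  -- The chain of weak derivatives is chosen with `F` itself at order `0` and the given `G` at order
  -- `k + 1`, since the bound must concern these representatives. Beyond `k + 1` the value is a
  -- dummy.
  have hH : ∀ i : ℕ, ∃ g, (i ≤ k + 1 → HasL2WeakDeriv i F g a b) ∧ (i = 0 → g = F) ∧
      (i = k + 1 → g = G) := by
    intro i
    rcases Nat.eq_zero_or_pos i with rfl | hi
    · exact ⟨F, fun _ => hasL2WeakDeriv_zero hF, fun _ => rfl, fun h => by omega⟩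
    · rcases lt_trichotomy i (k + 1) with h | rfl | h
      · obtain ⟨g, hg⟩ := hFi i h
        exact ⟨g, fun _ => hg, fun h => by omega, fun h => by omega⟩
      · exact ⟨G, fun _ => hG, fun h => by omega, fun _ => rfl⟩
      · exact ⟨F, fun h => by omega, fun h => by omega, fun h => by omega⟩
  choose H h1 h2 h3 using hH
  obtain ⟨p, hp, hpe⟩ := exists_taylor_ae hab hy hz he k H (fun i hi => (h1 i hi).2.1)
    (fun i hi φ hφ hc hs => (h1 i (by omega)).integral_mul_deriv (h1 (i + 1) (by omega)) hφ hc hs)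
  rw [h2 0 rfl, h3 (k + 1) rfl] at hpe
  refine ⟨p, hp, ?_⟩
  have hmono := hF.mono (Icc_subset_Icc hy hz)
  refine le_on_Icc_of_ae_le hyz (by fun_prop) (by fun_prop) hpe

theorem hasL2WeakDeriv_weakDeriv {k : ℕ} {f : ℝ → ℝ} {a b : ℝ}
    (h : ∃ g : ℝ → ℝ, HasL2WeakDeriv k f g a b) :
    HasL2WeakDeriv k f (weakDeriv k f a b) a b := by
  rw [weakDeriv, dif_pos h]
  exact h.choose_spec

theorem sobolevSeminorm_sq {k : ℕ} {f : ℝ → ℝ} {a b : ℝ} (hab : a ≤ b) :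
    sobolevSeminorm k f a b ^ 2 = ∫ x in a..b, (weakDeriv k f a b x) ^ 2 := by
  rw [sobolevSeminorm, Real.sq_sqrt]
  exact intervalIntegral.integral_nonneg hab fun x _ => sq_nonneg _

/-! ### The Gauss–Radau projection -/

/-- `p` is the Gauss–Radau projection of `R` on `(y, z)` with interpolation point `e`. -/
structure IsRadau (q : ℕ) (y z e : ℝ) (R : ℝ → ℝ) (p : ℝ[X]) : Prop where
  degree_lt : p.degree < (q : WithBot ℕ)
  eval_eq : p.eval e = R e
  orth : ∀ φ : ℝ[X], φ.degree < ((q - 1 : ℕ) : WithBot ℕ) →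
    ∫ x in y..z, φ.eval x * (p.eval x - R x) = 0

theorem exists_factor_of_eval_eq_zero {q : ℕ} {D : ℝ[X]} {e : ℝ}
    (hD : D.degree < (q : WithBot ℕ)) (he : D.eval e = 0) :
    ∃ M : ℝ[X], M.degree < ((q - 1 : ℕ) : WithBot ℕ) ∧ D = (X - C e) * M := by
  obtain ⟨M, rfl⟩ := dvd_iff_isRoot.2 he
  refine ⟨M, ?_, rfl⟩
  rcases eq_or_ne M 0 with rfl | hM
  · rw [degree_zero]; exact WithBot.bot_lt_coe _
  rw [degree_mul, degree_X_sub_C, degree_eq_natDegree hM] at hD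
  rw [degree_eq_natDegree hM]
  have : 1 + M.natDegree < q := by exact_mod_cast hD
  exact_mod_cast (by omega : M.natDegree < q - 1)

theorem exists_sign_of_endpoint {y z e : ℝ} (he : e = y ∨ e = z) :
    ∃ s : ℝ, |s| = 1 ∧ ∀ x ∈ Icc y z, s * (x - e) = |x - e| := by
  rcases he with rfl | rfl
  · exact ⟨1, by simp, fun x hx => by rw [abs_of_nonneg (by linarith [hx.1])]; ring⟩
  · exact ⟨-1, by simp, fun x hx => by rw [abs_of_nonpos (by linarith [hx.2])]; ring⟩

theorem endpoint_mem_Icc {y z e : ℝ} (hyz : y ≤ z) (he : e = y ∨ e = z) : e ∈ Icc y z := by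
  rcases he with rfl | rfl
  · exact left_mem_Icc.2 hyz
  · exact right_mem_Icc.2 hyz

/-- Divide out the root: `D = (x - e) M` with `M` an allowed test polynomial. As `e` is an end
point, `x - e` has one sign, so testing with `M` makes the integral of the nonnegative function `|x
- e| M²` vanish. -/
theorem eq_zero_of_orthogonal_of_eval_eq_zero {q : ℕ} {y z e : ℝ} (hyz : y < z)
    (he : e = y ∨ e = z) {D : ℝ[X]} (hD : D.degree < (q : WithBot ℕ)) (h0 : D.eval e = 0)
    (hort : ∀ φ : ℝ[X], φ.degree < ((q - 1 : ℕ) : WithBot ℕ) →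
      ∫ x in y..z, φ.eval x * D.eval x = 0) : D = 0 := by
  obtain ⟨M, hM, rfl⟩ := exists_factor_of_eval_eq_zero hD h0
  by_contra hne
  have hM0 : M ≠ 0 := right_ne_zero_of_mul hne
  obtain ⟨s, -, hs⟩ := exists_sign_of_endpoint he
  have h1 : ∫ x in y..z, |x - e| * M.eval x ^ 2 = 0 := by
    have h2 := hort M hM
    have : ∫ x in y..z, |x - e| * M.eval x ^ 2
        = ∫ x in y..z, s * (M.eval x * ((X - C e) * M).eval x) := by
      refine intervalIntegral.integral_congr fun x hx => ?_
      rw [uIcc_of_le hyz.le] at hx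
      simp only [eval_mul, eval_sub, eval_X, eval_C]
      rw [← hs x hx]; ring
    rw [this, intervalIntegral.integral_const_mul, h2, mul_zero]
  obtain ⟨x, hx, hxM⟩ : ∃ x ∈ Ioo y z, ¬ M.IsRoot x := by
    by_contra hcon
    push Not at hcon
    exact (Ioo_infinite hyz) ((M.finite_setOfPred_isRoot hM0).subset hcon)
  have hpos : 0 < ∫ x in y..z, |x - e| * M.eval x ^ 2 := by
    refine intervalIntegral.integral_pos hyz (by fun_prop)
      (fun x _ => by positivity) ⟨x, Ioo_subset_Icc_self hx, ?_⟩
    have hxe : x - e ≠ 0 := by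
      rcases he with rfl | rfl
      · exact (sub_pos.2 hx.1).ne'
      · exact (sub_neg.2 hx.2).ne
    have : M.eval x ≠ 0 := hxM
    positivity
  exact hpos.ne' h1

theorem intervalIntegrable_eval_mul {y z : ℝ} (hyz : y ≤ z) {R : ℝ → ℝ}
    (hR : ContinuousOn R (Icc y z)) (φ : ℝ[X]) :
    IntervalIntegrable (fun x => φ.eval x * R x) volume y z :=
  (φ.continuous.continuousOn.mul hR).intervalIntegrable_of_Icc hyz

/-- The data which determine a Gauss–Radau projection. -/
noncomputable def radauData (q : ℕ) (y z e : ℝ) (R : ℝ → ℝ) : Fin q → ℝ := fun i =>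
  if (i : ℕ) + 1 < q then ∫ x in y..z, x ^ (i : ℕ) * R x else R e

theorem isRadau_iff {q : ℕ} (hq : 1 ≤ q) {y z e : ℝ} (hyz : y ≤ z)
    {R : ℝ → ℝ} (hR : ContinuousOn R (Icc y z)) {p : ℝ[X]} :
    IsRadau q y z e R p ↔ p.degree < (q : WithBot ℕ) ∧
      radauData q y z e (fun x => p.eval x) = radauData q y z e R := by
  have hp : ContinuousOn (fun x => p.eval x) (Icc y z) := p.continuous.continuousOn
  have hmono : ∀ k : ℕ, (∫ x in y..z, x ^ k * (p.eval x - R x))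
      = (∫ x in y..z, x ^ k * p.eval x) - ∫ x in y..z, x ^ k * R x := by
    intro k
    have h1 := intervalIntegrable_eval_mul hyz hp (X ^ k)
    have h2 := intervalIntegrable_eval_mul hyz hR (X ^ k)
    simp only [eval_pow, eval_X] at h1 h2
    rw [← intervalIntegral.integral_sub h1 h2]
    congr 1; ext x; ring
  constructor
  · intro h
    refine ⟨h.degree_lt, funext fun i => ?_⟩
    simp only [radauData]
    split_ifs with hi
    · have := h.orth (X ^ (i : ℕ)) (by
        rw [degree_X_pow]; exact_mod_cast (by omega : (i : ℕ) < q - 1))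
      simp only [eval_pow, eval_X] at this
      rw [hmono] at this
      linarith
    · exact h.eval_eq
  · rintro ⟨hdeg, h⟩
    refine ⟨hdeg, ?_, fun φ hφ => ?_⟩
    -- The last slot, with index `q - 1`, holds the point value; the earlier ones hold the moments
    -- of order at most `q - 2`. For `q = 1` only the point value remains.
    · have := congrFun h ⟨q - 1, by omega⟩
      simpa [radauData, show q - 1 + 1 = q by omega] using this
    · rcases eq_or_ne φ 0 with rfl | h0
      · simp
      have hc : ContinuousOn (fun x => p.eval x - R x) (Icc y z) := hp.sub hR
      have hexp : ∀ x, φ.eval x * (p.eval x - R x)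
          = ∑ k ∈ Finset.range (q - 1), φ.coeff k * (x ^ k * (p.eval x - R x)) := by
        intro x
        rw [eval_eq_sum_range' (n := q - 1)]
        · rw [Finset.sum_mul]
          exact Finset.sum_congr rfl fun k _ => by ring
        · exact (natDegree_lt_iff_degree_lt h0).2 hφ
      simp_rw [hexp]
      rw [intervalIntegral.integral_finsetSum]
      · refine Finset.sum_eq_zero fun k hk => ?_
        have hk' := Finset.mem_range.1 hk
        rw [intervalIntegral.integral_const_mul, hmono]
        have := congrFun h ⟨k, by omega⟩
        simp only [radauData, show k + 1 < q by omega, if_true] at this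
        rw [this]; ring
      · intro k _
        have := intervalIntegrable_eval_mul hyz hc (X ^ k)
        simp only [eval_pow, eval_X] at this
        exact this.const_mul _

/-- The Gauss–Radau projection exists, is unique, and depends linearly on its data. -/
theorem exists_radauSolution {q : ℕ} (hq : 1 ≤ q) {y z e : ℝ} (hyz : y < z) (he : e = y ∨ e = z) :
    ∃ Ψ : (Fin q → ℝ) →ₗ[ℝ] ℝ[X], ∀ R : ℝ → ℝ, ContinuousOn R (Icc y z) → ∀ p : ℝ[X],
      IsRadau q y z e R p ↔ p = Ψ (radauData q y z e R) := by
  have hint : ∀ (k : ℕ) (p : ℝ[X]), IntervalIntegrable (fun x => x ^ k * p.eval x) volume y z :=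
    fun k p => Continuous.intervalIntegrable (by fun_prop) _ _
  let Λ : degreeLT ℝ q →ₗ[ℝ] (Fin q → ℝ) :=
    { toFun := fun p => radauData q y z e (fun x => (p : ℝ[X]).eval x)
      map_add' := fun p r => by
        funext i
        simp only [radauData, Submodule.coe_add, eval_add, Pi.add_apply]
        split_ifs
        · rw [← intervalIntegral.integral_add (hint _ _) (hint _ _)]
          congr 1; ext x; ring
        · rfl
      map_smul' := fun k p => by
        funext i
        simp only [radauData, Submodule.coe_smul, eval_smul, Pi.smul_apply, smul_eq_mul,
          RingHom.id_apply]
        split_ifs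
        · rw [← intervalIntegral.integral_const_mul]
          congr 1; ext x; ring
        · rfl }
  have hΛ : ∀ p : degreeLT ℝ q, Λ p = radauData q y z e (fun x => (p : ℝ[X]).eval x) :=
    fun _ => rfl
  -- A polynomial with zero data is a Radau projection of zero, hence zero. Since source and target
  -- both have dimension `q`, injectivity gives the inverse that solves for the projection.
  have hinj : Function.Injective Λ := by
    rw [← LinearMap.ker_eq_bot, LinearMap.ker_eq_bot']
    intro p hp
    rw [hΛ] at hp
    have hz : radauData q y z e (fun _ => 0) = 0 := by
      funext i; simp [radauData]
    have hrad := (isRadau_iff hq hyz.le (R := fun _ => 0) continuousOn_const (e := e)).2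
      ⟨mem_degreeLT.1 p.2, hp.trans hz.symm⟩
    have := eq_zero_of_orthogonal_of_eval_eq_zero hyz he hrad.degree_lt hrad.eval_eq
      (by simpa using hrad.orth)
    exact Subtype.ext this
  have : FiniteDimensional ℝ (degreeLT ℝ q) := Module.Finite.equiv (degreeLTEquiv ℝ q).symm
  let E := LinearMap.linearEquivOfInjective Λ hinj (degreeLTEquiv ℝ q).finrank_eq
  refine ⟨(degreeLT ℝ q).subtype ∘ₗ (E.symm : (Fin q → ℝ) →ₗ[ℝ] degreeLT ℝ q), fun R hR p => ?_⟩
  rw [isRadau_iff hq hyz.le hR]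
  constructor
  · rintro ⟨hd, hdata⟩
    have : E ⟨p, mem_degreeLT.2 hd⟩ = radauData q y z e R := hdata
    rw [← this]
    simp
  · intro h
    subst h
    refine ⟨mem_degreeLT.1 (E.symm (radauData q y z e R)).2, ?_⟩
    exact E.apply_symm_apply (radauData q y z e R)

/-- The coefficients of a Gauss–Radau projection may be differentiated in time. -/
theorem hasDerivWithinAt_coeff_radau {q : ℕ} (hq : 1 ≤ q) {y z e : ℝ} (hyz : y < z)
    (he : e = y ∨ e = z) {I : Set ℝ} {t : ℝ} (ht : t ∈ I) {R : ℝ → ℝ → ℝ} {R' : ℝ → ℝ}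
    {p : ℝ → ℝ[X]} {p' : ℝ[X]} (hR : ∀ s ∈ I, ContinuousOn (R s) (Icc y z))
    (hR' : ContinuousOn R' (Icc y z)) (hp : ∀ s ∈ I, IsRadau q y z e (R s) (p s))
    (hp' : IsRadau q y z e R' p')
    (hd : HasDerivWithinAt (fun s => radauData q y z e (R s)) (radauData q y z e R') I t) (k : ℕ) :
    HasDerivWithinAt (fun s => (p s).coeff k) (p'.coeff k) I t := by
  obtain ⟨Ψ, hΨ⟩ := exists_radauSolution hq hyz he
  -- A coefficient of the projection is a fixed linear functional of finitely many data, so it is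
  -- continuous and preserves derivatives.
  let L : (Fin q → ℝ) →L[ℝ] ℝ := LinearMap.toContinuousLinearMap ((lcoeff ℝ k) ∘ₗ Ψ)
  have hL : ∀ d, L d = (Ψ d).coeff k := fun _ => rfl
  have h1 : HasDerivWithinAt (fun s => L (radauData q y z e (R s))) (L (radauData q y z e R')) I t :=
    L.hasFDerivAt.comp_hasDerivWithinAt t hd
  rw [(hΨ R' hR' p').1 hp', ← hL]
  exact h1.congr (fun s hs => by rw [(hΨ _ (hR s hs) _).1 (hp s hs), hL])
    (by rw [(hΨ _ (hR t ht) _).1 (hp t ht), hL])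

/-- Optimal order error estimate for the Gauss–Radau projection. -/
theorem IsRadau.integral_sq_le {q : ℕ} (hq : 1 ≤ q) {y z e : ℝ} (hyz : y < z) (he : e = y ∨ e = z)
    {R : ℝ → ℝ} (hR : ContinuousOn R (Icc y z)) {p P : ℝ[X]} (hp : IsRadau q y z e R p)
    (hP : P.degree < (q : WithBot ℕ)) {S : ℝ}
    (hS : ∀ x ∈ Icc y z, |R x - P.eval x| ≤ |x - e| ^ (q - 1) * Real.sqrt |x - e| * S) :
    ∫ x in y..z, (p.eval x - R x) ^ 2 ≤ 4 * (z - y) ^ (2 * q) * S ^ 2 := by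
  obtain ⟨k, rfl⟩ : ∃ k, q = k + 1 := ⟨q - 1, by omega⟩
  simp only [Nat.add_sub_cancel] at hS
  have heI := endpoint_mem_Icc hyz.le he
  -- At `x = e` the factor `√|x - e|` in the Taylor bound vanishes.
  have hRe : R e = P.eval e := by
    have := hS e heI
    simp only [sub_self, abs_zero, Real.sqrt_zero, mul_zero, zero_mul] at this
    exact sub_eq_zero.1 (abs_nonpos_iff.1 this)
  obtain ⟨M, hM, hD⟩ := exists_factor_of_eval_eq_zero (D := p - P) (q := k + 1) (e := e)
    ((degree_sub_le _ _).trans_lt (max_lt hp.degree_lt hP))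
    (by rw [eval_sub, hp.eval_eq, hRe, sub_self])
  have hDx : ∀ x, p.eval x - P.eval x = (x - e) * M.eval x := fun x => by
    rw [← eval_sub, hD]; simp
  set h := z - y with hh
  have hh0 : 0 < h := sub_pos.2 hyz
  have hxe : ∀ x ∈ Icc y z, |x - e| ≤ h := fun x hx => by
    rw [abs_le]; constructor <;> linarith [hx.1, hx.2, heI.1, heI.2]
  obtain ⟨s, hs1, hs⟩ := exists_sign_of_endpoint he
  have hρ2 : ∀ x ∈ Icc y z, (R x - P.eval x) ^ 2 ≤ |x - e| * (h ^ (2 * k) * S ^ 2) := by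
    intro x hx
    rw [← sq_abs]
    calc |R x - P.eval x| ^ 2 ≤ (|x - e| ^ k * Real.sqrt |x - e| * S) ^ 2 :=
          pow_le_pow_left₀ (abs_nonneg _) (hS x hx) 2
      _ = |x - e| ^ (2 * k) * (|x - e| * S ^ 2) := by
          rw [mul_pow, mul_pow, Real.sq_sqrt (abs_nonneg _)]; ring
      _ ≤ h ^ (2 * k) * (|x - e| * S ^ 2) := by
          gcongr; exact hxe x hx
      _ = _ := by ring
  set A := ∫ x in y..z, |x - e| * M.eval x ^ 2 with hA
  have hRi : IntervalIntegrable (fun x => M.eval x * (R x - P.eval x)) volume y z :=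
    intervalIntegrable_eval_mul hyz.le (hR.sub P.continuous.continuousOn) M
  have hAi : IntervalIntegrable (fun x => |x - e| * M.eval x ^ 2) volume y z :=
    Continuous.intervalIntegrable (by fun_prop) _ _
  -- Orthogonality tested with `M`, where `p - P = (x - e) M`, replaces `(x - e) M²` by `M (R - P)`.
  have hAeq : A = ∫ x in y..z, s * (M.eval x * (R x - P.eval x)) := by
    have h0 := hp.orth M hM
    have h1 : ∫ x in y..z, M.eval x * (p.eval x - R x)
        = (∫ x in y..z, M.eval x * ((x - e) * M.eval x))
          - ∫ x in y..z, M.eval x * (R x - P.eval x) := by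
      rw [← intervalIntegral.integral_sub (Continuous.intervalIntegrable (by fun_prop) _ _) hRi]
      congr 1; ext x
      rw [← hDx]; ring
    have h2 : A = ∫ x in y..z, s * (M.eval x * ((x - e) * M.eval x)) := by
      refine intervalIntegral.integral_congr fun x hx => ?_
      rw [uIcc_of_le hyz.le] at hx
      rw [← hs x hx]; ring
    rw [h2, intervalIntegral.integral_const_mul, intervalIntegral.integral_const_mul]
    rw [h0] at h1
    rw [sub_eq_zero.1 h1.symm]
  -- Young's inequality with weight `|x - e|`: the bound `hρ2` contains this same weight, so half of
  -- `|x - e| M²` is absorbed into `A` and the rest is a constant.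
  have hAle : A ≤ h * (h ^ (2 * k) * S ^ 2) := by
    have h1 : ∫ x in y..z, s * (M.eval x * (R x - P.eval x))
        ≤ ∫ x in y..z, (1 / 2 * (|x - e| * M.eval x ^ 2) + 1 / 2 * (h ^ (2 * k) * S ^ 2)) := by
      refine intervalIntegral.integral_mono_on hyz.le (hRi.const_mul s)
        (Continuous.intervalIntegrable (by fun_prop) _ _) fun x hx => ?_
      refine (le_abs_self _).trans ?_
      rw [abs_mul, hs1, one_mul]
      rcases eq_or_ne x e with rfl | hne
      · rw [hRe]; simp; positivity
      have hpos : 0 < |x - e| := abs_pos.2 (sub_ne_zero.2 hne)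
      have h2 := hρ2 x hx
      have h3 : |M.eval x * (R x - P.eval x)| ^ 2
          ≤ (|x - e| * M.eval x ^ 2) * (h ^ (2 * k) * S ^ 2) := by
        rw [sq_abs, mul_pow]
        nlinarith [mul_le_mul_of_nonneg_left h2 (sq_nonneg (M.eval x))]
      have h4 : 0 ≤ |x - e| * M.eval x ^ 2 := by positivity
      have h5 : 0 ≤ h ^ (2 * k) * S ^ 2 := by positivity
      refine abs_le_of_sq_le_sq ?_ (by positivity)
      rw [sq_abs] at h3
      nlinarith [sq_nonneg (|x - e| * M.eval x ^ 2 - h ^ (2 * k) * S ^ 2)]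
    rw [← hAeq, intervalIntegral.integral_add (hAi.const_mul _)
      (intervalIntegrable_const), intervalIntegral.integral_const_mul,
      intervalIntegral.integral_const, smul_eq_mul, ← hA, ← hh] at h1
    linarith
  -- Split `p - R = (p - P) - (R - P)`. One factor `|x - e|` of `(p - P)²` is bounded by `h`, and
  -- the other is the weight in `A`.
  have hfin : ∫ x in y..z, (p.eval x - R x) ^ 2
      ≤ ∫ x in y..z, (2 * h * (|x - e| * M.eval x ^ 2) + 2 * (h * (h ^ (2 * k) * S ^ 2))) := by
    refine intervalIntegral.integral_mono_on hyz.le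
      (((p.continuous.continuousOn.sub hR).pow 2).intervalIntegrable_of_Icc hyz.le)
      (Continuous.intervalIntegrable (by fun_prop) _ _) fun x hx => ?_
    have h1 := hρ2 x hx
    have h2 := hxe x hx
    have h3 : (p.eval x - P.eval x) ^ 2 ≤ h * (|x - e| * M.eval x ^ 2) := by
      rw [hDx, mul_pow, ← sq_abs (x - e), sq]
      nlinarith [mul_le_mul_of_nonneg_right h2
        (by positivity : 0 ≤ |x - e| * M.eval x ^ 2)]
    have h4 : |x - e| * (h ^ (2 * k) * S ^ 2) ≤ h * (h ^ (2 * k) * S ^ 2) :=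
      mul_le_mul_of_nonneg_right h2 (by positivity)
    nlinarith [sq_nonneg ((p.eval x - P.eval x) + (R x - P.eval x))]
  rw [intervalIntegral.integral_add (hAi.const_mul _) intervalIntegrable_const,
    intervalIntegral.integral_const_mul, intervalIntegral.integral_const, smul_eq_mul, ← hA,
    ← hh] at hfin
  have : 2 * h * A ≤ 2 * h * (h * (h ^ (2 * k) * S ^ 2)) := by gcongr
  calc _ ≤ _ := hfin
    _ ≤ 2 * h * (h * (h ^ (2 * k) * S ^ 2)) + h * (2 * (h * (h ^ (2 * k) * S ^ 2))) := by gcongr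
    _ = _ := by ring

/-! ### Properties of the fluxes -/

theorem Trace.ext' {a b : Trace} (hv : a.v = b.v) (hp : a.p = b.p) : a = b := by
  cases a; cases b; simp_all

instance : Sub Trace := ⟨fun a b => ⟨a.v - b.v, a.p - b.p⟩⟩

@[simp] theorem Trace.sub_v (a b : Trace) : (a - b).v = a.v - b.v := rfl

@[simp] theorem Trace.sub_p (a b : Trace) : (a - b).p = a.p - b.p := rfl

theorem interFlux_sub (P : Params) (L R L' R' : Trace) :
    interFlux P (L - L') (R - R') = interFlux P L R - interFlux P L' R' := by
  apply Trace.ext' <;> simp only [interFlux, Trace.sub_v, Trace.sub_p] <;> ring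

theorem boundaryFlux_sub (P : Params) (n : ℝ) (S S' : Trace) :
    boundaryFlux P n (S - S') = boundaryFlux P n S - boundaryFlux P n S' := by
  unfold boundaryFlux
  split_ifs <;> apply Trace.ext' <;>
    simp only [inflowFlux, outflowFlux, Trace.sub_v, Trace.sub_p] <;> ring

theorem nodeFlux_sub (P : Params) (bc : BoundaryType) (N : ℕ) (aL aR bL bR : ℕ → Trace) (i : ℕ) :
    nodeFlux P bc N (fun j => aL j - bL j) (fun j => aR j - bR j) i
      = nodeFlux P bc N aL aR i - nodeFlux P bc N bL bR i := by
  unfold nodeFlux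
  split_ifs
  · exact interFlux_sub _ _ _ _ _
  all_goals cases bc
  · exact interFlux_sub _ _ _ _ _
  · exact boundaryFlux_sub _ _ _ _
  · exact interFlux_sub _ _ _ _ _
  · exact boundaryFlux_sub _ _ _ _

theorem nodeFlux_congr (P : Params) (bc : BoundaryType) {N : ℕ} (hN : 0 < N)
    {aL aR bL bR : ℕ → Trace} (hL : ∀ j < N, aL j = bL j) (hR : ∀ j < N, aR j = bR j) (i : ℕ) :
    nodeFlux P bc N aL aR i = nodeFlux P bc N bL bR i := by
  unfold nodeFlux
  split_ifs with h
  · rw [hL i h.2, hR (i - 1) (by omega)]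
  all_goals rw [hL 0 hN, hR (N - 1) (by omega)]

theorem nodeFlux_succ (P : Params) (bc : BoundaryType) {N : ℕ} (trL trR : ℕ → Trace) {j : ℕ}
    (hj : j + 1 < N) : nodeFlux P bc N trL trR (j + 1) = interFlux P (trR j) (trL (j + 1)) := by
  unfold nodeFlux
  rw [if_pos ⟨by omega, hj⟩, Nat.add_sub_cancel]

theorem nodeFlux_periodic_zero (P : Params) (N : ℕ) (trL trR : ℕ → Trace) :
    nodeFlux P .periodic N trL trR 0 = interFlux P (trR (N - 1)) (trL 0) := by
  simp [nodeFlux]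

theorem nodeFlux_periodic_last (P : Params) (N : ℕ) (trL trR : ℕ → Trace) :
    nodeFlux P .periodic N trL trR N = interFlux P (trR (N - 1)) (trL 0) := by
  simp [nodeFlux]

theorem nodeFlux_physical_zero (P : Params) (N : ℕ) (trL trR : ℕ → Trace) :
    nodeFlux P .physical N trL trR 0 = boundaryFlux P (-1) (trL 0) := by
  simp [nodeFlux]

theorem nodeFlux_physical_last (P : Params) {N : ℕ} (hN : 0 < N) (trL trR : ℕ → Trace) :
    nodeFlux P .physical N trL trR N = boundaryFlux P 1 (trR (N - 1)) := by
  simp [nodeFlux, hN.ne']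

/-- To prove something about all node fluxes, it suffices to treat interior nodes, the periodic
seam, and the two physical boundary points. -/
theorem nodeFlux_cases (P : Params) (bc : BoundaryType) {N : ℕ} (hN : 0 < N) (trL trR : ℕ → Trace)
    {motive : ℕ → Trace → Prop}
    (interior : ∀ j, j + 1 < N → motive (j + 1) (interFlux P (trR j) (trL (j + 1))))
    (seam : bc = .periodic → motive 0 (interFlux P (trR (N - 1)) (trL 0)) ∧
      motive N (interFlux P (trR (N - 1)) (trL 0)))
    (left : bc = .physical → motive 0 (boundaryFlux P (-1) (trL 0)))
    (right : bc = .physical → motive N (boundaryFlux P 1 (trR (N - 1)))) :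
    ∀ i ≤ N, motive i (nodeFlux P bc N trL trR i) := by
  intro i hi
  rcases Nat.eq_zero_or_pos i with rfl | h0
  · cases bc
    · rw [nodeFlux_periodic_zero]; exact (seam rfl).1
    · rw [nodeFlux_physical_zero]; exact left rfl
  rcases hi.lt_or_eq with h | rfl
  · obtain ⟨j, rfl⟩ : ∃ j, i = j + 1 := ⟨i - 1, by omega⟩
    rw [nodeFlux_succ P bc trL trR h]; exact interior j h
  · cases bc
    · rw [nodeFlux_periodic_last]; exact (seam rfl).2
    · rw [nodeFlux_physical_last P hN]; exact right rfl

/-! ### Consistency -/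

theorem interFlux_self (P : Params) (S : Trace) : interFlux P S S = S := by
  apply Trace.ext' <;> simp only [interFlux] <;> ring

theorem inflowFlux_eq_self {P : Params} {n : ℝ} {S : Trace} (hn : n * n = 1) (hξ : 0 < P.ξ)
    (hw : P.w * n < 0) (hS : S.v = P.w * S.p) : inflowFlux P n S = S := by
  have h0 : P.ξ - P.w * n ≠ 0 := by linarith
  have h1 : P.ξ * (S.p * n) - S.v = (P.ξ - P.w * n) * (S.p * n) := by
    rw [hS]; linear_combination (P.w * S.p) * hn
  apply Trace.ext' <;> simp only [inflowFlux] <;> rw [h1]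
  · rw [div_mul_eq_mul_div, mul_left_comm, mul_div_cancel_left₀ _ h0, hS]
    linear_combination (P.w * S.p) * hn
  · rw [mul_div_cancel_left₀ _ h0]
    linear_combination S.p * hn

theorem outflowFlux_eq_self {P : Params} {n : ℝ} {S : Trace} (hn : n * n = 1) (hξ : 0 < P.ξ)
    (hS : S.v + P.ξ * (S.p * n) = 0) : outflowFlux P n S = S := by
  have hv : S.v = - (P.ξ * (S.p * n)) := by linarith
  apply Trace.ext' <;> simp only [outflowFlux]
  · linarith
  · rw [hv]
    field_simp
    linear_combination (2 * S.p) * hn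

/-- Equal one-sided traces reproduce themselves in the inter-element flux. Only the seam and the
physical end points need information about the exact solution. -/
theorem nodeFlux_consistent (P : Params) (bc : BoundaryType) {N : ℕ} (hN : 0 < N) (x : ℕ → ℝ)
    (ex : ℝ → Trace) (hper : bc = .periodic → ex (x 0) = ex (x N))
    (hleft : bc = .physical → boundaryFlux P (-1) (ex (x 0)) = ex (x 0))
    (hright : bc = .physical → boundaryFlux P 1 (ex (x N)) = ex (x N)) :
    ∀ i ≤ N, nodeFlux P bc N (fun j => ex (x j)) (fun j => ex (x (j + 1))) i = ex (x i) := by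
  have hN1 : N - 1 + 1 = N := by omega
  refine nodeFlux_cases P bc hN _ _ (motive := fun i S => S = ex (x i)) ?_ ?_ ?_ ?_
  · intro j _; exact interFlux_self _ _
  · intro h
    simp only [hN1]
    rw [hper h]
    exact ⟨interFlux_self _ _, interFlux_self _ _⟩
  · intro h; exact hleft h
  · intro h; simp only [hN1]; exact hright h

/-! ### The flux of the projection error -/

/-- The contribution of the left side to `(v*, p*)` is `(αv - ηp, -βv + (1-α)p)`, and the end point
condition says that its two components are equal, to `s` say. The determinant `α(1-α) - βη`
vanishes, which forces `(α+β)s = 0` and `(1-α+η)s = 0`. The two factors add up to `1+β+η > 0`, so `s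
= 0`. -/
theorem Admissible.left_zero {P : Params} {bc : BoundaryType} (h : Admissible P bc) {v p : ℝ}
    (hR : (P.β + P.α) * v - (1 + P.η - P.α) * p = 0) :
    P.α * v - P.η * p = 0 ∧ -P.β * v + (1 - P.α) * p = 0 := by
  have hf := h.flux
  set s := P.α * v - P.η * p with hs
  have h1 : P.β * v - (1 - P.α) * p = -s := by rw [hs]; linarith
  have e1 : (P.α + P.β) * s = 0 := by
    linear_combination P.α * h1 + P.β * hs + p * hf
  have e2 : (1 - P.α + P.η) * s = 0 := by
    linear_combination (1 - P.α) * hs + P.η * h1 + v * hf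
  have : s = 0 := by
    by_contra hne
    have a1 := (mul_eq_zero.1 e1).resolve_right hne
    have a2 := (mul_eq_zero.1 e2).resolve_right hne
    linarith [h.α_nonneg, h.α_le_one, h.β_nonneg, h.η_nonneg]
  exact ⟨this, by linarith⟩

theorem Admissible.right_zero {P : Params} {bc : BoundaryType} (h : Admissible P bc) {v p : ℝ}
    (hL : (1 + P.β - P.α) * v + (P.η + P.α) * p = 0) :
    (1 - P.α) * v + P.η * p = 0 ∧ P.β * v + P.α * p = 0 := by
  have hf := h.flux
  set s := (1 - P.α) * v + P.η * p with hs
  have h1 : P.β * v + P.α * p = -s := by rw [hs]; linarith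
  have e1 : (1 - P.α + P.β) * s = 0 := by
    linear_combination (1 - P.α) * h1 + P.β * hs - p * hf
  have e2 : (P.α + P.η) * s = 0 := by
    linear_combination P.α * hs + P.η * h1 + v * hf
  have : s = 0 := by
    by_contra hne
    have a1 := (mul_eq_zero.1 e1).resolve_right hne
    have a2 := (mul_eq_zero.1 e2).resolve_right hne
    linarith [h.α_nonneg, h.α_le_one, h.β_nonneg, h.η_nonneg]
  exact ⟨this, by linarith⟩

theorem Admissible.interFlux_eq_zero {P : Params} {bc : BoundaryType} (h : Admissible P bc)
    {L R : Trace} (hL : (P.β + P.α) * L.v - (1 + P.η - P.α) * L.p = 0)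
    (hR : (1 + P.β - P.α) * R.v + (P.η + P.α) * R.p = 0) : interFlux P L R = ⟨0, 0⟩ := by
  obtain ⟨a1, a2⟩ := h.left_zero hL
  obtain ⟨b1, b2⟩ := h.right_zero hR
  apply Trace.ext' <;> simp only [interFlux]
  · linear_combination a1 + b1
  · linear_combination a2 + b2

theorem boundaryFlux_eq_zero {P : Params} {n : ℝ} {S : Trace} (h : S.v - P.ξ * (S.p * n) = 0) :
    boundaryFlux P n S = ⟨0, 0⟩ := by
  have h1 : P.ξ * (S.p * n) - S.v = 0 := by linarith
  unfold boundaryFlux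
  split_ifs <;> apply Trace.ext' <;> simp [inflowFlux, outflowFlux, h1, h]

theorem leftCondition_of_not {P : Params} {bc : BoundaryType} {j : ℕ} {δ : Trace}
    (h : ¬ (bc = .physical ∧ j = 0)) :
    LeftCondition P bc j δ ↔ (1 + P.β - P.α) * δ.v + (P.η + P.α) * δ.p = 0 := by
  cases bc <;> cases j <;> simp_all [LeftCondition]

theorem nodeFlux_error_eq_zero {P : Params} {bc : BoundaryType} (h : Admissible P bc) {N : ℕ}
    (hN : 0 < N) {trL trR : ℕ → Trace} (hL : ∀ j < N, LeftCondition P bc j (trL j))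
    (hR : ∀ j < N, RightCondition P bc N j (trR j)) :
    ∀ i ≤ N, nodeFlux P bc N trL trR i = ⟨0, 0⟩ := by
  refine nodeFlux_cases P bc hN _ _ (motive := fun _ S => S = ⟨0, 0⟩) ?_ ?_ ?_ ?_
  · intro j hj
    refine h.interFlux_eq_zero ?_ ?_
    · have := hR j (by omega)
      rwa [RightCondition, if_neg (by omega)] at this
    · exact (leftCondition_of_not (by omega)).1 (hL (j + 1) hj)
  · rintro rfl
    have key := h.interFlux_eq_zero (L := trR (N - 1)) (R := trL 0) (by
      have := hR (N - 1) (by omega)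
      rwa [RightCondition, if_neg (by simp)] at this)
      ((leftCondition_of_not (by simp)).1 (hL 0 hN))
    exact ⟨key, key⟩
  · rintro rfl
    refine boundaryFlux_eq_zero ?_
    have : (trL 0).v + P.ξ * (trL 0).p = 0 := hL 0 hN
    linarith
  · rintro rfl
    refine boundaryFlux_eq_zero ?_
    have := hR (N - 1) (by omega)
    rw [RightCondition, if_pos ⟨rfl, by omega⟩] at this
    linarith

/-! ### The fluxes do not create energy -/

/-- The contribution of an end point with traces `s` and flux `S` to the energy balance. -/
noncomputable def energyFlux (P : Params) (s S : Trace) : ℝ :=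
  -(P.c ^ 2 * P.w * s.p ^ 2 / 2) + P.c ^ 2 * (s.p * s.v) - P.w * s.v ^ 2 / 2
    + s.p * (P.c ^ 2 * P.w * S.p - P.c ^ 2 * S.v) + s.v * (P.w * S.v - P.c ^ 2 * S.p)

theorem quadratic_form_nonneg {A B E x y : ℝ} (hA : 0 ≤ A) (hB : 0 ≤ B) (h : E ^ 2 ≤ 4 * A * B) :
    0 ≤ A * x ^ 2 + E * (x * y) + B * y ^ 2 := by
  rcases hA.eq_or_lt with rfl | hA'
  · have : E = 0 := by nlinarith
    subst this
    nlinarith [mul_nonneg hB (sq_nonneg y)]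
  · have : 0 ≤ 4 * A * (A * x ^ 2 + E * (x * y) + B * y ^ 2) := by
      nlinarith [sq_nonneg (2 * A * x + E * y), mul_nonneg (sub_nonneg.2 h) (sq_nonneg y)]
    exact nonneg_of_mul_nonneg_right this (by positivity)

/-- The difference is a quadratic form in the jumps `[[v]]` and `[[p]]` alone, with diagonal
coefficients `A` and `c² B` and mixed coefficient `-w(η + c²β)`. The subsonic condition is exactly
the discriminant condition for this form. -/
theorem Admissible.interior_energy {P : Params} {bc : BoundaryType} (h : Admissible P bc)
    (L R : Trace) :
    0 ≤ energyFlux P L (interFlux P L R) - energyFlux P R (interFlux P L R) := by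
  have hs := h.stable
  have hc := h.c_pos
  rw [FluxStable] at hs
  set A := P.c ^ 2 * P.β - P.w * (1 / 2 - P.α) with hA
  set B := P.η + P.w * (1 / 2 - P.α) with hB
  have hsum : 0 ≤ A + B := by
    have : A + B = P.c ^ 2 * P.β + P.η := by rw [hA, hB]; ring
    rw [this]
    have := mul_nonneg (sq_nonneg P.c) h.β_nonneg
    linarith [h.η_nonneg]
  have hprod : 0 ≤ B * A := by
    have h4 : 0 ≤ 4 * P.c ^ 2 * (B * A) := by
      have : 0 ≤ P.w ^ 2 * (P.c ^ 2 * P.β + P.η) ^ 2 := by positivity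
      linarith
    exact nonneg_of_mul_nonneg_right h4 (by positivity)
  -- `A` and `B` have nonnegative sum and nonnegative product, so both are nonnegative.
  have hA0 : 0 ≤ A := by
    by_contra hn
    have : B ≤ 0 := by nlinarith
    linarith
  have hB0 : 0 ≤ B := by
    by_contra hn
    have : A ≤ 0 := by nlinarith
    linarith
  have key := quadratic_form_nonneg (A := A) (B := P.c ^ 2 * B)
    (E := -(P.w * (P.η + P.c ^ 2 * P.β))) (x := L.v - R.v) (y := L.p - R.p) hA0
    (by positivity) (by nlinarith)
  have e : energyFlux P L (interFlux P L R) - energyFlux P R (interFlux P L R)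
      = A * (L.v - R.v) ^ 2 + -(P.w * (P.η + P.c ^ 2 * P.β)) * ((L.v - R.v) * (L.p - R.p))
        + P.c ^ 2 * B * (L.p - R.p) ^ 2 := by
    simp only [energyFlux, interFlux, hA, hB]
    ring
  rw [e]; exact key

/-- The flux keeps `v - ξ n p`, so `v - v* = ξ n (p - p*)`. Together with the boundary condition
satisfied by `(v*, p*)` this diagonalizes the energy flux in `p*` and `d = p - p*`. The coefficient
of `d²` is `c²ξ - wn(c²+ξ²)/2` at both kinds of ends; that of `p*²` is `wn(w²-c²)/2` at inflow and
`c²ξ + wn(c²+ξ²)/2` at outflow. -/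
theorem Admissible.boundary_energy {P : Params} (h : Admissible P .physical) {n : ℝ}
    (hn : n = 1 ∨ n = -1) (S : Trace) : 0 ≤ n * energyFlux P S (boundaryFlux P n S) := by
  obtain ⟨hw, hξ, hle⟩ := h.physical rfl
  have hc := h.c_pos
  have hnn : n * n = 1 := by rcases hn with rfl | rfl <;> norm_num
  have hwn : |P.w * n| = |P.w| := by rcases hn with rfl | rfl <;> simp
  have hden : 0 < P.c ^ 2 + P.ξ ^ 2 := by positivity
  have hb : |P.w * n| * (P.c ^ 2 + P.ξ ^ 2) ≤ 2 * P.c ^ 2 * P.ξ := by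
    rw [hwn]; exact (le_div_iff₀ hden).1 hle
  set T := boundaryFlux P n S with hT
  set d := S.p - T.p with hd
  rcases lt_or_ge (P.w * n) 0 with hneg | hpos
  · have h0 : P.ξ - P.w * n ≠ 0 := by linarith
    have hTe : T = inflowFlux P n S := by rw [hT, boundaryFlux, if_pos hneg]
    have t1 : T.v = P.w * T.p := by
      rw [hTe]; simp only [inflowFlux]; ring
    have t2 : S.v = T.v + P.ξ * n * d := by
      have t3 : T.p * (P.ξ - P.w * n) = n * (P.ξ * (S.p * n) - S.v) := by
        rw [hTe]; simp only [inflowFlux]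
        rw [mul_assoc, div_mul_cancel₀ _ h0]
      rw [hd, t1]
      have hn0 : n ≠ 0 := by rintro rfl; norm_num at hnn
      apply mul_left_cancel₀ hn0
      linear_combination t3 + P.ξ * T.p * hnn
    have hp : S.p = T.p + d := by rw [hd]; ring
    have e : n * energyFlux P S T = P.w * n / 2 * T.p ^ 2 * (P.w ^ 2 - P.c ^ 2)
        + d ^ 2 * (P.c ^ 2 * P.ξ - P.w * n * (P.c ^ 2 + P.ξ ^ 2) / 2) := by
      simp only [energyFlux]
      rw [t2, hp, t1]
      linear_combination (P.c ^ 2 * P.ξ * d ^ 2 - n * P.w * P.ξ ^ 2 * d ^ 2 / 2) * hnn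
    rw [e]
    -- From `2cξ ≤ c² + ξ²`, the bound assumed for `|w|` is at most `c`.
    have hwc : |P.w| ≤ P.c := by
      rw [hwn] at hb
      have : |P.w| * (P.c ^ 2 + P.ξ ^ 2) ≤ P.c * (P.c ^ 2 + P.ξ ^ 2) := by
        nlinarith [mul_nonneg hc.le (sq_nonneg (P.c - P.ξ))]
      exact le_of_mul_le_mul_right this hden
    have hw2 : P.w ^ 2 ≤ P.c ^ 2 := sq_le_sq' (by linarith [neg_abs_le P.w]) ((le_abs_self _).trans hwc)
    have i1 : 0 ≤ P.w * n / 2 * T.p ^ 2 * (P.w ^ 2 - P.c ^ 2) := by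
      apply mul_nonneg_of_nonpos_of_nonpos _ (by linarith)
      exact mul_nonpos_of_nonpos_of_nonneg (by linarith) (sq_nonneg _)
    have i2 : P.w * n * (P.c ^ 2 + P.ξ ^ 2) ≤ 0 :=
      mul_nonpos_of_nonpos_of_nonneg hneg.le hden.le
    have i3 : 0 ≤ P.c ^ 2 * P.ξ - P.w * n * (P.c ^ 2 + P.ξ ^ 2) / 2 := by
      have : 0 ≤ P.c ^ 2 * P.ξ := by positivity
      linarith
    exact add_nonneg i1 (mul_nonneg (sq_nonneg d) i3)
  · have hTe : T = outflowFlux P n S := by rw [hT, boundaryFlux, if_neg (not_lt.2 hpos)]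
    have t1 : T.v = -(P.ξ * n * T.p) := by
      rw [hTe]; simp only [outflowFlux]
      field_simp
      linear_combination (n * S.p * P.ξ - S.v) * hnn
    have t2 : S.v = T.v + P.ξ * n * d := by
      have t3 : 2 * T.v = S.v - P.ξ * (S.p * n) := by
        rw [hTe]; simp only [outflowFlux]; ring
      rw [hd]
      linear_combination t1 - t3
    have hp : S.p = T.p + d := by rw [hd]; ring
    have e : n * energyFlux P S T = T.p ^ 2 * (P.c ^ 2 * P.ξ + P.w * n * (P.c ^ 2 + P.ξ ^ 2) / 2)
        + d ^ 2 * (P.c ^ 2 * P.ξ - P.w * n * (P.c ^ 2 + P.ξ ^ 2) / 2) := by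
      simp only [energyFlux]
      rw [t2, hp, t1]
      linear_combination (P.c ^ 2 * P.ξ * d ^ 2 - n * P.w * P.ξ ^ 2 * d ^ 2 / 2
        + P.c ^ 2 * P.ξ * T.p ^ 2 + n * P.w * P.ξ ^ 2 * T.p ^ 2 / 2) * hnn
    rw [e]
    rw [abs_of_nonneg hpos] at hb
    have i2 : 0 ≤ P.c ^ 2 * P.ξ - P.w * n * (P.c ^ 2 + P.ξ ^ 2) / 2 := by linarith
    have i3 : 0 ≤ P.w * n * (P.c ^ 2 + P.ξ ^ 2) := mul_nonneg hpos hden.le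
    positivity

/-- The sum over elements is regrouped by nodes: shifting the index in the left-end terms pairs the
two sides of each interior node, and leaves the first and the last end, which are the seam or the
physical boundary. -/
theorem Admissible.energy_dissipation {P : Params} {bc : BoundaryType} (h : Admissible P bc)
    {N : ℕ} (hN : 0 < N) (trL trR : ℕ → Trace) :
    0 ≤ ∑ j ∈ Finset.range N,
      (energyFlux P (trR j) (nodeFlux P bc N trL trR (j + 1))
        - energyFlux P (trL j) (nodeFlux P bc N trL trR j)) := by
  obtain ⟨k, rfl⟩ : ∃ k, N = k + 1 := ⟨N - 1, by omega⟩
  rw [Finset.sum_sub_distrib, Finset.sum_range_succ, Finset.sum_range_succ']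
  have hint : 0 ≤ ∑ j ∈ Finset.range k,
      (energyFlux P (trR j) (nodeFlux P bc (k + 1) trL trR (j + 1))
        - energyFlux P (trL (j + 1)) (nodeFlux P bc (k + 1) trL trR (j + 1))) := by
    refine Finset.sum_nonneg fun j hj => ?_
    have := Finset.mem_range.1 hj
    rw [nodeFlux_succ P bc trL trR (by omega)]
    exact h.interior_energy _ _
  rw [Finset.sum_sub_distrib] at hint
  have hend : 0 ≤ energyFlux P (trR k) (nodeFlux P bc (k + 1) trL trR (k + 1))
      - energyFlux P (trL 0) (nodeFlux P bc (k + 1) trL trR 0) := by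
    cases bc
    · rw [nodeFlux_periodic_zero, nodeFlux_periodic_last]
      exact h.interior_energy _ _
    · rw [nodeFlux_physical_zero, nodeFlux_physical_last P hN]
      have h1 := h.boundary_energy (Or.inl rfl) (trR k)
      have h2 := h.boundary_energy (Or.inr rfl) (trL 0)
      simp only [Nat.add_sub_cancel]
      linarith
  linarith

/-! ### The coupled projection of `(∂u/∂x, v)` on one element -/

/-- `(pp, pv)` is the projection of `(F, G)` on `(y, z)` with the end point conditions
`l₁ δ_v + l₂ δ_p = 0` at `y` and `r₁ δ_v - r₂ δ_p = 0` at `z`. -/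
structure IsPairProjection (q : ℕ) (l r : ℝ × ℝ) (y z : ℝ) (F G : ℝ → ℝ) (pp pv : ℝ[X]) :
    Prop where
  degree_p : pp.degree < (q : WithBot ℕ)
  degree_v : pv.degree < (q : WithBot ℕ)
  orth_p : ∀ φ : ℝ[X], φ.degree < ((q - 1 : ℕ) : WithBot ℕ) →
    ∫ x in y..z, φ.eval x * (pp.eval x - F x) = 0
  orth_v : ∀ φ : ℝ[X], φ.degree < ((q - 1 : ℕ) : WithBot ℕ) →
    ∫ x in y..z, φ.eval x * (pv.eval x - G x) = 0
  left_end : l.1 * (pv.eval y - G y) + l.2 * (pp.eval y - F y) = 0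
  right_end : r.1 * (pv.eval z - G z) - r.2 * (pp.eval z - F z) = 0

theorem degree_smul_add_smul_lt {q : ℕ} {p r : ℝ[X]} (hp : p.degree < (q : WithBot ℕ))
    (hr : r.degree < (q : WithBot ℕ)) (a b : ℝ) : (a • p + b • r).degree < (q : WithBot ℕ) :=
  mem_degreeLT.1 (add_mem (Submodule.smul_mem _ _ (mem_degreeLT.2 hp))
    (Submodule.smul_mem _ _ (mem_degreeLT.2 hr)))

theorem integral_eval_mul_add {y z : ℝ} (hyz : y ≤ z) {R R' : ℝ → ℝ}
    (hR : ContinuousOn R (Icc y z)) (hR' : ContinuousOn R' (Icc y z)) (φ : ℝ[X]) (a b : ℝ) :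
    ∫ x in y..z, φ.eval x * (a * R x + b * R' x)
      = a * (∫ x in y..z, φ.eval x * R x) + b * ∫ x in y..z, φ.eval x * R' x := by
  rw [← intervalIntegral.integral_const_mul, ← intervalIntegral.integral_const_mul,
    ← intervalIntegral.integral_add
      ((intervalIntegrable_eval_mul hyz hR φ).const_mul a)
      ((intervalIntegrable_eval_mul hyz hR' φ).const_mul b)]
  congr 1; ext x; ring

/-- The coupled projection decouples into two Gauss–Radau projections. -/
theorem isPairProjection_iff {q : ℕ} {l r : ℝ × ℝ} (hD : l.1 * r.2 + l.2 * r.1 ≠ 0)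
    {y z : ℝ} (hyz : y < z) {F G : ℝ → ℝ} (hF : ContinuousOn F (Icc y z))
    (hG : ContinuousOn G (Icc y z)) {pp pv : ℝ[X]} :
    IsPairProjection q l r y z F G pp pv ↔
      pp.degree < (q : WithBot ℕ) ∧ pv.degree < (q : WithBot ℕ) ∧
      IsRadau q y z y (fun x => l.1 * G x + l.2 * F x) (l.1 • pv + l.2 • pp) ∧
      IsRadau q y z z (fun x => r.1 * G x + (-r.2) * F x) (r.1 • pv + (-r.2) • pp) := by
  have hcp : ContinuousOn (fun x => pp.eval x - F x) (Icc y z) :=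
    pp.continuous.continuousOn.sub hF
  have hcv : ContinuousOn (fun x => pv.eval x - G x) (Icc y z) :=
    pv.continuous.continuousOn.sub hG
  have hcomb : ∀ (φ : ℝ[X]) (a b : ℝ),
      ∫ x in y..z, φ.eval x * ((a • pv + b • pp).eval x - (a * G x + b * F x))
        = a * (∫ x in y..z, φ.eval x * (pv.eval x - G x))
          + b * ∫ x in y..z, φ.eval x * (pp.eval x - F x) := by
    intro φ a b
    rw [← integral_eval_mul_add hyz.le hcv hcp]
    congr 1; ext x
    simp only [eval_add, eval_smul, smul_eq_mul]; ring
  constructor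
  · intro h
    refine ⟨h.degree_p, h.degree_v, ⟨degree_smul_add_smul_lt h.degree_v h.degree_p _ _, ?_, ?_⟩,
      ⟨degree_smul_add_smul_lt h.degree_v h.degree_p _ _, ?_, ?_⟩⟩
    · simp only [eval_add, eval_smul, smul_eq_mul]
      linarith [h.left_end]
    · intro φ hφ
      rw [hcomb, h.orth_p φ hφ, h.orth_v φ hφ]; ring
    · simp only [eval_add, eval_smul, smul_eq_mul]
      linarith [h.right_end]
    · intro φ hφ
      rw [hcomb, h.orth_p φ hφ, h.orth_v φ hφ]; ring
  · rintro ⟨hp, hv, hl, hr⟩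
    -- The two combinations are inverted by Cramer's rule, with determinant `l₁ r₂ + l₂ r₁`.
    have key : ∀ φ : ℝ[X], φ.degree < ((q - 1 : ℕ) : WithBot ℕ) →
        (∫ x in y..z, φ.eval x * (pp.eval x - F x)) = 0 ∧
        (∫ x in y..z, φ.eval x * (pv.eval x - G x)) = 0 := by
      intro φ hφ
      have h1 := hl.orth φ hφ
      have h2 := hr.orth φ hφ
      rw [hcomb] at h1 h2
      constructor <;> apply mul_left_cancel₀ hD
      · linear_combination r.1 * h1 - l.1 * h2
      · linear_combination r.2 * h1 + l.2 * h2
    refine ⟨hp, hv, fun φ hφ => (key φ hφ).1, fun φ hφ => (key φ hφ).2, ?_, ?_⟩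
    · have := hl.eval_eq
      simp only [eval_add, eval_smul, smul_eq_mul] at this
      linarith
    · have := hr.eval_eq
      simp only [eval_add, eval_smul, smul_eq_mul] at this
      linarith

theorem continuousOn_combination {s : Set ℝ} {F G : ℝ → ℝ} (hF : ContinuousOn F s)
    (hG : ContinuousOn G s) (a b : ℝ) : ContinuousOn (fun x => a * G x + b * F x) s :=
  (continuousOn_const.mul hG).add (continuousOn_const.mul hF)

theorem exists_isRadau {q : ℕ} (hq : 1 ≤ q) {y z e : ℝ} (hyz : y < z) (he : e = y ∨ e = z)
    {R : ℝ → ℝ} (hR : ContinuousOn R (Icc y z)) : ∃ p, IsRadau q y z e R p := by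
  obtain ⟨Ψ, hΨ⟩ := exists_radauSolution hq hyz he
  exact ⟨_, (hΨ R hR _).2 rfl⟩

theorem IsRadau.unique {q : ℕ} (hq : 1 ≤ q) {y z e : ℝ} (hyz : y < z) (he : e = y ∨ e = z)
    {R : ℝ → ℝ} (hR : ContinuousOn R (Icc y z)) {p p' : ℝ[X]} (hp : IsRadau q y z e R p)
    (hp' : IsRadau q y z e R p') : p = p' := by
  obtain ⟨Ψ, hΨ⟩ := exists_radauSolution hq hyz he
  rw [(hΨ R hR p).1 hp, (hΨ R hR p').1 hp']

theorem exists_isPairProjection {q : ℕ} (hq : 1 ≤ q) {l r : ℝ × ℝ}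
    (hD : l.1 * r.2 + l.2 * r.1 ≠ 0) {y z : ℝ} (hyz : y < z) {F G : ℝ → ℝ}
    (hF : ContinuousOn F (Icc y z)) (hG : ContinuousOn G (Icc y z)) :
    ∃ pp pv, IsPairProjection q l r y z F G pp pv := by
  obtain ⟨pl, hl⟩ := exists_isRadau hq hyz (Or.inl rfl) (continuousOn_combination hF hG l.1 l.2)
  obtain ⟨pr, hr⟩ := exists_isRadau hq hyz (Or.inr rfl) (continuousOn_combination hF hG r.1 (-r.2))
  set D := l.1 * r.2 + l.2 * r.1 with hDdef
  have hd := fun a b : ℝ => degree_smul_add_smul_lt hl.degree_lt hr.degree_lt a b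
  -- Cramer's rule again: these are the polynomials whose two end point combinations are `pl` and
  -- `pr`.
  refine ⟨(r.1 / D) • pl + (-l.1 / D) • pr, (r.2 / D) • pl + (l.2 / D) • pr,
    (isPairProjection_iff hD hyz hF hG).2 ⟨hd _ _, hd _ _, ?_, ?_⟩⟩
  · convert hl using 1
    have e1 : l.1 * (r.2 / D) + l.2 * (r.1 / D) = 1 := by field_simp; exact hDdef.symm
    have e2 : l.1 * (l.2 / D) + l.2 * (-l.1 / D) = 0 := by ring
    calc _ = (l.1 * (r.2 / D) + l.2 * (r.1 / D)) • pl
          + (l.1 * (l.2 / D) + l.2 * (-l.1 / D)) • pr := by module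
      _ = pl := by rw [e1, e2]; module
  · convert hr using 1
    have e1 : r.1 * (r.2 / D) + -r.2 * (r.1 / D) = 0 := by ring
    have e2 : r.1 * (l.2 / D) + -r.2 * (-l.1 / D) = 1 := by
      field_simp; rw [hDdef]; ring
    calc _ = (r.1 * (r.2 / D) + -r.2 * (r.1 / D)) • pl
          + (r.1 * (l.2 / D) + -r.2 * (-l.1 / D)) • pr := by module
      _ = pr := by rw [e1, e2]; module

/-- The coupled projection in terms of its two Gauss–Radau projections. -/
theorem pair_eq_of_combination {l r : ℝ × ℝ} (hD : l.1 * r.2 + l.2 * r.1 ≠ 0) (pp pv : ℝ[X]) :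
    pp = (l.1 * r.2 + l.2 * r.1)⁻¹ • (r.1 • (l.1 • pv + l.2 • pp)
      - l.1 • (r.1 • pv + (-r.2) • pp)) ∧
    pv = (l.1 * r.2 + l.2 * r.1)⁻¹ • (r.2 • (l.1 • pv + l.2 • pp)
      + l.2 • (r.1 • pv + (-r.2) • pp)) := by
  constructor <;> rw [eq_inv_smul_iff₀ hD] <;> module

theorem IsPairProjection.unique {q : ℕ} (hq : 1 ≤ q) {l r : ℝ × ℝ}
    (hD : l.1 * r.2 + l.2 * r.1 ≠ 0) {y z : ℝ} (hyz : y < z) {F G : ℝ → ℝ}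
    (hF : ContinuousOn F (Icc y z)) (hG : ContinuousOn G (Icc y z)) {pp pv pp' pv' : ℝ[X]}
    (h : IsPairProjection q l r y z F G pp pv) (h' : IsPairProjection q l r y z F G pp' pv') :
    pp = pp' ∧ pv = pv' := by
  obtain ⟨-, -, hl, hr⟩ := (isPairProjection_iff hD hyz hF hG).1 h
  obtain ⟨-, -, hl', hr'⟩ := (isPairProjection_iff hD hyz hF hG).1 h'
  have e1 := hl.unique hq hyz (Or.inl rfl) (continuousOn_combination hF hG _ _) hl'
  have e2 := hr.unique hq hyz (Or.inr rfl) (continuousOn_combination hF hG _ _) hr'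
  obtain ⟨a1, a2⟩ := pair_eq_of_combination hD pp pv
  obtain ⟨b1, b2⟩ := pair_eq_of_combination hD pp' pv'
  rw [e1, e2] at a1 a2
  exact ⟨a1.trans b1.symm, a2.trans b2.symm⟩

theorem radauData_combination {q : ℕ} {y z e : ℝ} (hyz : y ≤ z) {F G : ℝ → ℝ}
    (hF : ContinuousOn F (Icc y z)) (hG : ContinuousOn G (Icc y z)) (a b : ℝ) :
    radauData q y z e (fun x => a * G x + b * F x)
      = a • radauData q y z e G + b • radauData q y z e F := by
  funext i
  simp only [radauData, Pi.add_apply, Pi.smul_apply, smul_eq_mul]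
  split_ifs
  · have := integral_eval_mul_add hyz hG hF (X ^ (i : ℕ)) a b
    simpa only [eval_pow, eval_X] using this
  · rfl

/-- The coefficients of the coupled projection may be differentiated in time. -/
theorem hasDerivWithinAt_coeff_pair {q : ℕ} (hq : 1 ≤ q) {l r : ℝ × ℝ}
    (hD : l.1 * r.2 + l.2 * r.1 ≠ 0) {y z : ℝ} (hyz : y < z) {I : Set ℝ} {t : ℝ} (ht : t ∈ I)
    {F G : ℝ → ℝ → ℝ} {F' G' : ℝ → ℝ} {pp pv : ℝ → ℝ[X]} {pp' pv' : ℝ[X]}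
    (hF : ∀ s ∈ I, ContinuousOn (F s) (Icc y z)) (hG : ∀ s ∈ I, ContinuousOn (G s) (Icc y z))
    (hF' : ContinuousOn F' (Icc y z)) (hG' : ContinuousOn G' (Icc y z))
    (hp : ∀ s ∈ I, IsPairProjection q l r y z (F s) (G s) (pp s) (pv s))
    (hp' : IsPairProjection q l r y z F' G' pp' pv')
    (hdF : ∀ e, e = y ∨ e = z →
      HasDerivWithinAt (fun s => radauData q y z e (F s)) (radauData q y z e F') I t)
    (hdG : ∀ e, e = y ∨ e = z →
      HasDerivWithinAt (fun s => radauData q y z e (G s)) (radauData q y z e G') I t) (k : ℕ) :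
    HasDerivWithinAt (fun s => (pp s).coeff k) (pp'.coeff k) I t ∧
      HasDerivWithinAt (fun s => (pv s).coeff k) (pv'.coeff k) I t := by
  obtain ⟨-, -, hl', hr'⟩ := (isPairProjection_iff hD hyz hF' hG').1 hp'
  have hs := fun s hs => ((isPairProjection_iff hD hyz (hF s hs) (hG s hs)).1 (hp s hs)).2.2
  have hdata : ∀ (e : ℝ), e = y ∨ e = z → ∀ a b : ℝ, HasDerivWithinAt
      (fun s => radauData q y z e (fun x => a * G s x + b * F s x))
      (radauData q y z e (fun x => a * G' x + b * F' x)) I t := by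
    intro e he a b
    rw [radauData_combination hyz.le hF' hG']
    exact (((hdG e he).const_smul a).add ((hdF e he).const_smul b)).congr
      (fun s hs => radauData_combination hyz.le (hF s hs) (hG s hs) a b)
      (radauData_combination hyz.le (hF t ht) (hG t ht) a b)
  have h1 := hasDerivWithinAt_coeff_radau hq hyz (Or.inl rfl) ht
    (fun s hs => continuousOn_combination (hF s hs) (hG s hs) l.1 l.2)
    (continuousOn_combination hF' hG' l.1 l.2) (fun s h => (hs s h).1) hl'
    (hdata y (Or.inl rfl) l.1 l.2) k
  have h2 := hasDerivWithinAt_coeff_radau hq hyz (Or.inr rfl) ht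
    (fun s hs => continuousOn_combination (hF s hs) (hG s hs) r.1 (-r.2))
    (continuousOn_combination hF' hG' r.1 (-r.2)) (fun s h => (hs s h).2) hr'
    (hdata z (Or.inr rfl) r.1 (-r.2)) k
  have e1 : ∀ a b : ℝ[X], a.coeff k = (l.1 * r.2 + l.2 * r.1)⁻¹ *
      (r.1 * (l.1 • b + l.2 • a).coeff k - l.1 * (r.1 • b + (-r.2) • a).coeff k) := by
    intro a b
    conv_lhs => rw [(pair_eq_of_combination hD a b).1]
    simp only [coeff_smul, coeff_sub, smul_eq_mul]
  have e2 : ∀ a b : ℝ[X], b.coeff k = (l.1 * r.2 + l.2 * r.1)⁻¹ *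
      (r.2 * (l.1 • b + l.2 • a).coeff k + l.2 * (r.1 • b + (-r.2) • a).coeff k) := by
    intro a b
    conv_lhs => rw [(pair_eq_of_combination hD a b).2]
    simp only [coeff_smul, coeff_add, smul_eq_mul]
  constructor
  · rw [e1 pp' pv']
    exact (((h1.const_mul r.1).sub (h2.const_mul l.1)).const_mul _).congr
      (fun s _ => e1 (pp s) (pv s)) (e1 (pp t) (pv t))
  · rw [e2 pp' pv']
    exact (((h1.const_mul r.2).add (h2.const_mul l.2)).const_mul _).congr
      (fun s _ => e2 (pp s) (pv s)) (e2 (pp t) (pv t))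

/-- Optimal order error estimate for a combination of two functions. -/
theorem IsRadau.combination_integral_sq_le {q : ℕ} (hq : 1 ≤ q) {a b y z e : ℝ} (hyz : y < z)
    (hy : a ≤ y) (hz : z ≤ b) (he : e = y ∨ e = z) {F G F' G' : ℝ → ℝ}
    (hF : ContinuousOn F (Icc a b)) (hG : ContinuousOn G (Icc a b))
    (hFi : ∀ i < q, ∃ g, HasL2WeakDeriv i F g a b) (hF' : HasL2WeakDeriv q F F' a b)
    (hGi : ∀ i < q, ∃ g, HasL2WeakDeriv i G g a b) (hG' : HasL2WeakDeriv q G G' a b)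
    {m k K : ℝ} (hm : |m| ≤ K) (hk : |k| ≤ K) {p : ℝ[X]}
    (hp : IsRadau q y z e (fun x => m * G x + k * F x) p) :
    ∫ x in y..z, (p.eval x - (m * G x + k * F x)) ^ 2 ≤
      8 * K ^ 2 * (z - y) ^ (2 * q) * ((∫ x in y..z, F' x ^ 2) + ∫ x in y..z, G' x ^ 2) := by
  have heI := endpoint_mem_Icc hyz.le he
  obtain ⟨pF, hpF, hbF⟩ := exists_taylor hyz hy hz heI hq hF hFi hF'
  obtain ⟨pG, hpG, hbG⟩ := exists_taylor hyz hy hz heI hq hG hGi hG'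
  set SF := Real.sqrt (∫ x in y..z, F' x ^ 2) with hSF
  set SG := Real.sqrt (∫ x in y..z, G' x ^ 2) with hSG
  have hK : 0 ≤ K := (abs_nonneg _).trans hm
  have hsub := Icc_subset_Icc hy hz
  have hSF2 : SF ^ 2 = ∫ x in y..z, F' x ^ 2 :=
    Real.sq_sqrt (intervalIntegral.integral_nonneg hyz.le fun x _ => sq_nonneg _)
  have hSG2 : SG ^ 2 = ∫ x in y..z, G' x ^ 2 :=
    Real.sq_sqrt (intervalIntegral.integral_nonneg hyz.le fun x _ => sq_nonneg _)
  have key := hp.integral_sq_le hq hyz he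
    (continuousOn_combination (hF.mono hsub) (hG.mono hsub) m k)
    (degree_smul_add_smul_lt hpG hpF m k) (S := K * (SF + SG)) (by
      intro x hx
      simp only [eval_add, eval_smul, smul_eq_mul]
      have h1 := hbF x hx
      have h2 := hbG x hx
      set W := |x - e| ^ (q - 1) * Real.sqrt |x - e| with hW
      calc |m * G x + k * F x - (m * pG.eval x + k * pF.eval x)|
          = |m * (G x - pG.eval x) + k * (F x - pF.eval x)| := by congr 1; ring
        _ ≤ |m| * |G x - pG.eval x| + |k| * |F x - pF.eval x| := by
            rw [← abs_mul, ← abs_mul]; exact abs_add_le _ _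
        _ ≤ K * (W * SG) + K * (W * SF) := by gcongr
        _ = W * (K * (SF + SG)) := by ring)
  refine key.trans ?_
  rw [← hSF2, ← hSG2]
  have h0 : 0 ≤ (z - y) ^ (2 * q) * K ^ 2 := by
    have : 0 < z - y := sub_pos.2 hyz
    positivity
  nlinarith [mul_nonneg h0 (sq_nonneg (SF - SG))]

/-- Optimal order error estimate for the coupled projection. -/
theorem IsPairProjection.error_le {q : ℕ} (hq : 1 ≤ q) {l r : ℝ × ℝ} {K : ℝ}
    (hD : l.1 * r.2 + l.2 * r.1 ≠ 0) (hDK : |(l.1 * r.2 + l.2 * r.1)⁻¹| ≤ K)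
    (hl1 : |l.1| ≤ K) (hl2 : |l.2| ≤ K) (hr1 : |r.1| ≤ K) (hr2 : |r.2| ≤ K)
    {a b y z : ℝ} (hyz : y < z) (hy : a ≤ y) (hz : z ≤ b) {F G F' G' : ℝ → ℝ}
    (hF : ContinuousOn F (Icc a b)) (hG : ContinuousOn G (Icc a b))
    (hFi : ∀ i < q, ∃ g, HasL2WeakDeriv i F g a b) (hF' : HasL2WeakDeriv q F F' a b)
    (hGi : ∀ i < q, ∃ g, HasL2WeakDeriv i G g a b) (hG' : HasL2WeakDeriv q G G' a b)
    {pp pv : ℝ[X]} (h : IsPairProjection q l r y z F G pp pv) :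
    ∫ x in y..z, ((pp.eval x - F x) ^ 2 + (pv.eval x - G x) ^ 2) ≤
      64 * K ^ 6 * (z - y) ^ (2 * q) * ((∫ x in y..z, F' x ^ 2) + ∫ x in y..z, G' x ^ 2) := by
  have hsub := Icc_subset_Icc hy hz
  obtain ⟨-, -, hl, hr⟩ := (isPairProjection_iff hD hyz (hF.mono hsub) (hG.mono hsub)).1 h
  have kl := hl.combination_integral_sq_le hq hyz hy hz (Or.inl rfl) hF hG hFi hF' hGi hG' hl1 hl2
  have kr := hr.combination_integral_sq_le hq hyz hy hz (Or.inr rfl) hF hG hFi hF' hGi hG' hr1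
    ((abs_neg _).trans_le hr2)
  have hK : 0 ≤ K := (abs_nonneg _).trans hl1
  set D := l.1 * r.2 + l.2 * r.1 with hDdef
  set A : ℝ → ℝ := fun x => (l.1 • pv + l.2 • pp).eval x - (l.1 * G x + l.2 * F x) with hA
  set B : ℝ → ℝ := fun x => (r.1 • pv + (-r.2) • pp).eval x - (r.1 * G x + (-r.2) * F x) with hB
  have hcF := hF.mono hsub
  have hcG := hG.mono hsub
  have hcA : ContinuousOn A (Icc y z) := by fun_prop
  have hcB : ContinuousOn B (Icc y z) := by fun_prop
  have hiA : IntervalIntegrable (fun x => A x ^ 2) volume y z :=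
    (hcA.pow 2).intervalIntegrable_of_Icc hyz.le
  have hiB : IntervalIntegrable (fun x => B x ^ 2) volume y z :=
    (hcB.pow 2).intervalIntegrable_of_Icc hyz.le
  have hbound : ∀ {d s t X Y : ℝ}, |d| ≤ K → |s| ≤ K → |t| ≤ K →
      (d * (s * X + t * Y)) ^ 2 ≤ 2 * K ^ 4 * (X ^ 2 + Y ^ 2) := by
    intro d s t X Y hd hs ht
    have hd2 : d ^ 2 ≤ K ^ 2 := by rw [← sq_abs]; gcongr
    have hs2 : s ^ 2 ≤ K ^ 2 := by rw [← sq_abs]; gcongr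
    have ht2 : t ^ 2 ≤ K ^ 2 := by rw [← sq_abs]; gcongr
    calc (d * (s * X + t * Y)) ^ 2 = d ^ 2 * (s * X + t * Y) ^ 2 := by ring
      _ ≤ K ^ 2 * (2 * (s ^ 2 * X ^ 2 + t ^ 2 * Y ^ 2)) := by
          gcongr
          nlinarith [sq_nonneg (s * X - t * Y)]
      _ ≤ K ^ 2 * (2 * (K ^ 2 * X ^ 2 + K ^ 2 * Y ^ 2)) := by gcongr
      _ = _ := by ring
  -- Solving for the errors through `D⁻¹` costs three coefficients bounded by `K`, two of them
  -- squared in each product: `2 K⁴` for each component.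
  have hpt : ∀ x ∈ Icc y z, (pp.eval x - F x) ^ 2 + (pv.eval x - G x) ^ 2
      ≤ 4 * K ^ 4 * (A x ^ 2 + B x ^ 2) := by
    intro x _
    have e1 : pp.eval x - F x = D⁻¹ * (r.1 * A x + (-l.1) * B x) := by
      rw [eq_inv_mul_iff_mul_eq₀ hD, hA, hB, hDdef]
      simp only [eval_add, eval_smul, smul_eq_mul]; ring
    have e2 : pv.eval x - G x = D⁻¹ * (r.2 * A x + l.2 * B x) := by
      rw [eq_inv_mul_iff_mul_eq₀ hD, hA, hB, hDdef]
      simp only [eval_add, eval_smul, smul_eq_mul]; ring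
    rw [e1, e2]
    have b1 := hbound (X := A x) (Y := B x) hDK hr1 ((abs_neg l.1).trans_le hl1)
    have b2 := hbound (X := A x) (Y := B x) hDK hr2 hl2
    linarith
  have hle := intervalIntegral.integral_mono_on hyz.le
    ((((pp.continuous.continuousOn.sub hcF).pow 2).add
      ((pv.continuous.continuousOn.sub hcG).pow 2)).intervalIntegrable_of_Icc hyz.le)
    ((hiA.add hiB).const_mul (4 * K ^ 4)) hpt
  rw [intervalIntegral.integral_const_mul, intervalIntegral.integral_add hiA hiB] at hle
  refine hle.trans ?_
  set S := (∫ x in y..z, F' x ^ 2) + ∫ x in y..z, G' x ^ 2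
  calc 4 * K ^ 4 * ((∫ x in y..z, A x ^ 2) + ∫ x in y..z, B x ^ 2)
      ≤ 4 * K ^ 4 * (8 * K ^ 2 * (z - y) ^ (2 * q) * S + 8 * K ^ 2 * (z - y) ^ (2 * q) * S) := by
        gcongr
    _ = _ := by ring

/-! ### The projection of the method -/

/-- The coefficients `(l₁, l₂)` of the condition `l₁ δ_v + l₂ δ_p = 0` at a left end point. -/
def leftCoef (P : Params) : BoundaryType → ℕ → ℝ × ℝ
  | .physical, 0 => (1, P.ξ)
  | _, _ => (1 + P.β - P.α, P.η + P.α)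

open Classical in
/-- The coefficients `(r₁, r₂)` of the condition `r₁ δ_v - r₂ δ_p = 0` at a right end point. -/
noncomputable def rightCoef (P : Params) (bc : BoundaryType) (N j : ℕ) : ℝ × ℝ :=
  if bc = .physical ∧ j + 1 = N then (1, P.ξ) else (P.β + P.α, 1 + P.η - P.α)

theorem leftCondition_iff (P : Params) (bc : BoundaryType) (j : ℕ) (δ : Trace) :
    LeftCondition P bc j δ ↔ (leftCoef P bc j).1 * δ.v + (leftCoef P bc j).2 * δ.p = 0 := by
  cases bc <;> cases j <;> simp [LeftCondition, leftCoef]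

theorem rightCondition_iff (P : Params) (bc : BoundaryType) (N j : ℕ) (δ : Trace) :
    RightCondition P bc N j δ ↔
      (rightCoef P bc N j).1 * δ.v - (rightCoef P bc N j).2 * δ.p = 0 := by
  unfold RightCondition rightCoef
  split_ifs <;> simp

theorem leftCoef_cases (P : Params) (bc : BoundaryType) (j : ℕ) :
    (bc = .physical ∧ leftCoef P bc j = (1, P.ξ)) ∨
      leftCoef P bc j = (1 + P.β - P.α, P.η + P.α) := by
  cases bc <;> cases j <;> simp [leftCoef]

theorem rightCoef_cases (P : Params) (bc : BoundaryType) (N j : ℕ) :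
    (bc = .physical ∧ rightCoef P bc N j = (1, P.ξ)) ∨
      rightCoef P bc N j = (P.β + P.α, 1 + P.η - P.α) := by
  unfold rightCoef
  split_ifs with h
  · exact Or.inl ⟨h.1, rfl⟩
  · exact Or.inr rfl

/-- At two inter-element ends the determinant is `(1-α)² + α² + β + η + 2βη`, and at two physical
ends it is `2ξ`. The mixed cases are `1 + η - α + ξ(β + α)` and `η + α + ξ(1 + β - α)`, each
positive because `α` lies in `[0,1]` and `ξ > 0`. -/
theorem Admissible.det_pos {P : Params} {bc : BoundaryType} (h : Admissible P bc) (N j : ℕ) :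
    0 < (leftCoef P bc j).1 * (rightCoef P bc N j).2
      + (leftCoef P bc j).2 * (rightCoef P bc N j).1 := by
  have hα := h.α_nonneg
  have hα1 := sub_nonneg.2 h.α_le_one
  have hβ := h.β_nonneg
  have hη := h.η_nonneg
  rcases leftCoef_cases P bc j with ⟨hb, hl⟩ | hl <;>
    rcases rightCoef_cases P bc N j with ⟨hb', hr⟩ | hr <;> rw [hl, hr] <;> simp only
  · linarith [(h.physical hb).2.1]
  · have hξ := (h.physical hb).2.1
    rcases hα.eq_or_lt with h0 | h0
    · rw [← h0]; nlinarith
    · nlinarith [mul_pos hξ h0, mul_nonneg hξ.le hβ]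
  · have hξ := (h.physical hb').2.1
    rcases hα.eq_or_lt with h0 | h0
    · rw [← h0]; nlinarith
    · nlinarith [mul_nonneg hξ.le hα1, mul_nonneg hξ.le hβ]
  · nlinarith [mul_nonneg hβ hη, mul_nonneg hα hβ, mul_nonneg hα hη, mul_nonneg hα1 hβ,
      mul_nonneg hα1 hη, sq_nonneg (2 * P.α - 1)]

/-- A bound for the coefficients of the end point conditions. -/
def IsCoefBound (P : Params) (bc : BoundaryType) (K : ℝ) : Prop :=
  0 < K ∧ ∀ N j : ℕ,
    |((leftCoef P bc j).1 * (rightCoef P bc N j).2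
      + (leftCoef P bc j).2 * (rightCoef P bc N j).1)⁻¹| ≤ K ∧
    |(leftCoef P bc j).1| ≤ K ∧ |(leftCoef P bc j).2| ≤ K ∧
    |(rightCoef P bc N j).1| ≤ K ∧ |(rightCoef P bc N j).2| ≤ K

/-- Each end has only two possible coefficient pairs, so finitely many numbers are to be bounded,
whatever the mesh. This makes the final constant independent of the mesh. -/
theorem exists_isCoefBound (P : Params) (bc : BoundaryType) : ∃ K : ℝ, IsCoefBound P bc K := by
  set S : Set (ℝ × ℝ) := {(1, P.ξ), (1 + P.β - P.α, P.η + P.α)} with hS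
  set S' : Set (ℝ × ℝ) := {(1, P.ξ), (P.β + P.α, 1 + P.η - P.α)} with hS'
  have hfin : (S ×ˢ S').Finite := (Set.toFinite S).prod (Set.toFinite S')
  let f : (ℝ × ℝ) × (ℝ × ℝ) → ℝ := fun m =>
    |(m.1.1 * m.2.2 + m.1.2 * m.2.1)⁻¹| + |m.1.1| + |m.1.2| + |m.2.1| + |m.2.2|
  obtain ⟨K, hK⟩ := (hfin.image f).bddAbove
  refine ⟨max K 1, by positivity, fun N j => ?_⟩
  have hl : leftCoef P bc j ∈ S := by
    rcases leftCoef_cases P bc j with ⟨-, hl⟩ | hl <;> rw [hl, hS] <;> simp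
  have hr : rightCoef P bc N j ∈ S' := by
    rcases rightCoef_cases P bc N j with ⟨-, hl⟩ | hl <;> rw [hl, hS'] <;> simp
  have key : f (leftCoef P bc j, rightCoef P bc N j) ≤ max K 1 :=
    (hK (mem_image_of_mem f (mk_mem_prod hl hr))).trans (le_max_left _ _)
  simp only [f] at key
  set d := ((leftCoef P bc j).1 * (rightCoef P bc N j).2
        + (leftCoef P bc j).2 * (rightCoef P bc N j).1)⁻¹
  have a0 := abs_nonneg d
  have a1 := abs_nonneg (leftCoef P bc j).1
  have a2 := abs_nonneg (leftCoef P bc j).2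
  have a3 := abs_nonneg (rightCoef P bc N j).1
  have a4 := abs_nonneg (rightCoef P bc N j).2
  refine ⟨?_, ?_, ?_, ?_, ?_⟩ <;> linarith

theorem isProjection_iff {P : Params} {bc : BoundaryType} {q N : ℕ} {x : ℕ → ℝ} {j : ℕ}
    {f g : ℝ → ℝ} {pu pv : ℝ[X]} :
    IsProjection P bc q N x j f g pu pv ↔ pu.degree ≤ (q : WithBot ℕ) ∧
      IsPairProjection q (leftCoef P bc j) (rightCoef P bc N j) (x j) (x (j + 1))
        (derivWithin f (Icc (x 0) (x N))) g (derivative pu) pv ∧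
      ∫ y in (x j)..(x (j + 1)), (pu.eval y - f y) = 0 := by
  constructor
  · intro h
    exact ⟨h.degree_u, ⟨degree_derivative_lt_of_degree_le (degree_lt_succ_iff.2 h.degree_u),
      h.degree_v, h.orth_u, h.orth_v, (leftCondition_iff _ _ _ _).1 h.left_end,
      (rightCondition_iff _ _ _ _ _).1 h.right_end⟩, h.mean_u⟩
  · rintro ⟨hd, h, hm⟩
    exact ⟨hd, h.degree_v, h.orth_p, h.orth_v, hm, (leftCondition_iff _ _ _ _).2 h.left_end,
      (rightCondition_iff _ _ _ _ _).2 h.right_end⟩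

theorem mesh_mono {N : ℕ} {x : ℕ → ℝ} (hx : ∀ j < N, x j < x (j + 1)) {i k : ℕ} (hik : i ≤ k)
    (hk : k ≤ N) : x i ≤ x k := by
  induction k, hik using Nat.le_induction with
  | base => exact le_rfl
  | succ k _ ih => exact (ih (by omega)).trans (hx k (by omega)).le

theorem mesh_lt {N : ℕ} {x : ℕ → ℝ} (hN : 0 < N) (hx : ∀ j < N, x j < x (j + 1)) : x 0 < x N :=
  (hx 0 hN).trans_le (mesh_mono hx (by omega) le_rfl)

theorem continuousOn_derivWithin_Icc {f : ℝ → ℝ} {a b : ℝ} (hab : a < b)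
    (hf : ContDiffOn ℝ 1 f (Icc a b)) : ContinuousOn (derivWithin f (Icc a b)) (Icc a b) :=
  hf.continuousOn_derivWithin (uniqueDiffOn_Icc hab) le_rfl

/-- The coupled projection determines `∂u/∂x` and `v`; the remaining constant of integration in `u`
is fixed by the condition on the mean. -/
theorem existsUnique_isProjection {P : Params} {bc : BoundaryType} (h : Admissible P bc) {q : ℕ}
    (hq : 1 ≤ q) {N : ℕ} {x : ℕ → ℝ} (hN : 0 < N) (hx : ∀ j < N, x j < x (j + 1)) {f g : ℝ → ℝ}
    (hf : ContDiffOn ℝ 1 f (Icc (x 0) (x N))) (hg : ContinuousOn g (Icc (x 0) (x N))) {j : ℕ}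
    (hj : j < N) : ∃! p : ℝ[X] × ℝ[X], IsProjection P bc q N x j f g p.1 p.2 := by
  have hyz := hx j hj
  have hsub : Icc (x j) (x (j + 1)) ⊆ Icc (x 0) (x N) :=
    Icc_subset_Icc (mesh_mono hx (by omega) (by omega)) (mesh_mono hx (by omega) le_rfl)
  have hF := (continuousOn_derivWithin_Icc (mesh_lt hN hx) hf).mono hsub
  have hG := hg.mono hsub
  have hD := (h.det_pos N j).ne'
  have hfi : IntervalIntegrable f volume (x j) (x (j + 1)) :=
    (hf.continuousOn.mono hsub).intervalIntegrable_of_Icc hyz.le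
  have hpi : ∀ p : ℝ[X], IntervalIntegrable (fun y => p.eval y) volume (x j) (x (j + 1)) :=
    fun p => p.continuous.intervalIntegrable _ _
  obtain ⟨pp, pv, hpair⟩ := exists_isPairProjection hq hD hyz hF hG
  obtain ⟨Q, hQ, -⟩ := exists_antiderivative pp 0 0
  have hlen : x (j + 1) - x j ≠ 0 := (sub_pos.2 hyz).ne'
  -- The mean error of an arbitrary antiderivative, to be subtracted.
  set m := (∫ y in (x j)..(x (j + 1)), (Q.eval y - f y)) / (x (j + 1) - x j) with hm
  have hder : derivative (Q - C m) = pp := by simp [hQ]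
  refine ⟨(Q - C m, pv), ?_, ?_⟩
  · refine isProjection_iff.2 ⟨?_, by rwa [hder], ?_⟩
    · exact degree_lt_succ_iff.1 (degree_lt_succ_of_derivative (by
        rw [hder]; exact hpair.degree_p))
    · have e : ∀ y, (Q - C m).eval y - f y = (Q.eval y - f y) - m := fun y => by
        rw [eval_sub, eval_C]; ring
      simp_rw [e]
      rw [intervalIntegral.integral_sub ((hpi Q).sub hfi) intervalIntegrable_const,
        intervalIntegral.integral_const, smul_eq_mul, hm, mul_div_cancel₀ _ hlen, sub_self]
  · rintro ⟨pu', pv'⟩ hp'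
    obtain ⟨-, hpair', hmean⟩ := isProjection_iff.1 hp'
    obtain ⟨e1, e2⟩ := hpair'.unique hq hD hyz hF hG hpair
    simp only at e1 e2 hmean
    refine Prod.ext ?_ e2
    have hd0 : derivative (pu' - Q) = 0 := by rw [derivative_sub, e1, hQ, sub_self]
    have hc := eq_C_of_derivative_eq_zero hd0
    set k := (pu' - Q).coeff 0 with hk
    have hpu : pu' = Q + C k := by rw [← hc]; ring
    have : ∫ y in (x j)..(x (j + 1)), (pu'.eval y - f y)
        = (∫ y in (x j)..(x (j + 1)), (Q.eval y - f y)) + k * (x (j + 1) - x j) := by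
      have e : ∀ y, pu'.eval y - f y = (Q.eval y - f y) + k := fun y => by
        rw [hpu, eval_add, eval_C]; ring
      simp_rw [e]
      rw [intervalIntegral.integral_add ((hpi Q).sub hfi) intervalIntegrable_const,
        intervalIntegral.integral_const, smul_eq_mul, mul_comm k]
    rw [hmean] at this
    have hkm : k = -m := by
      rw [hm, eq_comm, neg_eq_iff_eq_neg, div_eq_iff hlen]; linarith
    simp only
    rw [hpu, hkm, C_neg]; ring

/-! ### Regularity of classical solutions -/

section Partial

variable {E : Type*} [NormedAddCommGroup E] [NormedSpace ℝ E]

theorem hasDerivWithinAt_fst_of_differentiableOn {F : ℝ × ℝ → E} {A B : Set ℝ} {t x : ℝ}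
    (hF : DifferentiableOn ℝ F (A ×ˢ B)) (ht : t ∈ A) (hx : x ∈ B) :
    HasDerivWithinAt (fun s => F (s, x)) (fderivWithin ℝ F (A ×ˢ B) (t, x) (1, 0)) A t := by
  have h1 := (hF (t, x) (mk_mem_prod ht hx)).hasFDerivWithinAt
  have h2 : HasDerivWithinAt (fun s : ℝ => (s, x)) ((1 : ℝ), (0 : ℝ)) A t :=
    (hasDerivWithinAt_id t A).prodMk (hasDerivWithinAt_const t A x)
  exact h1.comp_hasDerivWithinAt t h2 fun s hs => mk_mem_prod hs hx

theorem hasDerivWithinAt_snd_of_differentiableOn {F : ℝ × ℝ → E} {A B : Set ℝ} {t x : ℝ}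
    (hF : DifferentiableOn ℝ F (A ×ˢ B)) (ht : t ∈ A) (hx : x ∈ B) :
    HasDerivWithinAt (fun y => F (t, y)) (fderivWithin ℝ F (A ×ˢ B) (t, x) (0, 1)) B x := by
  have h1 := (hF (t, x) (mk_mem_prod ht hx)).hasFDerivWithinAt
  have h2 : HasDerivWithinAt (fun y : ℝ => (t, y)) ((0 : ℝ), (1 : ℝ)) B x :=
    (hasDerivWithinAt_const x B t).prodMk (hasDerivWithinAt_id x B)
  exact h1.comp_hasDerivWithinAt x h2 fun s hs => mk_mem_prod ht hs

end Partial

/-- The first order system satisfied by `p = ∂u/∂x` and `v`, with continuous derivatives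
`px, vx` in space. -/
structure IsRegularSystem (P : Params) (a b T : ℝ) (p v px vx : ℝ → ℝ → ℝ) : Prop where
  continuousOn_px : ContinuousOn (Function.uncurry px) (Icc 0 T ×ˢ Icc a b)
  continuousOn_vx : ContinuousOn (Function.uncurry vx) (Icc 0 T ×ˢ Icc a b)
  deriv_p : ∀ t ∈ Icc 0 T, ∀ x ∈ Icc a b, HasDerivWithinAt (p t) (px t x) (Icc a b) x
  deriv_v : ∀ t ∈ Icc 0 T, ∀ x ∈ Icc a b, HasDerivWithinAt (v t) (vx t x) (Icc a b) x
  deriv_time_p : ∀ t ∈ Icc 0 T, ∀ x ∈ Icc a b,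
    HasDerivWithinAt (fun s => p s x) (vx t x - P.w * px t x) (Icc 0 T) t
  deriv_time_v : ∀ t ∈ Icc 0 T, ∀ x ∈ Icc a b,
    HasDerivWithinAt (fun s => v s x) (P.c ^ 2 * px t x - P.w * vx t x) (Icc 0 T) t

/-- Since `u` is of class `C²`, mixed derivatives commute: `p_t = (u_t)_x`, and the first equation
gives `u_t = v - w p`, which can be differentiated in `x`. Thus `p_t` is expressed by space
derivatives without any mixed derivative of `v`. -/
theorem IsClassicalSolution.exists_regularSystem {P : Params} {bc : BoundaryType} {a b T : ℝ}
    (hab : a < b) (hT : 0 < T) {u v : ℝ → ℝ → ℝ} (h : IsClassicalSolution P bc a b T u v) :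
    ∃ px vx : ℝ → ℝ → ℝ,
      IsRegularSystem P a b T (fun t => derivWithin (u t) (Icc a b)) v px vx ∧
      ∀ t ∈ Icc 0 T, ContDiffOn ℝ 1 (u t) (Icc a b) := by
  set A := Icc (0 : ℝ) T with hA
  set B := Icc a b with hB
  have hUA : UniqueDiffOn ℝ A := uniqueDiffOn_Icc hT
  have hUB : UniqueDiffOn ℝ B := uniqueDiffOn_Icc hab
  have hU : UniqueDiffOn ℝ (A ×ˢ B) := hUA.prod hUB
  set U := Function.uncurry u with hUdef
  set V := Function.uncurry v with hVdef
  have hUd : DifferentiableOn ℝ U (A ×ˢ B) := h.contDiff_u.differentiableOn (by norm_num)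
  have hVd : DifferentiableOn ℝ V (A ×ˢ B) := h.contDiff_v.differentiableOn (by norm_num)
  set DU := fderivWithin ℝ U (A ×ˢ B) with hDU
  have hDU1 : ContDiffOn ℝ 1 DU (A ×ˢ B) := h.contDiff_u.fderivWithin hU (by norm_num)
  have hDUd : DifferentiableOn ℝ DU (A ×ˢ B) := hDU1.differentiableOn (by norm_num)
  set DDU := fderivWithin ℝ DU (A ×ˢ B) with hDDU
  have hDDUc : ContinuousOn DDU (A ×ˢ B) := hDU1.continuousOn_fderivWithin hU le_rfl
  have hDVc : ContinuousOn (fderivWithin ℝ V (A ×ˢ B)) (A ×ˢ B) :=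
    h.contDiff_v.continuousOn_fderivWithin hU le_rfl
  have hsymm : ∀ t ∈ A, ∀ x ∈ B, DDU (t, x) (1, 0) (0, 1) = DDU (t, x) (0, 1) (1, 0) := by
    intro t ht x hx
    -- Symmetry of the second derivative within the closed rectangle also holds at its boundary
    -- points, because they are limits of interior points.
    have hcl : (t, x) ∈ closure (interior (A ×ˢ B)) := by
      rw [interior_prod_eq, hA, hB, interior_Icc, interior_Icc, closure_prod_eq,
        closure_Ioo hT.ne, closure_Ioo hab.ne]
      exact mk_mem_prod ht hx
    have := (h.contDiff_u (t, x) (mk_mem_prod ht hx)).isSymmSndFDerivWithinAt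
      (by simp) hU hcl (mk_mem_prod ht hx)
    exact this _ _
  have hux : ∀ t ∈ A, ∀ x ∈ B, HasDerivWithinAt (u t) (DU (t, x) (0, 1)) B x :=
    fun t ht x hx => hasDerivWithinAt_snd_of_differentiableOn hUd ht hx
  have hut : ∀ t ∈ A, ∀ x ∈ B, HasDerivWithinAt (fun s => u s x) (DU (t, x) (1, 0)) A t :=
    fun t ht x hx => hasDerivWithinAt_fst_of_differentiableOn hUd ht hx
  have hp : ∀ t ∈ A, ∀ x ∈ B, derivWithin (u t) B x = DU (t, x) (0, 1) :=
    fun t ht x hx => (hux t ht x hx).derivWithin (hUB x hx)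
  have hvx : ∀ t ∈ A, ∀ x ∈ B, HasDerivWithinAt (v t)
      (fderivWithin ℝ V (A ×ˢ B) (t, x) (0, 1)) B x :=
    fun t ht x hx => hasDerivWithinAt_snd_of_differentiableOn hVd ht hx
  have hvt : ∀ t ∈ A, ∀ x ∈ B, HasDerivWithinAt (fun s => v s x)
      (fderivWithin ℝ V (A ×ˢ B) (t, x) (1, 0)) A t :=
    fun t ht x hx => hasDerivWithinAt_fst_of_differentiableOn hVd ht hx
  have hDx : ∀ t ∈ A, ∀ x ∈ B, ∀ e : ℝ × ℝ,
      HasDerivWithinAt (fun y => DU (t, y) e) (DDU (t, x) (0, 1) e) B x := by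
    intro t ht x hx e
    exact (hasDerivWithinAt_snd_of_differentiableOn hDUd ht hx).clm_apply
      (hasDerivWithinAt_const x B e) |>.congr_deriv (by simp; rfl)
  have hDt : ∀ t ∈ A, ∀ x ∈ B, ∀ e : ℝ × ℝ,
      HasDerivWithinAt (fun s => DU (s, x) e) (DDU (t, x) (1, 0) e) A t := by
    intro t ht x hx e
    exact (hasDerivWithinAt_fst_of_differentiableOn hDUd ht hx).clm_apply
      (hasDerivWithinAt_const t A e) |>.congr_deriv (by simp; rfl)
  have hpx : ∀ t ∈ A, ∀ x ∈ B, HasDerivWithinAt (derivWithin (u t) B)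
      (DDU (t, x) (0, 1) (0, 1)) B x := fun t ht x hx =>
    (hDx t ht x hx (0, 1)).congr (fun y hy => hp t ht y hy) (hp t ht x hx)
  refine ⟨fun t x => DDU (t, x) (0, 1) (0, 1), fun t x => fderivWithin ℝ V (A ×ˢ B) (t, x) (0, 1),
    ⟨?_, ?_, hpx, hvx, ?_, ?_⟩, ?_⟩
  · exact (hDDUc.clm_apply continuousOn_const).clm_apply continuousOn_const
  · exact hDVc.clm_apply continuousOn_const
  · intro t ht x hx
    have h1 : HasDerivWithinAt (fun y => v t y - P.w * derivWithin (u t) B y)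
        (fderivWithin ℝ V (A ×ˢ B) (t, x) (0, 1) - P.w * DDU (t, x) (0, 1) (0, 1)) B x :=
      (hvx t ht x hx).sub ((hpx t ht x hx).const_mul P.w)
    have heq : ∀ y ∈ B, DU (t, y) (1, 0) = v t y - P.w * derivWithin (u t) B y := by
      intro y hy
      have := h.eq_u t ht y hy
      rw [(hut t ht y hy).derivWithin (hUA t ht)] at this
      linarith
    have h3 : DDU (t, x) (0, 1) (1, 0) = _ :=
      (hUB x hx).eq_deriv _ (hDx t ht x hx (1, 0)) (h1.congr heq (heq x hx))
    rw [← h3, ← hsymm t ht x hx]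
    exact (hDt t ht x hx (0, 1)).congr (fun s hs => hp s hs x hx) (hp t ht x hx)
  · intro t ht x hx
    have h2 : iteratedDerivWithin 2 (u t) B x = DDU (t, x) (0, 1) (0, 1) := by
      rw [iteratedDerivWithin_succ, iteratedDerivWithin_one]
      exact (hpx t ht x hx).derivWithin (hUB x hx)
    have := h.eq_v t ht x hx
    rw [(hvt t ht x hx).derivWithin (hUA t ht), (hvx t ht x hx).derivWithin (hUB x hx), h2] at this
    exact (hvt t ht x hx).congr_deriv (by linarith)
  · intro t ht
    have hc : ContDiffOn ℝ 2 (fun y => U (t, y)) B :=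
      h.contDiff_u.comp (contDiffOn_const.prodMk contDiffOn_id) fun y hy => mk_mem_prod ht hy
    exact hc.of_le (by norm_num)

/-! ### Differentiation in time -/

/-- Dominated convergence for difference quotients, which the mean value inequality bounds by the
uniform bound `K` of the time derivative. -/
theorem hasDerivWithinAt_integral_pow_mul {T y z K : ℝ} (hyz : y ≤ z) {R R' : ℝ → ℝ → ℝ}
    (hR : ∀ s ∈ Icc 0 T, ContinuousOn (R s) (Icc y z))
    (hd : ∀ s ∈ Icc 0 T, ∀ x ∈ Icc y z, HasDerivWithinAt (fun s => R s x) (R' s x) (Icc 0 T) s)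
    (hK : ∀ s ∈ Icc 0 T, ∀ x ∈ Icc y z, |R' s x| ≤ K) {t : ℝ} (ht : t ∈ Icc 0 T) (k : ℕ) :
    HasDerivWithinAt (fun s => ∫ x in y..z, x ^ k * R s x) (∫ x in y..z, x ^ k * R' t x)
      (Icc 0 T) t := by
  have hint : ∀ s ∈ Icc 0 T, IntervalIntegrable (fun x => x ^ k * R s x) volume y z := by
    intro s hs
    simpa using intervalIntegrable_eval_mul hyz (hR s hs) (X ^ k)
  rw [hasDerivWithinAt_iff_tendsto_slope]
  have hmem : ∀ᶠ s in nhdsWithin t (Icc 0 T \ {t}), s ∈ Icc 0 T \ {t} :=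
    eventually_mem_nhdsWithin
  have hlim : Filter.Tendsto
      (fun s => ∫ x in y..z, x ^ k * slope (fun s => R s x) t s)
      (nhdsWithin t (Icc 0 T \ {t})) (nhds (∫ x in y..z, x ^ k * R' t x)) := by
    refine intervalIntegral.tendsto_integral_filter_of_dominated_convergence
      (fun x => |x| ^ k * K) ?_ ?_ ?_ ?_
    · filter_upwards [hmem] with s hs
      have : ContinuousOn (fun x => x ^ k * slope (fun s => R s x) t s) (Icc y z) := by
        simp only [slope_def_field]
        have h1 := hR s hs.1
        have h2 := hR t ht
        fun_prop
      rw [uIoc_of_le hyz]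
      exact (this.mono Ioc_subset_Icc_self).aestronglyMeasurable measurableSet_Ioc
    · filter_upwards [hmem] with s hs
      refine .of_forall fun x hx => ?_
      rw [uIoc_of_le hyz] at hx
      have hx' := Ioc_subset_Icc_self hx
      have hmv := (convex_Icc (0 : ℝ) T).norm_image_sub_le_of_norm_hasDerivWithin_le
        (fun s hs => hd s hs x hx') (fun s hs => hK s hs x hx') ht hs.1
      have hst : 0 < |s - t| := abs_pos.2 (sub_ne_zero.2 hs.2)
      rw [norm_mul, norm_pow, Real.norm_eq_abs, Real.norm_eq_abs]
      gcongr
      rw [slope_def_field, abs_div, div_le_iff₀ hst]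
      exact hmv
    · exact Continuous.intervalIntegrable (by fun_prop) _ _
    · refine .of_forall fun x hx => ?_
      rw [uIoc_of_le hyz] at hx
      exact ((hasDerivWithinAt_iff_tendsto_slope.1
        (hd t ht x (Ioc_subset_Icc_self hx))).const_mul _)
  refine hlim.congr' ?_
  filter_upwards [hmem] with s hs
  rw [slope_def_field, ← intervalIntegral.integral_sub (hint s hs.1) (hint t ht),
    ← intervalIntegral.integral_div]
  congr 1; ext x
  rw [slope_def_field]; ring

theorem hasDerivWithinAt_radauData {q : ℕ} {T y z e K : ℝ} (hyz : y ≤ z) (he : e ∈ Icc y z)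
    {R R' : ℝ → ℝ → ℝ} (hR : ∀ s ∈ Icc 0 T, ContinuousOn (R s) (Icc y z))
    (hd : ∀ s ∈ Icc 0 T, ∀ x ∈ Icc y z, HasDerivWithinAt (fun s => R s x) (R' s x) (Icc 0 T) s)
    (hK : ∀ s ∈ Icc 0 T, ∀ x ∈ Icc y z, |R' s x| ≤ K) {t : ℝ} (ht : t ∈ Icc 0 T) :
    HasDerivWithinAt (fun s => radauData q y z e (R s)) (radauData q y z e (R' t))
      (Icc 0 T) t := by
  rw [hasDerivWithinAt_pi]
  intro i
  simp only [radauData]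
  split_ifs
  · exact hasDerivWithinAt_integral_pow_mul hyz hR hd hK ht i
  · exact hd t ht e he

theorem eval_eq_sum_range_of_degree_lt {q : ℕ} {p : ℝ[X]} (hp : p.degree < (q : WithBot ℕ))
    (y : ℝ) : p.eval y = ∑ k ∈ Finset.range q, p.coeff k * y ^ k := by
  rcases eq_or_ne p 0 with rfl | h0
  · simp
  · exact eval_eq_sum_range' ((natDegree_lt_iff_degree_lt h0).2 hp) y

theorem integral_eval_mul_eval {q : ℕ} {p r : ℝ[X]} (hp : p.degree < (q : WithBot ℕ))
    (hr : r.degree < (q : WithBot ℕ)) (y z : ℝ) :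
    ∫ s in y..z, p.eval s * r.eval s = ∑ k ∈ Finset.range q, ∑ l ∈ Finset.range q,
      p.coeff k * r.coeff l * ∫ s in y..z, s ^ k * s ^ l := by
  have e : ∀ s, p.eval s * r.eval s = ∑ k ∈ Finset.range q, ∑ l ∈ Finset.range q,
      p.coeff k * r.coeff l * (s ^ k * s ^ l) := by
    intro s
    rw [eval_eq_sum_range_of_degree_lt hp, eval_eq_sum_range_of_degree_lt hr,
      Finset.sum_mul_sum]
    exact Finset.sum_congr rfl fun k _ => Finset.sum_congr rfl fun l _ => by ring
  simp_rw [e]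
  rw [intervalIntegral.integral_finsetSum
    (fun k _ => Continuous.intervalIntegrable (by fun_prop) _ _)]
  refine Finset.sum_congr rfl fun k _ => ?_
  rw [intervalIntegral.integral_finsetSum
    (fun l _ => Continuous.intervalIntegrable (by fun_prop) _ _)]
  exact Finset.sum_congr rfl fun l _ => intervalIntegral.integral_const_mul _ _

/-- The squared `L²` norm of a polynomial with differentiable coefficients. -/
theorem hasDerivWithinAt_integral_eval_sq {q : ℕ} {I : Set ℝ} {t : ℝ} (ht : t ∈ I)
    {p : ℝ → ℝ[X]} {p' : ℝ[X]} (hp : ∀ s ∈ I, (p s).degree < (q : WithBot ℕ))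
    (hp' : p'.degree < (q : WithBot ℕ))
    (hd : ∀ k, HasDerivWithinAt (fun s => (p s).coeff k) (p'.coeff k) I t) (y z : ℝ) :
    HasDerivWithinAt (fun s => ∫ w in y..z, (p s).eval w ^ 2)
      (2 * ∫ w in y..z, (p t).eval w * p'.eval w) I t := by
  have h1 : HasDerivWithinAt (fun s => ∑ k ∈ Finset.range q, ∑ l ∈ Finset.range q,
      (p s).coeff k * (p s).coeff l * ∫ w in y..z, w ^ k * w ^ l)
      (∑ k ∈ Finset.range q, ∑ l ∈ Finset.range q,
        (p'.coeff k * (p t).coeff l + (p t).coeff k * p'.coeff l) *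
          ∫ w in y..z, w ^ k * w ^ l) I t :=
    HasDerivWithinAt.fun_sum fun k _ => HasDerivWithinAt.fun_sum fun l _ =>
      ((hd k).mul (hd l)).mul_const _
  have h2 : (2 * ∫ w in y..z, (p t).eval w * p'.eval w) = ∑ k ∈ Finset.range q,
      ∑ l ∈ Finset.range q, (p'.coeff k * (p t).coeff l + (p t).coeff k * p'.coeff l) *
          ∫ w in y..z, w ^ k * w ^ l := by
    simp_rw [add_mul, Finset.sum_add_distrib]
    rw [← integral_eval_mul_eval hp' (hp t ht), ← integral_eval_mul_eval (hp t ht) hp', two_mul]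
    congr 2; ext w; ring
  rw [h2]
  have h3 : ∀ s ∈ I, ∫ w in y..z, (p s).eval w ^ 2 = ∑ k ∈ Finset.range q, ∑ l ∈ Finset.range q,
      (p s).coeff k * (p s).coeff l * ∫ w in y..z, w ^ k * w ^ l := by
    intro s hs
    rw [← integral_eval_mul_eval (hp s hs) (hp s hs)]
    simp_rw [sq]
  exact h1.congr h3 (h3 t ht)

/-- A coefficient that vanishes for all times has derivative zero. This is needed because the time
derivatives in the definition of a semidiscrete solution carry no degree bound of their own. -/
theorem degree_lt_of_hasDerivWithinAt_coeff {q : ℕ} {I : Set ℝ} {t : ℝ}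
    (hI : UniqueDiffWithinAt ℝ I t) (ht : t ∈ I) {p : ℝ → ℝ[X]} {p' : ℝ[X]}
    (hp : ∀ s ∈ I, (p s).degree < (q : WithBot ℕ))
    (hd : ∀ k, HasDerivWithinAt (fun s => (p s).coeff k) (p'.coeff k) I t) :
    p'.degree < (q : WithBot ℕ) := by
  rw [degree_lt_iff_coeff_zero]
  intro m hm
  have hz : ∀ s ∈ I, (p s).coeff m = 0 := fun s hs =>
    (degree_lt_iff_coeff_zero _ _).1 (hp s hs) m hm
  exact hI.eq_deriv _ (hd m) ((hasDerivWithinAt_const t I (0 : ℝ)).congr hz (hz t ht))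

/-! ### The variational form after integration by parts -/

/-- The integrand of the variational form after integration by parts. -/
noncomputable def weakIntegrand (P : Params) (ψ χ : ℝ[X]) (p v pt vt : ℝ → ℝ) (x : ℝ) : ℝ :=
  P.c ^ 2 * (ψ.eval x * pt x) + χ.eval x * vt x
    - P.c ^ 2 * P.w * ((derivative ψ).eval x * p x) + P.c ^ 2 * ((derivative ψ).eval x * v x)
    - P.w * ((derivative χ).eval x * v x) + P.c ^ 2 * ((derivative χ).eval x * p x)

/-- The end point contribution of the variational form after integration by parts. -/
noncomputable def weakFace (P : Params) (ψ χ : ℝ[X]) (S : Trace) (x : ℝ) : ℝ :=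
  ψ.eval x * (P.c ^ 2 * P.w * S.p - P.c ^ 2 * S.v) + χ.eval x * (P.w * S.v - P.c ^ 2 * S.p)

/-- The variational form on `(y, z)` after integration by parts, with fluxes `SL, SR`. -/
noncomputable def weakElement (P : Params) (ψ χ : ℝ[X]) (p v pt vt : ℝ → ℝ) (SL SR : Trace)
    (y z : ℝ) : ℝ :=
  (∫ x in y..z, weakIntegrand P ψ χ p v pt vt x) + (weakFace P ψ χ SR z - weakFace P ψ χ SL y)

theorem integral_mul_deriv_Icc {y z : ℝ} (hyz : y ≤ z) (ψ : ℝ[X]) {f f' : ℝ → ℝ}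
    (hf : ∀ x ∈ Icc y z, HasDerivWithinAt f (f' x) (Icc y z) x) (hf' : ContinuousOn f' (Icc y z)) :
    ∫ x in y..z, ψ.eval x * f' x
      = ψ.eval z * f z - ψ.eval y * f y - ∫ x in y..z, (derivative ψ).eval x * f x := by
  rw [← uIcc_of_le hyz] at hf
  exact intervalIntegral.integral_mul_deriv_eq_deriv_mul_of_hasDerivWithinAt
    (fun x _ => (ψ.hasDerivAt x).hasDerivWithinAt) hf
    ((derivative ψ).continuous.intervalIntegrable _ _) (hf'.intervalIntegrable_of_Icc hyz)

theorem integral_weakIntegrand (P : Params) (ψ χ : ℝ[X]) {p v pt vt : ℝ → ℝ} {y z : ℝ}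
    (hyz : y ≤ z) (hp : ContinuousOn p (Icc y z)) (hv : ContinuousOn v (Icc y z))
    (hpt : ContinuousOn pt (Icc y z)) (hvt : ContinuousOn vt (Icc y z)) :
    ∫ x in y..z, weakIntegrand P ψ χ p v pt vt x =
      P.c ^ 2 * (∫ x in y..z, ψ.eval x * pt x) + (∫ x in y..z, χ.eval x * vt x)
      - P.c ^ 2 * P.w * (∫ x in y..z, (derivative ψ).eval x * p x)
      + P.c ^ 2 * (∫ x in y..z, (derivative ψ).eval x * v x)
      - P.w * (∫ x in y..z, (derivative χ).eval x * v x)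
      + P.c ^ 2 * (∫ x in y..z, (derivative χ).eval x * p x) := by
  have i1 := (intervalIntegrable_eval_mul hyz hpt ψ).const_mul (P.c ^ 2)
  have i2 := intervalIntegrable_eval_mul hyz hvt χ
  have i3 := (intervalIntegrable_eval_mul hyz hp (derivative ψ)).const_mul (P.c ^ 2 * P.w)
  have i4 := (intervalIntegrable_eval_mul hyz hv (derivative ψ)).const_mul (P.c ^ 2)
  have i5 := (intervalIntegrable_eval_mul hyz hv (derivative χ)).const_mul P.w
  have i6 := (intervalIntegrable_eval_mul hyz hp (derivative χ)).const_mul (P.c ^ 2)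
  unfold weakIntegrand
  rw [intervalIntegral.integral_add ((((i1.add i2).sub i3).add i4).sub i5) i6,
    intervalIntegral.integral_sub (((i1.add i2).sub i3).add i4) i5,
    intervalIntegral.integral_add ((i1.add i2).sub i3) i4,
    intervalIntegral.integral_sub (i1.add i2) i3, intervalIntegral.integral_add i1 i2]
  simp only [intervalIntegral.integral_const_mul]

/-- The method, tested with `φ_c = 0`, in the form obtained by integration by parts. -/
theorem volumeTerm_sub_faceTerm (P : Params) (φu φv u v ut vt : ℝ[X]) {y z : ℝ} (hyz : y ≤ z)
    (SL SR : Trace) :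
    volumeTerm P φu φv 0 u v ut vt y z
      - (faceTerm P φu φv (polyTrace u v y) SL y (-1) + faceTerm P φu φv (polyTrace u v z) SR z 1)
      = weakElement P (derivative φu) φv (fun x => (derivative u).eval x) (fun x => v.eval x)
          (fun x => (derivative ut).eval x) (fun x => vt.eval x) SL SR y z := by
  set ψ := derivative φu with hψ
  set p := derivative u with hp
  have hib : ∀ a f : ℝ[X], ∫ x in y..z, a.eval x * (derivative f).eval x
      = a.eval z * f.eval z - a.eval y * f.eval y - ∫ x in y..z, (derivative a).eval x * f.eval x :=
    fun a f => integral_mul_deriv_Icc hyz a (fun x _ => (f.hasDerivAt x).hasDerivWithinAt)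
      (derivative f).continuous.continuousOn
  have hvol : volumeTerm P φu φv 0 u v ut vt y z =
      P.c ^ 2 * (∫ x in y..z, ψ.eval x * (derivative ut).eval x)
      + P.c ^ 2 * P.w * (∫ x in y..z, ψ.eval x * (derivative p).eval x)
      - P.c ^ 2 * (∫ x in y..z, ψ.eval x * (derivative v).eval x)
      + (∫ x in y..z, φv.eval x * vt.eval x)
      + P.w * (∫ x in y..z, φv.eval x * (derivative v).eval x)
      + P.c ^ 2 * ∫ x in y..z, (derivative φv).eval x * p.eval x := by
    unfold volumeTerm
    have hi : ∀ (k : ℝ) (a b : ℝ[X]),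
        IntervalIntegrable (fun x => k * (a.eval x * b.eval x)) volume y z :=
      fun k a b => Continuous.intervalIntegrable (by fun_prop) _ _
    have hi' : ∀ (a b : ℝ[X]), IntervalIntegrable (fun x => a.eval x * b.eval x) volume y z :=
      fun a b => Continuous.intervalIntegrable (by fun_prop) _ _
    simp only [← intervalIntegral.integral_const_mul]
    rw [← intervalIntegral.integral_add (hi _ _ _) (hi _ _ _),
      ← intervalIntegral.integral_sub ((hi _ _ _).add (hi _ _ _)) (hi _ _ _),
      ← intervalIntegral.integral_add (((hi _ _ _).add (hi _ _ _)).sub (hi _ _ _)) (hi' _ _),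
      ← intervalIntegral.integral_add ((((hi _ _ _).add (hi _ _ _)).sub (hi _ _ _)).add (hi' _ _))
        (hi _ _ _),
      ← intervalIntegral.integral_add (((((hi _ _ _).add (hi _ _ _)).sub (hi _ _ _)).add
        (hi' _ _)).add (hi _ _ _)) (hi _ _ _)]
    congr 1; ext x
    simp only [derivative_sub, derivative_add, derivative_mul, derivative_C, eval_sub, eval_add,
      eval_mul, eval_C, zero_mul, zero_add, ← hψ, ← hp]
    ring
  rw [hvol, weakElement, integral_weakIntegrand P ψ φv hyz p.continuous.continuousOn
    v.continuous.continuousOn (derivative ut).continuous.continuousOn vt.continuous.continuousOn,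
    hib ψ p, hib ψ v, hib φv v]
  simp only [faceTerm, weakFace, polyTrace, ← hψ, ← hp]
  ring

/-- Integration by parts backwards: with the fluxes equal to the traces of the exact solution, all
boundary terms cancel and the differential equations remain. -/
theorem weakElement_exact (P : Params) (ψ χ : ℝ[X]) {p v px vx : ℝ → ℝ} {y z : ℝ} (hyz : y ≤ z)
    (hp : ∀ x ∈ Icc y z, HasDerivWithinAt p (px x) (Icc y z) x)
    (hv : ∀ x ∈ Icc y z, HasDerivWithinAt v (vx x) (Icc y z) x)
    (hpx : ContinuousOn px (Icc y z)) (hvx : ContinuousOn vx (Icc y z)) :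
    weakElement P ψ χ p v (fun x => vx x - P.w * px x) (fun x => P.c ^ 2 * px x - P.w * vx x)
      ⟨v y, p y⟩ ⟨v z, p z⟩ y z = 0 := by
  have e1 := integral_eval_mul_add hyz hvx hpx ψ 1 (-P.w)
  have e2 := integral_eval_mul_add hyz hvx hpx χ (-P.w) (P.c ^ 2)
  have e1' : ∀ x, 1 * vx x + -P.w * px x = vx x - P.w * px x := fun x => by ring
  have e2' : ∀ x, -P.w * vx x + P.c ^ 2 * px x = P.c ^ 2 * px x - P.w * vx x := fun x => by ring
  simp_rw [e1'] at e1
  simp_rw [e2'] at e2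
  rw [weakElement, integral_weakIntegrand P ψ χ hyz (fun x hx => (hp x hx).continuousWithinAt)
    (fun x hx => (hv x hx).continuousWithinAt) (by fun_prop) (by fun_prop), e1, e2,
    integral_mul_deriv_Icc hyz ψ hp hpx, integral_mul_deriv_Icc hyz ψ hv hvx,
    integral_mul_deriv_Icc hyz χ hp hpx, integral_mul_deriv_Icc hyz χ hv hvx]
  simp only [weakFace]
  ring

theorem weakElement_sub (P : Params) (ψ χ : ℝ[X]) {p v pt vt p' v' pt' vt' : ℝ → ℝ}
    {SL SR SL' SR' : Trace} {y z : ℝ} (hyz : y ≤ z)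
    (hp : ContinuousOn p (Icc y z)) (hv : ContinuousOn v (Icc y z))
    (hpt : ContinuousOn pt (Icc y z)) (hvt : ContinuousOn vt (Icc y z))
    (hp' : ContinuousOn p' (Icc y z)) (hv' : ContinuousOn v' (Icc y z))
    (hpt' : ContinuousOn pt' (Icc y z)) (hvt' : ContinuousOn vt' (Icc y z)) :
    weakElement P ψ χ (fun x => p x - p' x) (fun x => v x - v' x) (fun x => pt x - pt' x)
      (fun x => vt x - vt' x) (SL - SL') (SR - SR') y z
      = weakElement P ψ χ p v pt vt SL SR y z - weakElement P ψ χ p' v' pt' vt' SL' SR' y z := by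
  have e : ∀ (φ : ℝ[X]) {f g : ℝ → ℝ}, ContinuousOn f (Icc y z) → ContinuousOn g (Icc y z) →
      ∫ x in y..z, φ.eval x * (f x - g x)
        = (∫ x in y..z, φ.eval x * f x) - ∫ x in y..z, φ.eval x * g x := by
    intro φ f g hf hg
    rw [← intervalIntegral.integral_sub (intervalIntegrable_eval_mul hyz hf φ)
      (intervalIntegrable_eval_mul hyz hg φ)]
    congr 1; ext x; ring
  simp only [weakElement]
  rw [integral_weakIntegrand P ψ χ hyz (hp.fun_sub hp') (hv.fun_sub hv') (hpt.fun_sub hpt')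
      (hvt.fun_sub hvt'),
    integral_weakIntegrand P ψ χ hyz hp hv hpt hvt,
    integral_weakIntegrand P ψ χ hyz hp' hv' hpt' hvt', e _ hp hp', e _ hp hp', e _ hv hv',
    e _ hv hv', e _ hpt hpt', e _ hvt hvt']
  simp only [weakFace, Trace.sub_v, Trace.sub_p]
  ring

/-- Tested with itself, the spatial part is a total derivative: `ψψ'` and `χχ'` are halves of
derivatives of squares, and `ψ'χ + χ'ψ` is a derivative. Only end point values survive, collected in
`energyFlux`. -/
theorem weakElement_self (P : Params) (ψ χ : ℝ[X]) {pt vt : ℝ → ℝ} {SL SR : Trace} {y z : ℝ}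
    (hyz : y ≤ z) (hpt : ContinuousOn pt (Icc y z)) (hvt : ContinuousOn vt (Icc y z)) :
    weakElement P ψ χ (fun x => ψ.eval x) (fun x => χ.eval x) pt vt SL SR y z
      = (P.c ^ 2 * (∫ x in y..z, ψ.eval x * pt x) + ∫ x in y..z, χ.eval x * vt x)
        + (energyFlux P ⟨χ.eval z, ψ.eval z⟩ SR - energyFlux P ⟨χ.eval y, ψ.eval y⟩ SL) := by
  have hib : ∀ a f : ℝ[X], ∫ x in y..z, a.eval x * (derivative f).eval x
      = a.eval z * f.eval z - a.eval y * f.eval y - ∫ x in y..z, (derivative a).eval x * f.eval x :=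
    fun a f => integral_mul_deriv_Icc hyz a (fun x _ => (f.hasDerivAt x).hasDerivWithinAt)
      (derivative f).continuous.continuousOn
  have hcomm : ∀ a f : ℝ[X], ∫ x in y..z, a.eval x * f.eval x = ∫ x in y..z, f.eval x * a.eval x :=
    fun a f => by congr 1; ext x; ring
  have e1 := hib ψ ψ
  have e2 := hib χ χ
  have e3 := hib χ ψ
  rw [hcomm ψ (derivative ψ)] at e1
  rw [hcomm χ (derivative χ)] at e2
  rw [hcomm χ (derivative ψ)] at e3
  rw [weakElement, integral_weakIntegrand P ψ χ hyz ψ.continuous.continuousOn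
    χ.continuous.continuousOn hpt hvt]
  simp only [weakFace, energyFlux]
  linear_combination (-(P.c ^ 2 * P.w) / 2) * e1 + (-P.w / 2) * e2 + P.c ^ 2 * e3

/-- Differentiation lowers the degree of the test polynomials below `q - 1`, exactly the range in
which the projection error is orthogonal. -/
theorem weakElement_projectionError (P : Params) {q : ℕ} {ψ χ : ℝ[X]}
    (hψ : ψ.degree < (q : WithBot ℕ)) (hχ : χ.degree < (q : WithBot ℕ)) (hq : 1 ≤ q)
    {l r : ℝ × ℝ} {y z : ℝ} (hyz : y ≤ z) {F G : ℝ → ℝ} (hF : ContinuousOn F (Icc y z))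
    (hG : ContinuousOn G (Icc y z)) {pp pv : ℝ[X]} (h : IsPairProjection q l r y z F G pp pv)
    {pt vt : ℝ → ℝ} (hpt : ContinuousOn pt (Icc y z)) (hvt : ContinuousOn vt (Icc y z)) :
    weakElement P ψ χ (fun x => pp.eval x - F x) (fun x => pv.eval x - G x) pt vt ⟨0, 0⟩ ⟨0, 0⟩ y z
      = P.c ^ 2 * (∫ x in y..z, ψ.eval x * pt x) + ∫ x in y..z, χ.eval x * vt x := by
  have hd : ∀ {a : ℝ[X]}, a.degree < (q : WithBot ℕ) →
      (derivative a).degree < ((q - 1 : ℕ) : WithBot ℕ) := by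
    intro a ha
    refine degree_derivative_lt_of_degree_le ?_
    rwa [show q - 1 + 1 = q by omega]
  rw [weakElement, integral_weakIntegrand P ψ χ hyz (pp.continuous.continuousOn.fun_sub hF)
    (pv.continuous.continuousOn.fun_sub hG) hpt hvt, h.orth_p _ (hd hψ), h.orth_p _ (hd hχ),
    h.orth_v _ (hd hψ), h.orth_v _ (hd hχ)]
  simp [weakFace]

/-! ### The energy balance of the error -/

/-- The trace at `y` of `v = g` and `∂u/∂x`, `u = f`, for functions on `[a, b]`. -/
noncomputable def exactTrace (a b : ℝ) (f g : ℝ → ℝ) (y : ℝ) : Trace :=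
  ⟨g y, derivWithin f (Icc a b) y⟩

/-- At inflow, `u = 0` for all times gives `u_t = 0`, and the first equation then reads `v = w u_x`,
the condition imposed on the inflow flux. At outflow, where `wn > 0` since `w ≠ 0`, the radiation
condition is the one imposed. -/
theorem IsClassicalSolution.boundaryFlux_eq {P : Params} {bc : BoundaryType} {a b T : ℝ}
    (hT : 0 < T) {u v : ℝ → ℝ → ℝ} (h : IsClassicalSolution P bc a b T u v) (hw : P.w ≠ 0)
    (hξ : 0 < P.ξ) {n y : ℝ} (hn : n * n = 1) (hy : y ∈ Icc a b)
    (hb : ∀ t ∈ Icc 0 T, PhysicalCondition P n (u t y) (v t y) (derivWithin (u t) (Icc a b) y))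
    {t : ℝ} (ht : t ∈ Icc 0 T) :
    boundaryFlux P n (exactTrace a b (u t) (v t) y) = exactTrace a b (u t) (v t) y := by
  have hn0 : n ≠ 0 := by rintro rfl; norm_num at hn
  unfold boundaryFlux
  split_ifs with hneg
  · refine inflowFlux_eq_self hn hξ hneg ?_
    have hz : ∀ s ∈ Icc 0 T, u s y = 0 := fun s hs => (hb s hs).1 hneg
    have hd : derivWithin (fun s => u s y) (Icc 0 T) t = 0 := by
      have : HasDerivWithinAt (fun s => u s y) 0 (Icc 0 T) t :=
        (hasDerivWithinAt_const t _ (0 : ℝ)).congr hz (hz t ht)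
      exact this.derivWithin (uniqueDiffOn_Icc hT t ht)
    have := h.eq_u t ht y hy
    rw [hd] at this
    simp only [exactTrace]
    linarith
  · refine outflowFlux_eq_self hn hξ ?_
    exact (hb t ht).2 (lt_of_le_of_ne (not_lt.1 hneg) (mul_ne_zero hw hn0).symm)

theorem IsClassicalSolution.nodeFlux_eq {P : Params} {bc : BoundaryType} (hP : Admissible P bc)
    {N : ℕ} {x : ℕ → ℝ} (hN : 0 < N) (hx : ∀ j < N, x j < x (j + 1)) {T : ℝ} (hT : 0 < T)
    {u v : ℝ → ℝ → ℝ} (h : IsClassicalSolution P bc (x 0) (x N) T u v) {t : ℝ}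
    (ht : t ∈ Icc 0 T) : ∀ i ≤ N,
    nodeFlux P bc N (fun j => exactTrace (x 0) (x N) (u t) (v t) (x j))
      (fun j => exactTrace (x 0) (x N) (u t) (v t) (x (j + 1))) i
      = exactTrace (x 0) (x N) (u t) (v t) (x i) := by
  have hab := mesh_lt hN hx
  refine nodeFlux_consistent P bc hN x _ ?_ ?_ ?_
  · rintro rfl
    obtain ⟨-, h2, h3⟩ := h.boundary t ht
    exact Trace.ext' h2 h3
  · rintro rfl
    obtain ⟨hw, hξ, -⟩ := hP.physical rfl
    exact h.boundaryFlux_eq hT hw hξ (by norm_num) (left_mem_Icc.2 hab.le)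
      (fun s hs => (h.boundary s hs).1) ht
  · rintro rfl
    obtain ⟨hw, hξ, -⟩ := hP.physical rfl
    exact h.boundaryFlux_eq hT hw hξ (by norm_num) (right_mem_Icc.2 hab.le)
      (fun s hs => (h.boundary s hs).2) ht

theorem errorEnergy_eq (P : Params) (N : ℕ) (x : ℕ → ℝ) (pu pv uh vh : ℕ → ℝ[X]) :
    errorEnergy P N x pu pv uh vh = 1 / 2 * ∑ j ∈ Finset.range N,
      ((∫ y in (x j)..(x (j + 1)), ((pv j - vh j).eval y) ^ 2)
        + P.c ^ 2 * ∫ y in (x j)..(x (j + 1)), ((derivative (pu j - uh j)).eval y) ^ 2) := by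
  unfold errorEnergy
  congr 1
  refine Finset.sum_congr rfl fun j _ => ?_
  rw [← intervalIntegral.integral_const_mul, ← intervalIntegral.integral_add]
  · exact Continuous.intervalIntegrable (by fun_prop) _ _
  · exact Continuous.intervalIntegrable (by fun_prop) _ _

/-- The coefficients of the projection of a classical solution are differentiable in time, and
their derivatives are those of the projection of the time derivatives. -/
theorem IsRegularSystem.hasDerivWithinAt_projection {P : Params} {bc : BoundaryType}
    (hP : Admissible P bc) {q : ℕ} (hq : 1 ≤ q) {N : ℕ} {x : ℕ → ℝ}
    (hx : ∀ j < N, x j < x (j + 1)) {T : ℝ} {p v px vx : ℝ → ℝ → ℝ}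
    (h : IsRegularSystem P (x 0) (x N) T p v px vx) {j : ℕ} (hj : j < N)
    {pp pv : ℝ → ℝ[X]} (hpair : ∀ s ∈ Icc 0 T, IsPairProjection q (leftCoef P bc j)
      (rightCoef P bc N j) (x j) (x (j + 1)) (p s) (v s) (pp s) (pv s))
    {t : ℝ} (ht : t ∈ Icc 0 T) {pp' pv' : ℝ[X]} (hpair' : IsPairProjection q (leftCoef P bc j)
      (rightCoef P bc N j) (x j) (x (j + 1)) (fun y => vx t y - P.w * px t y)
      (fun y => P.c ^ 2 * px t y - P.w * vx t y) pp' pv') (k : ℕ) :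
    HasDerivWithinAt (fun s => (pp s).coeff k) (pp'.coeff k) (Icc 0 T) t ∧
      HasDerivWithinAt (fun s => (pv s).coeff k) (pv'.coeff k) (Icc 0 T) t := by
  have hyz := hx j hj
  have hsub : Icc (x j) (x (j + 1)) ⊆ Icc (x 0) (x N) :=
    Icc_subset_Icc (mesh_mono hx (by omega) (by omega)) (mesh_mono hx (by omega) le_rfl)
  have hslice : ∀ {f : ℝ → ℝ → ℝ},
      ContinuousOn (Function.uncurry f) (Icc 0 T ×ˢ Icc (x 0) (x N)) → ∀ s ∈ Icc 0 T,
      ContinuousOn (f s) (Icc (x j) (x (j + 1))) := fun hf s hs =>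
    hf.comp (f := fun y => (s, y)) (by fun_prop) fun y hy => mk_mem_prod hs (hsub hy)
  have hcpx := hslice h.continuousOn_px
  have hcvx := hslice h.continuousOn_vx
  -- Continuity on the compact space-time rectangle provides the uniform bounds on the time
  -- derivatives needed to differentiate the moments.
  have hcomp : IsCompact (Icc (0 : ℝ) T ×ˢ Icc (x 0) (x N)) := isCompact_Icc.prod isCompact_Icc
  obtain ⟨K1, hK1⟩ := hcomp.exists_bound_of_continuousOn
    (f := fun m : ℝ × ℝ => vx m.1 m.2 - P.w * px m.1 m.2)
    (h.continuousOn_vx.sub (continuousOn_const.mul h.continuousOn_px))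
  obtain ⟨K2, hK2⟩ := hcomp.exists_bound_of_continuousOn
    (f := fun m : ℝ × ℝ => P.c ^ 2 * px m.1 m.2 - P.w * vx m.1 m.2)
    ((continuousOn_const.mul h.continuousOn_px).sub (continuousOn_const.mul h.continuousOn_vx))
  have hpc : ∀ s ∈ Icc 0 T, ContinuousOn (p s) (Icc (x j) (x (j + 1))) := fun s hs y hy =>
    ((h.deriv_p s hs y (hsub hy)).continuousWithinAt).mono hsub
  have hvc : ∀ s ∈ Icc 0 T, ContinuousOn (v s) (Icc (x j) (x (j + 1))) := fun s hs y hy =>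
    ((h.deriv_v s hs y (hsub hy)).continuousWithinAt).mono hsub
  have c1 := hcpx t ht
  have c2 := hcvx t ht
  refine hasDerivWithinAt_coeff_pair hq (hP.det_pos N j).ne' hyz ht hpc hvc (by fun_prop)
    (by fun_prop) hpair hpair' ?_ ?_ k
  · intro e he
    exact hasDerivWithinAt_radauData (R' := fun s y => vx s y - P.w * px s y) hyz.le
      (endpoint_mem_Icc hyz.le he) hpc (fun s hs y hy => h.deriv_time_p s hs y (hsub hy))
      (fun s hs y hy => hK1 (s, y) (mk_mem_prod hs (hsub hy))) ht
  · intro e he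
    exact hasDerivWithinAt_radauData (R' := fun s y => P.c ^ 2 * px s y - P.w * vx s y) hyz.le
      (endpoint_mem_Icc hyz.le he) hvc (fun s hs y hy => h.deriv_time_v s hs y (hsub hy))
      (fun s hs y hy => hK2 (s, y) (mk_mem_prod hs (hsub hy))) ht

/-- The energy of the error grows at most at the rate caused by the time derivative of the
projection error. -/
theorem errorEnergy_deriv_le {P : Params} {bc : BoundaryType} (hP : Admissible P bc) {q : ℕ}
    (hq : 1 ≤ q) {N : ℕ} {x : ℕ → ℝ} (hN : 0 < N) (hx : ∀ j < N, x j < x (j + 1)) {T : ℝ}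
    (hT : 0 < T) {u v px vx : ℝ → ℝ → ℝ} (h : IsClassicalSolution P bc (x 0) (x N) T u v)
    (hreg : IsRegularSystem P (x 0) (x N) T (fun t => derivWithin (u t) (Icc (x 0) (x N))) v px vx)
    {uh vh : ℝ → ℕ → ℝ[X]} (hdg : IsDGSolution P bc q N x T uh vh) {pu pv : ℝ → ℕ → ℝ[X]}
    (hproj : ∀ t ∈ Icc 0 T, ∀ j < N,
      IsProjection P bc q N x j (u t) (v t) (pu t j) (pv t j)) {t : ℝ} (ht : t ∈ Icc 0 T)
    {pp' pv' : ℕ → ℝ[X]} (hpair' : ∀ j < N, IsPairProjection q (leftCoef P bc j)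
      (rightCoef P bc N j) (x j) (x (j + 1)) (fun y => vx t y - P.w * px t y)
      (fun y => P.c ^ 2 * px t y - P.w * vx t y) (pp' j) (pv' j)) :
    ∃ D : ℝ, HasDerivWithinAt (fun s => errorEnergy P N x (pu s) (pv s) (uh s) (vh s)) D
        (Icc 0 T) t ∧
      D ≤ ∑ j ∈ Finset.range N,
        (P.c ^ 2 * (∫ y in (x j)..(x (j + 1)), (derivative (pu t j - uh t j)).eval y
            * ((pp' j).eval y - (vx t y - P.w * px t y)))
          + ∫ y in (x j)..(x (j + 1)), (pv t j - vh t j).eval y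
            * ((pv' j).eval y - (P.c ^ 2 * px t y - P.w * vx t y))) := by
  obtain ⟨hdeg, Ut, Vt, hcoef, hform⟩ := hdg
  have hpairs : ∀ s ∈ Icc 0 T, ∀ j < N, IsPairProjection q (leftCoef P bc j)
      (rightCoef P bc N j) (x j) (x (j + 1)) (derivWithin (u s) (Icc (x 0) (x N))) (v s)
      (derivative (pu s j)) (pv s j) := fun s hs j hj => (isProjection_iff.1 (hproj s hs j hj)).2.1
  have hdiff : UniqueDiffWithinAt ℝ (Icc 0 T) t := uniqueDiffOn_Icc hT t ht
  set ψ : ℝ → ℕ → ℝ[X] := fun s j => derivative (pu s j - uh s j) with hψ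
  set χ : ℝ → ℕ → ℝ[X] := fun s j => pv s j - vh s j with hχ
  set ψ' : ℕ → ℝ[X] := fun j => pp' j - derivative (Ut t j) with hψ'
  set χ' : ℕ → ℝ[X] := fun j => pv' j - Vt t j with hχ'
  have hdψ : ∀ s ∈ Icc 0 T, ∀ j < N, (ψ s j).degree < (q : WithBot ℕ) := fun s hs j hj =>
    degree_derivative_lt_of_degree_le (degree_lt_succ_iff.2 ((degree_sub_le _ _).trans
      (max_le (hproj s hs j hj).degree_u (hdeg s hs j hj).1)))
  have hdχ : ∀ s ∈ Icc 0 T, ∀ j < N, (χ s j).degree < (q : WithBot ℕ) := fun s hs j hj =>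
    (degree_sub_le _ _).trans_lt (max_lt (hproj s hs j hj).degree_v (hdeg s hs j hj).2)
  have hcoefψ : ∀ j < N, ∀ k, HasDerivWithinAt (fun s => (ψ s j).coeff k) ((ψ' j).coeff k)
      (Icc 0 T) t := by
    intro j hj k
    have h1 := (hreg.hasDerivWithinAt_projection hP hq hx hj (fun s hs => hpairs s hs j hj) ht
      (hpair' j hj) k).1
    have h2 := ((hcoef t ht j hj (k + 1)).1).mul_const ((k : ℝ) + 1)
    simp only [hψ, hψ', derivative_sub, coeff_sub]
    exact h1.sub (by simpa only [coeff_derivative] using h2)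
  have hcoefχ : ∀ j < N, ∀ k, HasDerivWithinAt (fun s => (χ s j).coeff k) ((χ' j).coeff k)
      (Icc 0 T) t := by
    intro j hj k
    have h1 := (hreg.hasDerivWithinAt_projection hP hq hx hj (fun s hs => hpairs s hs j hj) ht
      (hpair' j hj) k).2
    simp only [hχ, hχ', coeff_sub]
    exact h1.sub (hcoef t ht j hj k).2
  have hdψ' : ∀ j < N, (ψ' j).degree < (q : WithBot ℕ) := fun j hj =>
    degree_lt_of_hasDerivWithinAt_coeff hdiff ht (fun s hs => hdψ s hs j hj) (hcoefψ j hj)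
  have hdχ' : ∀ j < N, (χ' j).degree < (q : WithBot ℕ) := fun j hj =>
    degree_lt_of_hasDerivWithinAt_coeff hdiff ht (fun s hs => hdχ s hs j hj) (hcoefχ j hj)
  refine ⟨∑ j ∈ Finset.range N,
    (P.c ^ 2 * (∫ y in (x j)..(x (j + 1)), (ψ t j).eval y * (ψ' j).eval y)
      + ∫ y in (x j)..(x (j + 1)), (χ t j).eval y * (χ' j).eval y), ?_, ?_⟩
  · simp only [errorEnergy_eq]
    have hsum : HasDerivWithinAt (fun s => ∑ j ∈ Finset.range N,
        ((∫ y in (x j)..(x (j + 1)), ((χ s j).eval y) ^ 2)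
          + P.c ^ 2 * ∫ y in (x j)..(x (j + 1)), ((ψ s j).eval y) ^ 2))
        (∑ j ∈ Finset.range N,
          ((2 * ∫ y in (x j)..(x (j + 1)), (χ t j).eval y * (χ' j).eval y)
            + P.c ^ 2 * (2 * ∫ y in (x j)..(x (j + 1)), (ψ t j).eval y * (ψ' j).eval y)))
        (Icc 0 T) t := by
      refine HasDerivWithinAt.fun_sum fun j hj => ?_
      have hj' := Finset.mem_range.1 hj
      exact (hasDerivWithinAt_integral_eval_sq ht (fun s hs => hdχ s hs j hj') (hdχ' j hj')
        (hcoefχ j hj') _ _).add ((hasDerivWithinAt_integral_eval_sq ht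
          (fun s hs => hdψ s hs j hj') (hdψ' j hj') (hcoefψ j hj') _ _).const_mul _)
    refine (hsum.const_mul (1 / 2)).congr_deriv ?_
    rw [Finset.mul_sum]
    exact Finset.sum_congr rfl fun j _ => by ring
  · set a := x 0
    set b := x N
    set ex : ℝ → Trace := exactTrace a b (u t) (v t) with hex
    set F : ℝ → ℝ := derivWithin (u t) (Icc a b) with hF
    set F' : ℝ → ℝ := fun y => vx t y - P.w * px t y with hF'
    set G' : ℝ → ℝ := fun y => P.c ^ 2 * px t y - P.w * vx t y with hG'
    set eL : ℕ → Trace := fun j => polyTrace (pu t j - uh t j) (pv t j - vh t j) (x j) with heL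
    set eR : ℕ → Trace := fun j => polyTrace (pu t j - uh t j) (pv t j - vh t j) (x (j + 1))
      with heR
    set hL : ℕ → Trace := fun j => polyTrace (uh t j) (vh t j) (x j) with hhL
    set hR : ℕ → Trace := fun j => polyTrace (uh t j) (vh t j) (x (j + 1)) with hhR
    set S := nodeFlux P bc N eL eR with hS
    set Sh := nodeFlux P bc N hL hR with hSh
    -- Linearity of the flux applied to `ẽ = δ - (u^h - u)`: the flux of `δ` is zero and that of the
    -- exact solution is its own trace.
    have hflux : ∀ i ≤ N, S i = ⟨0, 0⟩ - (Sh i - ex (x i)) := by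
      intro i hi
      have e0 := nodeFlux_error_eq_zero hP hN
        (trL := fun j => errTrace a b (u t) (v t) (pu t j) (pv t j) (x j))
        (trR := fun j => errTrace a b (u t) (v t) (pu t j) (pv t j) (x (j + 1)))
        (fun j hj => (hproj t ht j hj).left_end) (fun j hj => (hproj t ht j hj).right_end) i hi
      have e1 := h.nodeFlux_eq hP hN hx hT ht i hi
      rw [← e0, hex, ← e1, hSh, ← nodeFlux_sub, ← nodeFlux_sub]
      refine nodeFlux_congr P bc hN (fun j _ => ?_) (fun j _ => ?_) i <;>
      · apply Trace.ext' <;>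
          simp only [heL, heR, hhL, hhR, polyTrace, errTrace, exactTrace, Trace.sub_v,
            Trace.sub_p, derivative_sub, eval_sub] <;> ring
    -- The error identity on one element. The weak form of the scheme on the right vanishes only
    -- after summation over the elements.
    have hel : ∀ j < N,
        (P.c ^ 2 * (∫ y in (x j)..(x (j + 1)), (ψ t j).eval y * (ψ' j).eval y)
          + ∫ y in (x j)..(x (j + 1)), (χ t j).eval y * (χ' j).eval y)
        + (energyFlux P (eR j) (S (j + 1)) - energyFlux P (eL j) (S j))
        = (P.c ^ 2 * (∫ y in (x j)..(x (j + 1)), (ψ t j).eval y * ((pp' j).eval y - F' y))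
          + ∫ y in (x j)..(x (j + 1)), (χ t j).eval y * ((pv' j).eval y - G' y))
        - weakElement P (ψ t j) (χ t j) (fun y => (derivative (uh t j)).eval y)
            (fun y => (vh t j).eval y) (fun y => (derivative (Ut t j)).eval y)
            (fun y => (Vt t j).eval y) (Sh j) (Sh (j + 1)) (x j) (x (j + 1)) := by
      intro j hj
      have hyz := (hx j hj).le
      have hsub : Icc (x j) (x (j + 1)) ⊆ Icc a b :=
        Icc_subset_Icc (mesh_mono hx (by omega) (by omega)) (mesh_mono hx (by omega) le_rfl)
      have hpx : ContinuousOn (px t) (Icc (x j) (x (j + 1))) :=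
        hreg.continuousOn_px.comp (f := fun y => (t, y)) (by fun_prop)
          fun y hy => mk_mem_prod ht (hsub hy)
      have hvx : ContinuousOn (vx t) (Icc (x j) (x (j + 1))) :=
        hreg.continuousOn_vx.comp (f := fun y => (t, y)) (by fun_prop)
          fun y hy => mk_mem_prod ht (hsub hy)
      have hFd : ∀ y ∈ Icc (x j) (x (j + 1)),
          HasDerivWithinAt F (px t y) (Icc (x j) (x (j + 1))) y :=
        fun y hy => (hreg.deriv_p t ht y (hsub hy)).mono hsub
      have hGd : ∀ y ∈ Icc (x j) (x (j + 1)),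
          HasDerivWithinAt (v t) (vx t y) (Icc (x j) (x (j + 1))) y :=
        fun y hy => (hreg.deriv_v t ht y (hsub hy)).mono hsub
      have hFc : ContinuousOn F (Icc (x j) (x (j + 1))) :=
        fun y hy => (hFd y hy).continuousWithinAt
      have hGc : ContinuousOn (v t) (Icc (x j) (x (j + 1))) :=
        fun y hy => (hGd y hy).continuousWithinAt
      have hF'c : ContinuousOn F' (Icc (x j) (x (j + 1))) := by fun_prop
      have hG'c : ContinuousOn G' (Icc (x j) (x (j + 1))) := by fun_prop
      have hpc : ∀ p : ℝ[X], ContinuousOn (fun y => p.eval y) (Icc (x j) (x (j + 1))) :=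
        fun p => p.continuous.continuousOn
      have w1 := weakElement_self P (ψ t j) (χ t j) (SL := S j) (SR := S (j + 1)) hyz
        (hpc (ψ' j)) (hpc (χ' j))
      have w2 := weakElement_projectionError P (hdψ t ht j hj) (hdχ t ht j hj) hq hyz hFc hGc
        (hpairs t ht j hj) ((hpc (pp' j)).fun_sub hF'c) ((hpc (pv' j)).fun_sub hG'c)
      have w3 := weakElement_exact P (ψ t j) (χ t j) hyz hFd hGd hpx hvx
      have w4 := weakElement_sub P (ψ t j) (χ t j) (SL := Sh j) (SR := Sh (j + 1))
        (SL' := ex (x j)) (SR' := ex (x (j + 1))) hyz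
        (hpc (derivative (uh t j))) (hpc (vh t j)) (hpc (derivative (Ut t j))) (hpc (Vt t j))
        hFc hGc hF'c hG'c
      -- The weak form of `ẽ` is that of `δ` minus that of `u^h - u`; with `w4` and `w3` the latter
      -- reduces to the form of the scheme.
      have w5 := weakElement_sub P (ψ t j) (χ t j) (SL := ⟨0, 0⟩) (SR := ⟨0, 0⟩)
        (SL' := Sh j - ex (x j)) (SR' := Sh (j + 1) - ex (x (j + 1))) hyz
        ((hpc (derivative (pu t j))).fun_sub hFc) ((hpc (pv t j)).fun_sub hGc)
        ((hpc (pp' j)).fun_sub hF'c) ((hpc (pv' j)).fun_sub hG'c)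
        ((hpc (derivative (uh t j))).fun_sub hFc) ((hpc (vh t j)).fun_sub hGc)
        ((hpc (derivative (Ut t j))).fun_sub hF'c) ((hpc (Vt t j)).fun_sub hG'c)
      rw [← hflux j (by omega), ← hflux (j + 1) (by omega)] at w5
      have e1 : ∀ A B C : ℝ, A - C - (B - C) = A - B := fun A B C => by ring
      simp only [e1] at w5
      have f1 : (fun y => (ψ t j).eval y)
          = fun y => (derivative (pu t j)).eval y - (derivative (uh t j)).eval y := by
        funext y; simp [hψ]
      have f2 : (fun y => (χ t j).eval y) = fun y => (pv t j).eval y - (vh t j).eval y := by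
        funext y; simp [hχ]
      have f3 : (fun y => (ψ' j).eval y)
          = fun y => (pp' j).eval y - (derivative (Ut t j)).eval y := by
        funext y; simp [hψ']
      have f4 : (fun y => (χ' j).eval y) = fun y => (pv' j).eval y - (Vt t j).eval y := by
        funext y; simp [hχ']
      rw [← f1, ← f2, ← f3, ← f4, w1, w2, w4] at w5
      have w3' : weakElement P (ψ t j) (χ t j) F (v t) F' G' (ex (x j)) (ex (x (j + 1)))
        (x j) (x (j + 1)) = 0 := w3
      rw [w3'] at w5
      have hbd : energyFlux P (eR j) (S (j + 1)) - energyFlux P (eL j) (S j)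
          = energyFlux P ⟨(χ t j).eval (x (j + 1)), (ψ t j).eval (x (j + 1))⟩ (S (j + 1))
            - energyFlux P ⟨(χ t j).eval (x j), (ψ t j).eval (x j)⟩ (S j) := rfl
      rw [hbd]
      linarith
    have hzero : ∑ j ∈ Finset.range N, weakElement P (ψ t j) (χ t j)
        (fun y => (derivative (uh t j)).eval y)
        (fun y => (vh t j).eval y) (fun y => (derivative (Ut t j)).eval y)
        (fun y => (Vt t j).eval y) (Sh j) (Sh (j + 1)) (x j) (x (j + 1)) = 0 := by
      -- The test pair is the discrete error itself. The constant test function is zero, since it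
      -- only governs the element means of `u^h`, which the energy does not see.
      have hf := hform t ht (fun j => pu t j - uh t j) (fun j => χ t j) (fun _ => 0)
        (fun j hj => ⟨(degree_sub_le _ _).trans
          (max_le (hproj t ht j hj).degree_u (hdeg t ht j hj).1), hdχ t ht j hj⟩)
      simp only [formB] at hf
      rw [← Finset.sum_sub_distrib] at hf
      rw [← hf]
      refine Finset.sum_congr rfl fun j hj => ?_
      rw [volumeTerm_sub_faceTerm P _ _ _ _ _ _ (hx j (Finset.mem_range.1 hj)).le]
    have hdiss : 0 ≤ ∑ j ∈ Finset.range N,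
        (energyFlux P (eR j) (S (j + 1)) - energyFlux P (eL j) (S j)) :=
      hP.energy_dissipation hN eL eR
    have hsum := Finset.sum_congr rfl fun j hj => hel j (Finset.mem_range.1 hj)
    rw [Finset.sum_add_distrib] at hsum
    conv_rhs at hsum => rw [Finset.sum_sub_distrib, hzero, sub_zero]
    rw [← hsum]
    exact le_add_of_nonneg_right hdiss

/-! ### Summation over the elements -/

/-- Cauchy–Schwarz for the weighted sum, from the discriminant of a nonnegative quadratic in `t`. On
each element the integrand is `(tχ - g)² + c²(tψ - f)² + f² + c²g²`, whence the factor `c² + 1`. -/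
theorem sum_integral_mul_le {N : ℕ} {x : ℕ → ℝ} (hx : ∀ j < N, x j < x (j + 1)) (c : ℝ)
    (ψ χ : ℕ → ℝ[X]) {f g : ℕ → ℝ → ℝ}
    (hf : ∀ j < N, ContinuousOn (f j) (Icc (x j) (x (j + 1))))
    (hg : ∀ j < N, ContinuousOn (g j) (Icc (x j) (x (j + 1)))) :
    ∑ j ∈ Finset.range N, (c ^ 2 * (∫ y in (x j)..(x (j + 1)), (ψ j).eval y * f j y)
        + ∫ y in (x j)..(x (j + 1)), (χ j).eval y * g j y)
      ≤ Real.sqrt (∑ j ∈ Finset.range N, ((∫ y in (x j)..(x (j + 1)), ((χ j).eval y) ^ 2)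
          + c ^ 2 * ∫ y in (x j)..(x (j + 1)), ((ψ j).eval y) ^ 2))
        * Real.sqrt ((c ^ 2 + 1) * ∑ j ∈ Finset.range N,
          ∫ y in (x j)..(x (j + 1)), (f j y ^ 2 + g j y ^ 2)) := by
  set X := ∑ j ∈ Finset.range N, ((∫ y in (x j)..(x (j + 1)), ((χ j).eval y) ^ 2)
          + c ^ 2 * ∫ y in (x j)..(x (j + 1)), ((ψ j).eval y) ^ 2) with hX
  set Y := ∑ j ∈ Finset.range N, (c ^ 2 * (∫ y in (x j)..(x (j + 1)), (ψ j).eval y * f j y)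
        + ∫ y in (x j)..(x (j + 1)), (χ j).eval y * g j y) with hY
  set Z := ∑ j ∈ Finset.range N, ∫ y in (x j)..(x (j + 1)), (f j y ^ 2 + g j y ^ 2) with hZ
  have key : ∀ t : ℝ, 0 ≤ X * (t * t) + (-2 * Y) * t + (c ^ 2 + 1) * Z := by
    intro t
    rw [hX, hY, hZ, Finset.sum_mul, Finset.mul_sum, Finset.sum_mul, Finset.mul_sum,
      ← Finset.sum_add_distrib, ← Finset.sum_add_distrib]
    refine Finset.sum_nonneg fun j hj => ?_
    have hj' := Finset.mem_range.1 hj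
    have hyz := (hx j hj').le
    have hf' := hf j hj'
    have hg' := hg j hj'
    have i1 : IntervalIntegrable (fun y => ((χ j).eval y) ^ 2) volume (x j) (x (j + 1)) :=
      Continuous.intervalIntegrable (by fun_prop) _ _
    have i2 : IntervalIntegrable (fun y => ((ψ j).eval y) ^ 2) volume (x j) (x (j + 1)) :=
      Continuous.intervalIntegrable (by fun_prop) _ _
    have i3 := intervalIntegrable_eval_mul hyz hf' (ψ j)
    have i4 := intervalIntegrable_eval_mul hyz hg' (χ j)
    have i5 : IntervalIntegrable (fun y => f j y ^ 2 + g j y ^ 2) volume (x j) (x (j + 1)) :=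
      ContinuousOn.intervalIntegrable_of_Icc hyz (by fun_prop)
    have e : ((∫ y in (x j)..(x (j + 1)), ((χ j).eval y) ^ 2)
          + c ^ 2 * ∫ y in (x j)..(x (j + 1)), ((ψ j).eval y) ^ 2) * (t * t)
        + -2 * (c ^ 2 * (∫ y in (x j)..(x (j + 1)), (ψ j).eval y * f j y)
          + ∫ y in (x j)..(x (j + 1)), (χ j).eval y * g j y) * t
        + (c ^ 2 + 1) * ∫ y in (x j)..(x (j + 1)), (f j y ^ 2 + g j y ^ 2)
        = ∫ y in (x j)..(x (j + 1)), ((t * t) * ((χ j).eval y) ^ 2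
          + (c ^ 2 * (t * t)) * ((ψ j).eval y) ^ 2 + (-2 * c ^ 2 * t) * ((ψ j).eval y * f j y)
          + (-2 * t) * ((χ j).eval y * g j y) + (c ^ 2 + 1) * (f j y ^ 2 + g j y ^ 2)) := by
      rw [intervalIntegral.integral_add ((((i1.const_mul _).add (i2.const_mul _)).add
          (i3.const_mul _)).add (i4.const_mul _)) (i5.const_mul _),
        intervalIntegral.integral_add (((i1.const_mul _).add (i2.const_mul _)).add
          (i3.const_mul _)) (i4.const_mul _),
        intervalIntegral.integral_add ((i1.const_mul _).add (i2.const_mul _)) (i3.const_mul _),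
        intervalIntegral.integral_add (i1.const_mul _) (i2.const_mul _)]
      simp only [intervalIntegral.integral_const_mul]
      ring
    rw [e]
    refine intervalIntegral.integral_nonneg hyz fun y _ => ?_
    nlinarith [sq_nonneg (t * (χ j).eval y - g j y), sq_nonneg (f j y),
      mul_nonneg (sq_nonneg c) (sq_nonneg (t * (ψ j).eval y - f j y)),
      mul_nonneg (sq_nonneg c) (sq_nonneg (g j y))]
  have hX0 : 0 ≤ X := Finset.sum_nonneg fun j hj => add_nonneg
    (intervalIntegral.integral_nonneg (hx j (Finset.mem_range.1 hj)).le fun y _ => sq_nonneg _)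
    (mul_nonneg (sq_nonneg c) (intervalIntegral.integral_nonneg
      (hx j (Finset.mem_range.1 hj)).le fun y _ => sq_nonneg _))
  rw [← Real.sqrt_mul hX0]
  refine (le_abs_self Y).trans (Real.abs_le_sqrt ?_)
  have := discrim_le_zero key
  rw [discrim] at this
  nlinarith

theorem sum_integral_mesh {N : ℕ} {x : ℕ → ℝ} (hx : ∀ j < N, x j < x (j + 1)) {f : ℝ → ℝ}
    (hf : IntervalIntegrable f volume (x 0) (x N)) :
    ∑ j ∈ Finset.range N, ∫ y in (x j)..(x (j + 1)), f y = ∫ y in (x 0)..(x N), f y := by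
  refine intervalIntegral.sum_integral_adjacent_intervals fun j hj => hf.mono_set ?_
  have h0 : x 0 ≤ x j := mesh_mono hx (by omega) (by omega)
  have h1 : x (j + 1) ≤ x N := mesh_mono hx (by omega) le_rfl
  have h2 := (hx j hj).le
  rw [uIcc_of_le h2, uIcc_of_le (h0.trans (h2.trans h1))]
  exact Icc_subset_Icc h0 h1

theorem intervalIntegrable_sq_of_memLp {f : ℝ → ℝ} {a b : ℝ} (hab : a ≤ b)
    (hf : MemLp f 2 (volume.restrict (Ioo a b))) :
    IntervalIntegrable (fun x => f x ^ 2) volume a b := by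
  rw [intervalIntegrable_iff_integrableOn_Ioo_of_le hab]
  exact hf.integrable_sq

/-- The global error of the coupled projection is of optimal order. -/
theorem sum_projectionError_le {P : Params} {bc : BoundaryType} (hP : Admissible P bc) {K : ℝ}
    (hK : IsCoefBound P bc K) {q : ℕ} (hq : 1 ≤ q) {N : ℕ} {x : ℕ → ℝ} (hN : 0 < N) {h : ℝ}
    (hx : ∀ j < N, x j < x (j + 1)) (hh : ∀ j < N, x (j + 1) - x j ≤ h) {F G F' G' : ℝ → ℝ}
    (hF : ContinuousOn F (Icc (x 0) (x N))) (hG : ContinuousOn G (Icc (x 0) (x N)))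
    (hFi : ∀ i < q, ∃ g, HasL2WeakDeriv i F g (x 0) (x N))
    (hF' : HasL2WeakDeriv q F F' (x 0) (x N))
    (hGi : ∀ i < q, ∃ g, HasL2WeakDeriv i G g (x 0) (x N))
    (hG' : HasL2WeakDeriv q G G' (x 0) (x N)) {pp pv : ℕ → ℝ[X]}
    (hpair : ∀ j < N, IsPairProjection q (leftCoef P bc j) (rightCoef P bc N j) (x j) (x (j + 1))
      F G (pp j) (pv j)) :
    ∑ j ∈ Finset.range N, ∫ y in (x j)..(x (j + 1)),
        (((pp j).eval y - F y) ^ 2 + ((pv j).eval y - G y) ^ 2)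
      ≤ 64 * K ^ 6 * h ^ (2 * q) *
        ((∫ y in (x 0)..(x N), F' y ^ 2) + ∫ y in (x 0)..(x N), G' y ^ 2) := by
  obtain ⟨hK0, hK⟩ := hK
  have hab := (mesh_lt hN hx).le
  rw [← sum_integral_mesh hx (intervalIntegrable_sq_of_memLp hab hF'.2.1),
    ← sum_integral_mesh hx (intervalIntegrable_sq_of_memLp hab hG'.2.1), ← Finset.sum_add_distrib,
    Finset.mul_sum]
  refine Finset.sum_le_sum fun j hj => ?_
  have hj' := Finset.mem_range.1 hj
  have hyz := hx j hj'
  obtain ⟨k0, k1, k2, k3, k4⟩ := hK N j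
  refine ((hpair j hj').error_le hq (hP.det_pos N j).ne' k0 k1 k2 k3 k4 hyz
    (mesh_mono hx (by omega) (by omega)) (mesh_mono hx (by omega) le_rfl) hF hG hFi hF' hGi
    hG').trans ?_
  have h0 : 0 ≤ x (j + 1) - x j := sub_nonneg.2 hyz.le
  have h1 := hh j hj'
  have h2 : 0 ≤ ∫ y in (x j)..(x (j + 1)), F' y ^ 2 :=
    intervalIntegral.integral_nonneg hyz.le fun y _ => sq_nonneg _
  have h3 : 0 ≤ ∫ y in (x j)..(x (j + 1)), G' y ^ 2 :=
    intervalIntegral.integral_nonneg hyz.le fun y _ => sq_nonneg _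
  gcongr

/-- Formally the derivative of `√E` is at most `B/2`, so the bound grows linearly in time with no
exponential factor. -/
theorem le_sq_of_deriv_le_mul_sqrt {T B : ℝ} (hT : 0 < T) (hB : 0 ≤ B) {E : ℝ → ℝ}
    (hE : ∀ t ∈ Icc 0 T, 0 ≤ E t) (h0 : E 0 = 0)
    (hd : ∀ t ∈ Icc 0 T, ∃ D, HasDerivWithinAt E D (Icc 0 T) t ∧ D ≤ B * Real.sqrt (E t)) :
    E T ≤ (B * T / 2) ^ 2 := by
  have h0m : (0 : ℝ) ∈ Icc 0 T := left_mem_Icc.2 hT.le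
  have hTm : T ∈ Icc 0 T := right_mem_Icc.2 hT.le
  have key : Real.sqrt (E T) ≤ B * T / 2 := by
    -- The square root is not differentiable at zero, where `E` starts; `√(E + δ²)` is used instead,
    -- at the price of its initial value `δ`.
    refine le_of_forall_pos_le_add fun δ hδ => ?_
    have hpos : ∀ t ∈ Icc 0 T, 0 < E t + δ ^ 2 := fun t ht => by
      have := hE t ht
      positivity
    have hderiv : ∀ t ∈ Icc 0 T, ∃ D, HasDerivWithinAt (fun s => Real.sqrt (E s + δ ^ 2)) D
        (Icc 0 T) t ∧ D ≤ B / 2 := by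
      intro t ht
      obtain ⟨D, hD, hDle⟩ := hd t ht
      refine ⟨_, (hD.add_const (δ ^ 2)).sqrt (hpos t ht).ne', ?_⟩
      have hs : 0 < Real.sqrt (E t + δ ^ 2) := Real.sqrt_pos.2 (hpos t ht)
      rw [div_le_iff₀ (by positivity)]
      calc D ≤ B * Real.sqrt (E t) := hDle
        _ ≤ B * Real.sqrt (E t + δ ^ 2) := by
            gcongr
            linarith [sq_nonneg δ]
        _ = _ := by ring
    have hmv := (convex_Icc (0 : ℝ) T).image_sub_le_mul_sub_of_deriv_le
      (f := fun s => Real.sqrt (E s + δ ^ 2)) (C := B / 2)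
      (fun t ht => (hderiv t ht).choose_spec.1.continuousWithinAt)
      (fun t ht => ((hderiv t (interior_subset ht)).choose_spec.1.mono
        interior_subset).differentiableWithinAt)
      (fun t ht => by
        obtain ⟨D, hD, hle⟩ := hderiv t (interior_subset ht)
        rw [interior_Icc] at ht
        rwa [(hD.hasDerivAt (Icc_mem_nhds ht.1 ht.2)).deriv]) 0 h0m T hTm hT.le
    simp only [h0, zero_add, sub_zero, Real.sqrt_sq hδ.le] at hmv
    have : Real.sqrt (E T) ≤ Real.sqrt (E T + δ ^ 2) :=
      Real.sqrt_le_sqrt (by linarith [sq_nonneg δ])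
    linarith
  have h1 := Real.sqrt_nonneg (E T)
  calc E T = Real.sqrt (E T) ^ 2 := (Real.sq_sqrt (hE T hTm)).symm
    _ ≤ _ := by gcongr

theorem errorEnergy_nonneg (P : Params) {N : ℕ} {x : ℕ → ℝ} (hx : ∀ j < N, x j < x (j + 1))
    (pu pv uh vh : ℕ → ℝ[X]) : 0 ≤ errorEnergy P N x pu pv uh vh := by
  refine mul_nonneg (by norm_num) (Finset.sum_nonneg fun j hj => ?_)
  exact intervalIntegral.integral_nonneg (hx j (Finset.mem_range.1 hj)).le fun y _ => by positivity

/-! ### The estimates -/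

/-- Weak derivatives of `∂u/∂x` and of the space derivatives in a regular system. -/
theorem IsRegularSystem.hasL2WeakDeriv {P : Params} {a b T : ℝ} (hab : a < b)
    {u v px vx : ℝ → ℝ → ℝ}
    (hreg : IsRegularSystem P a b T (fun t => derivWithin (u t) (Icc a b)) v px vx)
    {t : ℝ} (ht : t ∈ Icc 0 T) (hut : ContDiffOn ℝ 1 (u t) (Icc a b)) {i : ℕ} {g k : ℝ → ℝ}
    (hg : HasL2WeakDeriv (i + 2) (u t) g a b) (hk : HasL2WeakDeriv (i + 1) (v t) k a b) :
    HasL2WeakDeriv i (fun y => vx t y - P.w * px t y) (fun y => k y + -P.w * g y) a b ∧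
    HasL2WeakDeriv i (fun y => P.c ^ 2 * px t y - P.w * vx t y)
      (fun y => P.c ^ 2 * g y + -P.w * k y) a b := by
  have hpx : ContinuousOn (px t) (Icc a b) :=
    hreg.continuousOn_px.comp (f := fun y => (t, y)) (by fun_prop) fun y hy => mk_mem_prod ht hy
  have hvx : ContinuousOn (vx t) (Icc a b) :=
    hreg.continuousOn_vx.comp (f := fun y => (t, y)) (by fun_prop) fun y hy => mk_mem_prod ht hy
  have h1 : HasL2WeakDeriv i (vx t) k a b :=
    hk.of_hasDerivWithinAt hab (hreg.deriv_v t ht) hvx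
  have h2 : HasL2WeakDeriv (i + 1) (derivWithin (u t) (Icc a b)) g a b :=
    HasL2WeakDeriv.of_hasDerivWithinAt hab
      (fun x hx => ((hut.differentiableOn (by norm_num)) x hx).hasDerivWithinAt)
      (continuousOn_derivWithin_Icc hab hut) hg
  have h3 : HasL2WeakDeriv i (px t) g a b := h2.of_hasDerivWithinAt hab (hreg.deriv_p t ht) hpx
  have e1 : (fun y => vx t y - P.w * px t y) = fun y => vx t y + -P.w * px t y := by
    funext y; ring
  have e2 : (fun y => P.c ^ 2 * px t y - P.w * vx t y)
      = fun y => P.c ^ 2 * px t y + -P.w * vx t y := by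
    funext y; ring
  rw [e1, e2]
  exact ⟨h1.add hab.le (h3.const_mul _), (h3.const_mul _).add hab.le (h1.const_mul _)⟩

theorem integral_sq_combination_le {a b : ℝ} (hab : a ≤ b) {f g : ℝ → ℝ}
    (hf : MemLp f 2 (volume.restrict (Ioo a b))) (hg : MemLp g 2 (volume.restrict (Ioo a b)))
    (m k : ℝ) :
    ∫ x in a..b, (m * f x + k * g x) ^ 2
      ≤ 2 * m ^ 2 * (∫ x in a..b, f x ^ 2) + 2 * k ^ 2 * ∫ x in a..b, g x ^ 2 := by
  have i1 := intervalIntegrable_sq_of_memLp hab hf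
  have i2 := intervalIntegrable_sq_of_memLp hab hg
  rw [← intervalIntegral.integral_const_mul, ← intervalIntegral.integral_const_mul,
    ← intervalIntegral.integral_add (i1.const_mul _) (i2.const_mul _)]
  refine intervalIntegral.integral_mono_on hab
    (intervalIntegrable_sq_of_memLp hab ((hf.const_mul m).add (hg.const_mul k)))
    ((i1.const_mul _).add (i2.const_mul _)) fun x _ => ?_
  nlinarith [sq_nonneg (m * f x - k * g x)]

/-- The constant of the energy estimate. -/
noncomputable def rateConstant (P : Params) (K : ℝ) : ℝ :=
  Real.sqrt (256 * (P.c ^ 2 + 1) * K ^ 6 * (1 + P.w ^ 2 + P.c ^ 4))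

theorem energy_estimate {P : Params} {bc : BoundaryType} (hP : Admissible P bc) {K : ℝ}
    (hK : IsCoefBound P bc K) {q : ℕ} (hq : 1 ≤ q) {N : ℕ} {x : ℕ → ℝ} {h T : ℝ} (hN : 0 < N)
    (hT : 0 < T) (hx : ∀ j < N, x j < x (j + 1)) (hh : ∀ j < N, x (j + 1) - x j ≤ h)
    {u v : ℝ → ℝ → ℝ} (hsol : IsClassicalSolution P bc (x 0) (x N) T u v)
    (hreg : ∀ t ∈ Icc 0 T, MemSobolev (q + 2) (u t) (x 0) (x N) ∧
      MemSobolev (q + 1) (v t) (x 0) (x N))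
    {uh vh : ℝ → ℕ → ℝ[X]} (hdg : IsDGSolution P bc q N x T uh vh) {pu pv : ℝ → ℕ → ℝ[X]}
    (hproj : ∀ t ∈ Icc 0 T, ∀ j < N, IsProjection P bc q N x j (u t) (v t) (pu t j) (pv t j))
    {t : ℝ} (ht : t ∈ Icc 0 T) :
    ∃ D : ℝ, HasDerivWithinAt (fun s => errorEnergy P N x (pu s) (pv s) (uh s) (vh s)) D
        (Icc 0 T) t ∧
      D ≤ rateConstant P K * h ^ q
        * Real.sqrt (errorEnergy P N x (pu t) (pv t) (uh t) (vh t))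
        * Real.sqrt (sobolevSeminorm (q + 2) (u t) (x 0) (x N) ^ 2
            + sobolevSeminorm (q + 1) (v t) (x 0) (x N) ^ 2) := by
  have hab := mesh_lt hN hx
  have hh0 : 0 ≤ h := (sub_pos.2 (hx 0 hN)).le.trans (hh 0 hN)
  obtain ⟨px, vx, hsys, hC1⟩ := hsol.exists_regularSystem hab hT
  have hpx : ContinuousOn (px t) (Icc (x 0) (x N)) :=
    hsys.continuousOn_px.comp (f := fun y => (t, y)) (by fun_prop) fun y hy => mk_mem_prod ht hy
  have hvx : ContinuousOn (vx t) (Icc (x 0) (x N)) :=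
    hsys.continuousOn_vx.comp (f := fun y => (t, y)) (by fun_prop) fun y hy => mk_mem_prod ht hy
  set F : ℝ → ℝ := fun y => vx t y - P.w * px t y with hF
  set G : ℝ → ℝ := fun y => P.c ^ 2 * px t y - P.w * vx t y with hG
  have hFc : ContinuousOn F (Icc (x 0) (x N)) := by fun_prop
  have hGc : ContinuousOn G (Icc (x 0) (x N)) := by fun_prop
  have hsub : ∀ j < N, Icc (x j) (x (j + 1)) ⊆ Icc (x 0) (x N) := fun j hj =>
    Icc_subset_Icc (mesh_mono hx (by omega) (by omega)) (mesh_mono hx (by omega) le_rfl)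
  -- Projections of the time derivatives of `(p, v)`; zero polynomials serve as dummies outside the
  -- mesh.
  have hex : ∀ j, ∃ pp pv : ℝ[X], j < N → IsPairProjection q (leftCoef P bc j)
      (rightCoef P bc N j) (x j) (x (j + 1)) F G pp pv := by
    intro j
    by_cases hj : j < N
    · obtain ⟨pp, pv, hp⟩ := exists_isPairProjection hq (hP.det_pos N j).ne' (hx j hj)
        (hFc.mono (hsub j hj)) (hGc.mono (hsub j hj))
      exact ⟨pp, pv, fun _ => hp⟩
    · exact ⟨0, 0, fun h => absurd h hj⟩
  choose pp' pv' hpair' using hex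
  obtain ⟨D, hD, hDle⟩ := errorEnergy_deriv_le hP hq hN hx hT hsol hsys hdg hproj ht hpair'
  refine ⟨D, hD, hDle.trans ?_⟩
  have hcs := sum_integral_mul_le hx P.c (fun j => derivative (pu t j - uh t j))
    (fun j => pv t j - vh t j) (f := fun j y => (pp' j).eval y - F y)
    (g := fun j y => (pv' j).eval y - G y)
    (fun j hj => (pp' j).continuous.continuousOn.fun_sub (hFc.mono (hsub j hj)))
    (fun j hj => (pv' j).continuous.continuousOn.fun_sub (hGc.mono (hsub j hj)))
  refine hcs.trans ?_
  obtain ⟨hu, hv⟩ := hreg t ht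
  -- Order `i` of the time derivatives uses order `i + 2` of `u` and order `i + 1` of `v`, because
  -- both have already been differentiated in space.
  have hwd := fun i (hi : i ≤ q) => hsys.hasL2WeakDeriv hab ht (hC1 t ht)
    (hasL2WeakDeriv_weakDeriv (hu (i + 2) (by omega)))
    (hasL2WeakDeriv_weakDeriv (hv (i + 1) (by omega)))
  have herr := sum_projectionError_le hP hK hq hN hx hh hFc hGc
    (fun i hi => ⟨_, (hwd i hi.le).1⟩) (hwd q le_rfl).1
    (fun i hi => ⟨_, (hwd i hi.le).2⟩) (hwd q le_rfl).2 hpair'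
  have hLu := (hasL2WeakDeriv_weakDeriv (hu (q + 2) le_rfl)).2.1
  have hLv := (hasL2WeakDeriv_weakDeriv (hv (q + 1) le_rfl)).2.1
  have n1 := integral_sq_combination_le hab.le hLv hLu 1 (-P.w)
  have n2 := integral_sq_combination_le hab.le hLu hLv (P.c ^ 2) (-P.w)
  simp only [one_mul] at n1
  rw [← sobolevSeminorm_sq hab.le, ← sobolevSeminorm_sq hab.le] at n1 n2
  set Ru := sobolevSeminorm (q + 2) (u t) (x 0) (x N) ^ 2 with hRu
  set Rv := sobolevSeminorm (q + 1) (v t) (x 0) (x N) ^ 2 with hRv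
  set Δ := ∑ j ∈ Finset.range N, ∫ y in (x j)..(x (j + 1)),
        (((pp' j).eval y - F y) ^ 2 + ((pv' j).eval y - G y) ^ 2) with hΔ
  have hRu0 : 0 ≤ Ru := sq_nonneg _
  have hRv0 : 0 ≤ Rv := sq_nonneg _
  have hK0 := hK.1
  have hΔle : Δ ≤ 64 * K ^ 6 * h ^ (2 * q) * (2 * (1 + P.w ^ 2 + P.c ^ 4) * (Ru + Rv)) := by
    refine herr.trans ?_
    gcongr
    refine (add_le_add n1 n2).trans ?_
    have : 0 ≤ P.c ^ 4 * Rv := by positivity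
    have : 0 ≤ 1 * Ru := by positivity
    nlinarith
  have hE := errorEnergy_eq P N x (pu t) (pv t) (uh t) (vh t)
  set E := errorEnergy P N x (pu t) (pv t) (uh t) (vh t) with hEdef
  have hE0 : 0 ≤ E := errorEnergy_nonneg P hx _ _ _ _
  set X := ∑ j ∈ Finset.range N,
      ((∫ y in (x j)..(x (j + 1)), ((pv t j - vh t j).eval y) ^ 2)
        + P.c ^ 2 * ∫ y in (x j)..(x (j + 1)), ((derivative (pu t j - uh t j)).eval y) ^ 2)
  -- This factor two, the `64` of the projection estimate and the two in `hΔle` make up the `256` of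
  -- `rateConstant`.
  have hXE : X = 2 * E := by rw [hE]; ring
  rw [hXE]
  have hhq : h ^ q = Real.sqrt (h ^ (2 * q)) := by
    rw [mul_comm 2 q, pow_mul, Real.sqrt_sq (by positivity)]
  rw [rateConstant, hhq, ← Real.sqrt_mul (by positivity), ← Real.sqrt_mul (by positivity),
    ← Real.sqrt_mul (by positivity), ← Real.sqrt_mul (by positivity)]
  apply Real.sqrt_le_sqrt
  calc 2 * E * ((P.c ^ 2 + 1) * Δ)
      ≤ 2 * E * ((P.c ^ 2 + 1)
        * (64 * K ^ 6 * h ^ (2 * q) * (2 * (1 + P.w ^ 2 + P.c ^ 4) * (Ru + Rv)))) := by gcongr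
    _ = _ := by ring

/-- The triangle inequality through the projection. The factor `1 + 1/c²` removes the weight `c²` on
`∂u/∂x` in the energy. -/
theorem energyNormErrorSq_le {P : Params} {bc : BoundaryType} (hP : Admissible P bc) {K : ℝ}
    (hK : IsCoefBound P bc K) {q : ℕ} (hq : 1 ≤ q) {N : ℕ} {x : ℕ → ℝ} {h : ℝ} (hN : 0 < N)
    (hx : ∀ j < N, x j < x (j + 1)) (hh : ∀ j < N, x (j + 1) - x j ≤ h)
    {f g : ℝ → ℝ} (hf : ContDiffOn ℝ 1 f (Icc (x 0) (x N)))
    (hg : ContinuousOn g (Icc (x 0) (x N))) (hfS : MemSobolev (q + 1) f (x 0) (x N))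
    (hgS : MemSobolev q g (x 0) (x N)) {uh vh pu pv : ℕ → ℝ[X]}
    (hproj : ∀ j < N, IsProjection P bc q N x j f g (pu j) (pv j)) :
    energyNormErrorSq N x f g uh vh ≤ 4 * (1 + 1 / P.c ^ 2) * errorEnergy P N x pu pv uh vh
      + 128 * K ^ 6 * h ^ (2 * q) * (sobolevSeminorm (q + 1) f (x 0) (x N) ^ 2
        + sobolevSeminorm q g (x 0) (x N) ^ 2) := by
  have hab := mesh_lt hN hx
  set F := derivWithin f (Icc (x 0) (x N)) with hF
  have hFc : ContinuousOn F (Icc (x 0) (x N)) := continuousOn_derivWithin_Icc hab hf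
  have hFd : ∀ y ∈ Icc (x 0) (x N), HasDerivWithinAt f (F y) (Icc (x 0) (x N)) y :=
    fun y hy => ((hf.differentiableOn (by norm_num)) y hy).hasDerivWithinAt
  have hwF := fun i (hi : i ≤ q) => HasL2WeakDeriv.of_hasDerivWithinAt hab hFd hFc
    (hasL2WeakDeriv_weakDeriv (hfS (i + 1) (by omega)))
  have hwG := fun i (hi : i ≤ q) => hasL2WeakDeriv_weakDeriv (hgS i hi)
  have herr := sum_projectionError_le hP hK hq hN hx hh hFc hg
    (fun i hi => ⟨_, hwF i hi.le⟩) (hwF q le_rfl) (fun i hi => ⟨_, hwG i hi.le⟩) (hwG q le_rfl)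
    (fun j hj => (isProjection_iff.1 (hproj j hj)).2.1)
  rw [← sobolevSeminorm_sq hab.le, ← sobolevSeminorm_sq hab.le] at herr
  have hc := hP.c_pos
  have hmain : energyNormErrorSq N x f g uh vh ≤ 4 * (1 + 1 / P.c ^ 2) *
      errorEnergy P N x pu pv uh vh + 2 * ∑ j ∈ Finset.range N, ∫ y in (x j)..(x (j + 1)),
        (((derivative (pu j)).eval y - F y) ^ 2 + ((pv j).eval y - g y) ^ 2) := by
    rw [errorEnergy, energyNormErrorSq, ← mul_assoc, Finset.mul_sum, Finset.mul_sum,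
      ← Finset.sum_add_distrib]
    refine Finset.sum_le_sum fun j hj => ?_
    have hj' := Finset.mem_range.1 hj
    have hyz := (hx j hj').le
    have hsub : Icc (x j) (x (j + 1)) ⊆ Icc (x 0) (x N) :=
      Icc_subset_Icc (mesh_mono hx (by omega) (by omega)) (mesh_mono hx (by omega) le_rfl)
    have hF1 := hFc.mono hsub
    have hg1 := hg.mono hsub
    rw [← intervalIntegral.integral_const_mul, ← intervalIntegral.integral_const_mul,
      ← intervalIntegral.integral_add (Continuous.intervalIntegrable (by fun_prop) _ _)
        (ContinuousOn.intervalIntegrable_of_Icc hyz (by fun_prop))]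
    refine intervalIntegral.integral_mono_on hyz
      (ContinuousOn.intervalIntegrable_of_Icc hyz
        (((hF1.sub (derivative (uh j)).continuous.continuousOn).pow 2).add
          ((hg1.sub (vh j).continuous.continuousOn).pow 2)))
      (ContinuousOn.intervalIntegrable_of_Icc hyz (by fun_prop)) fun y _ => ?_
    simp only [derivative_sub, eval_sub]
    set A := (derivative (pu j)).eval y - F y
    set B := (pv j).eval y - g y
    set ψ := (derivative (pu j)).eval y - (derivative (uh j)).eval y with hψ
    set χ := (pv j).eval y - (vh j).eval y with hχ
    have e1 : F y - (derivative (uh j)).eval y = ψ - A := by ring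
    have e2 : g y - (vh j).eval y = χ - B := by ring
    have e3 : 4 * (1 + 1 / P.c ^ 2) * (1 / 2) * (χ ^ 2 + P.c ^ 2 * ψ ^ 2)
        = 2 * χ ^ 2 + 2 * P.c ^ 2 * ψ ^ 2 + 2 * (χ ^ 2 / P.c ^ 2) + 2 * ψ ^ 2 := by
      field_simp; ring
    rw [e1, e2, e3]
    have p1 : 0 ≤ χ ^ 2 / P.c ^ 2 := by positivity
    have p2 : 0 ≤ P.c ^ 2 * ψ ^ 2 := by positivity
    nlinarith [sq_nonneg (ψ + A), sq_nonneg (χ + B)]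
  linarith

/-- For `α = 1/2` the terms in `w(1/2 - α)` vanish, and both sides of the subsonic condition are
squares of nonnegative numbers, so the inequality reduces to one between their roots. -/
theorem sommerfeld_fluxStable_iff {c w ξ : ℝ} (hc : 0 < c) (hξ : 0 < ξ) :
    FluxStable (sommerfeld c w ξ) ↔ |w| ≤ 2 * c ^ 2 * ξ / (c ^ 2 + ξ ^ 2) := by
  have hden : 0 < c ^ 2 + ξ ^ 2 := by positivity
  have e1 : w ^ 2 * (c ^ 2 * (1 / (2 * ξ)) + ξ / 2) ^ 2
      = (|w| * ((c ^ 2 + ξ ^ 2) / (2 * ξ))) ^ 2 := by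
    rw [mul_pow, sq_abs]; congr 2; field_simp
  have e2 : 4 * c ^ 2 * (ξ / 2 + w * (1 / 2 - 1 / 2)) * (c ^ 2 * (1 / (2 * ξ)) - w * (1 / 2 - 1 / 2))
      = (c ^ 2) ^ 2 := by field_simp; ring
  simp only [FluxStable, sommerfeld]
  rw [e1, e2, sq_le_sq₀ (by positivity) (by positivity), le_div_iff₀ hden, ← mul_div_assoc,
    div_le_iff₀ (by positivity)]
  constructor <;> intro h <;> linarith

end AdvectiveDG

/-! ### The choice of the constant and the proof of the theorem. -/

theorem mainTheorem2 :
    -- estimates for all admissible parameters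
    (∀ (q : ℕ) (P : AdvectiveDG.Params) (bc : AdvectiveDG.BoundaryType),
      1 ≤ q → AdvectiveDG.Admissible P bc →
      -- the projection exists, is unique, and makes all the flux errors vanish
      (∀ (N : ℕ) (x : ℕ → ℝ), 0 < N → (∀ j < N, x j < x (j + 1)) →
        ∀ f g : ℝ → ℝ, ContDiffOn ℝ 1 f (Set.Icc (x 0) (x N)) →
          ContinuousOn g (Set.Icc (x 0) (x N)) →
          (∀ j < N, ∃! p : Polynomial ℝ × Polynomial ℝ,
            AdvectiveDG.IsProjection P bc q N x j f g p.1 p.2) ∧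
          ∀ pu pv : ℕ → Polynomial ℝ,
            (∀ j < N, AdvectiveDG.IsProjection P bc q N x j f g (pu j) (pv j)) →
            ∀ i ≤ N,
              AdvectiveDG.nodeFlux P bc N
                (fun j => AdvectiveDG.errTrace (x 0) (x N) f g (pu j) (pv j) (x j))
                (fun j => AdvectiveDG.errTrace (x 0) (x N) f g (pu j) (pv j) (x (j + 1))) i
                = ⟨0, 0⟩) ∧
      -- the energy and error estimates
      ∃ C : ℝ, 0 < C ∧
        ∀ (N : ℕ) (x : ℕ → ℝ) (h T : ℝ), 0 < N → 0 < T →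
          (∀ j < N, x j < x (j + 1)) → (∀ j < N, x (j + 1) - x j ≤ h) →
        ∀ u v : ℝ → ℝ → ℝ,
          AdvectiveDG.IsClassicalSolution P bc (x 0) (x N) T u v →
          (∀ t ∈ Set.Icc 0 T, AdvectiveDG.MemSobolev (q + 2) (u t) (x 0) (x N) ∧
            AdvectiveDG.MemSobolev (q + 1) (v t) (x 0) (x N)) →
        ∀ uh vh : ℝ → ℕ → Polynomial ℝ, AdvectiveDG.IsDGSolution P bc q N x T uh vh →
        ∀ pu pv : ℝ → ℕ → Polynomial ℝ,
          (∀ t ∈ Set.Icc 0 T, ∀ j < N,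
            AdvectiveDG.IsProjection P bc q N x j (u t) (v t) (pu t j) (pv t j)) →
          (∀ t ∈ Set.Icc 0 T, ∃ D : ℝ,
            HasDerivWithinAt
              (fun s => AdvectiveDG.errorEnergy P N x (pu s) (pv s) (uh s) (vh s)) D
              (Set.Icc 0 T) t ∧
            D ≤ C * h ^ q
              * Real.sqrt (AdvectiveDG.errorEnergy P N x (pu t) (pv t) (uh t) (vh t))
              * Real.sqrt (AdvectiveDG.sobolevSeminorm (q + 2) (u t) (x 0) (x N) ^ 2
                  + AdvectiveDG.sobolevSeminorm (q + 1) (v t) (x 0) (x N) ^ 2)) ∧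
          ((∀ j < N, uh 0 j = pu 0 j ∧ vh 0 j = pv 0 j) →
            ∀ M : ℝ,
              (∀ t ∈ Set.Icc 0 T,
                AdvectiveDG.sobolevSeminorm (q + 2) (u t) (x 0) (x N) ^ 2
                  + AdvectiveDG.sobolevSeminorm (q + 1) (v t) (x 0) (x N) ^ 2 ≤ M) →
              AdvectiveDG.energyNormErrorSq N x (u T) (v T) (uh T) (vh T) ≤
                C * h ^ (2 * q) *
                  (AdvectiveDG.sobolevSeminorm (q + 1) (u T) (x 0) (x N) ^ 2
                    + AdvectiveDG.sobolevSeminorm q (v T) (x 0) (x N) ^ 2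
                    + T ^ 2 * M))) ∧
    -- the Sommerfeld flux is an instance
    (∀ c w ξ : ℝ, 0 < c → 0 < ξ →
      (AdvectiveDG.sommerfeld c w ξ).α * (1 - (AdvectiveDG.sommerfeld c w ξ).α) =
          (AdvectiveDG.sommerfeld c w ξ).β * (AdvectiveDG.sommerfeld c w ξ).η ∧
      (AdvectiveDG.FluxStable (AdvectiveDG.sommerfeld c w ξ) ↔
        |w| ≤ 2 * c ^ 2 * ξ / (c ^ 2 + ξ ^ 2))) := by
  refine ⟨fun q P bc hq hP => ⟨fun N x hN hx f g hf hg =>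
    ⟨fun j hj => AdvectiveDG.existsUnique_isProjection hP hq hN hx hf hg hj,
      fun pu pv hproj => AdvectiveDG.nodeFlux_error_eq_zero hP hN
        (fun j hj => (hproj j hj).left_end) (fun j hj => (hproj j hj).right_end)⟩, ?_⟩,
    fun c w ξ hc hξ => ⟨?_, AdvectiveDG.sommerfeld_fluxStable_iff hc hξ⟩⟩
  · obtain ⟨K, hK⟩ : ∃ K, AdvectiveDG.IsCoefBound P bc K := AdvectiveDG.exists_isCoefBound P bc
    have hK0 := hK.1
    have hc := hP.c_pos
    set C₁ := AdvectiveDG.rateConstant P K with hC₁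
    have hC₁0 : 0 ≤ C₁ := Real.sqrt_nonneg _
    -- A single constant has to dominate three: the rate in the energy inequality, its square after
    -- integration in time (with the factor passing from the energy to the error norm), and the
    -- projection error at time `T`.
    set C := C₁ + (1 + 1 / P.c ^ 2) * C₁ ^ 2 + 128 * K ^ 6 with hC
    have hCa : C₁ ≤ C := by
      have : 0 ≤ (1 + 1 / P.c ^ 2) * C₁ ^ 2 + 128 * K ^ 6 := by positivity
      linarith
    have hCb : (1 + 1 / P.c ^ 2) * C₁ ^ 2 ≤ C := by
      have : 0 ≤ C₁ + 128 * K ^ 6 := by positivity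
      linarith
    have hCc : 128 * K ^ 6 ≤ C := by
      have : 0 ≤ C₁ + (1 + 1 / P.c ^ 2) * C₁ ^ 2 := by positivity
      linarith
    refine ⟨C, by positivity, ?_⟩
    intro N x h T hN hT hx hh u v hsol hreg uh vh hdg pu pv hproj
    have hh0 : 0 ≤ h := (sub_pos.2 (hx 0 hN)).le.trans (hh 0 hN)
    have hest := fun t ht =>
      AdvectiveDG.energy_estimate hP hK hq hN hT hx hh hsol hreg hdg hproj (t := t) ht
    refine ⟨fun t ht => ?_, fun hinit M hM => ?_⟩
    · obtain ⟨D, hD, hle⟩ := hest t ht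
      refine ⟨D, hD, hle.trans ?_⟩
      gcongr
    · have hab := AdvectiveDG.mesh_lt hN hx
      have hTm : T ∈ Set.Icc 0 T := Set.right_mem_Icc.2 hT.le
      have hM0 : 0 ≤ M := (add_nonneg (sq_nonneg _) (sq_nonneg _)).trans (hM T hTm)
      -- The bound `M` makes the growth rate constant in time, and the energy starts at zero because
      -- the initial data are the projection.
      have hE := AdvectiveDG.le_sq_of_deriv_le_mul_sqrt (B := C₁ * h ^ q * Real.sqrt M) hT
        (by positivity)
        (E := fun s => AdvectiveDG.errorEnergy P N x (pu s) (pv s) (uh s) (vh s))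
        (fun t _ => AdvectiveDG.errorEnergy_nonneg P hx _ _ _ _)
        (by
          simp only [AdvectiveDG.errorEnergy]
          rw [Finset.sum_eq_zero, mul_zero]
          intro j hj
          obtain ⟨e1, e2⟩ := hinit j (Finset.mem_range.1 hj)
          rw [e1, e2]
          simp)
        (fun t ht => by
          obtain ⟨D, hD, hle⟩ := hest t ht
          refine ⟨D, hD, hle.trans ?_⟩
          rw [mul_right_comm (C₁ * h ^ q)]
          gcongr
          exact hM t ht)
      obtain ⟨px, vx, hsys, hC1⟩ := hsol.exists_regularSystem hab hT
      obtain ⟨hu, hv⟩ := hreg T hTm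
      have hfin := AdvectiveDG.energyNormErrorSq_le hP hK hq hN hx hh (hC1 T hTm)
        (fun y hy => (hsys.deriv_v T hTm y hy).continuousWithinAt)
        (fun i hi => hu i (by omega)) (fun i hi => hv i (by omega)) (uh := uh T) (vh := vh T)
        (hproj T hTm)
      refine hfin.trans ?_
      set R := AdvectiveDG.sobolevSeminorm (q + 1) (u T) (x 0) (x N) ^ 2
        + AdvectiveDG.sobolevSeminorm q (v T) (x 0) (x N) ^ 2 with hR
      have hR0 : 0 ≤ R := add_nonneg (sq_nonneg _) (sq_nonneg _)
      calc _ ≤ 4 * (1 + 1 / P.c ^ 2) * (C₁ * h ^ q * Real.sqrt M * T / 2) ^ 2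
            + 128 * K ^ 6 * h ^ (2 * q) * R := by gcongr
        _ = (1 + 1 / P.c ^ 2) * C₁ ^ 2 * (h ^ (2 * q) * (T ^ 2 * Real.sqrt M ^ 2))
            + 128 * K ^ 6 * (h ^ (2 * q) * R) := by ring
        _ ≤ C * (h ^ (2 * q) * (T ^ 2 * Real.sqrt M ^ 2)) + C * (h ^ (2 * q) * R) := by gcongr
        _ = _ := by rw [Real.sq_sqrt hM0]; ring
  · simp only [AdvectiveDG.sommerfeld]
    field_simp
    norm_num
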